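/- Let $G$ be a finite-dimensional real Lie group with Lie algebra $\mathfrak g$. Put $\langle \mathrm{Ad}^*(u)j,\xi\rangle=\langle j,\mathrm{Ad}(u)\xi\rangle$, and let $H=G\ltimes\mathfrak g^*$ with $(u_1,a_1)(u_2,a_2)=(u_1u_2,\,a_1+\mathrm{Ad}^*(u_1^{-1})a_2)$. On its Lie algebra $\mathfrak g\oplus\mathfrak g^*$ use the invariant pairing $\langle(\xi,a),(\eta,b)\rangle=a(\eta)+b(\xi)$ and the bracket $[(\xi,a),(\eta,b)]=([\xi,\eta],\,a\circ\mathrm{ad}_\eta-b\circ\mathrm{ad}_\xi)$. Let $\mathfrak c\subset\mathfrak g\oplus\mathfrak g^*$ be an abelian Lie subalgebra of the form $\mathfrak c=\mathfrak t\oplus\mathfrak t'$ with $\mathfrak t\subset\mathfrak g$, $\mathfrak t'\subset\mathfrak g^*$ (for instance an abelian Cartan subalgebra of this form). Let $k\in\mathbb R$ and let $n,g\ge 0$ be integers. For $1\le i\le n$ let $(\mu_i,s_i)\in\mathfrak g\oplus\mathfrak g^*$ be constants with $[(\mu_i,0),(0,s_i)]=0$ (for instance elements of Cartan subalgebras as above),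 and put $C_i=(e^{\mu_i},s_i)$. Let $P$ be a finite-dimensional smooth manifold carrying smooth functions $g_i=(v_{M_i},x_{M_i})$ $(1\le i\le n)$, $A_i,B_i$ $(1\le i\le g)$, $g_\infty=(v_\infty,x_\infty)$ and $w$ with values in $H$, and $(\mu,s)$ with values in $\mathfrak c$. Write $$M_i=(u_{M_i},-\mathrm{Ad}^*(u_{M_i}^{-1})j_{M_i})=(v_{M_i},x_{M_i})(e^{-\mu_i},-s_i)(v_{M_i},x_{M_i})^{-1},$$ $$A_i=(u_{A_i},-\mathrm{Ad}^*(u_{A_i}^{-1})j_{A_i}),\qquad B_i=(u_{B_i},-\mathrm{Ad}^*(u_{B_i}^{-1})j_{B_i}).$$ Define $K_0=1$ and, with $[b,a]=bab^{-1}a^{-1}$, $$K_i^{-1}=M_i\cdots M_1\ (1\le i\le n),\qquad K_{n+2i-1}^{-1}=A_i[B_{i-1},A_{i-1}^{-1}]\cdots[B_1,A_1^{-1}]M_n\cdots M_1,$$ $$K_{n+2i}^{-1}=[B_i,A_i^{-1}]\cdots[B_1,A_1^{-1}]M_n\cdots M_1\quad(1\le i\le g),$$ and assume that on $P$ (with $K=K_{n+2g}$)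 $$K^{-1}=(u_K,-\mathrm{Ad}^*(u_K^{-1})j_K)=(v_\infty,x_\infty)(e^{-\mu},-s)(v_\infty,x_\infty)^{-1}.$$ Let $\delta$ be the exterior derivative on $P$; pairings of two one-forms are wedge products, $\langle\alpha\wedge\beta\rangle(X,Y)=\langle\alpha(X),\beta(Y)\rangle-\langle\alpha(Y),\beta(X)\rangle$. Consider the two-form $$\begin{aligned}\Omega=&\tfrac{k}{4\pi}\sum_{i=1}^n\langle C_ig_i^{-1}\delta g_i\,C_i^{-1}\wedge g_i^{-1}\delta g_i\rangle-\tfrac{k}{4\pi}\sum_{i=1}^{n+2g}\langle\delta K_iK_i^{-1}\wedge\delta K_{i-1}K_{i-1}^{-1}\rangle\\&-\tfrac{k}{4\pi}\sum_{i=1}^g\Big(\langle A_i^{-1}\delta A_i\wedge B_i^{-1}\delta B_i\rangle+\langle\delta(B_iA_iB_i^{-1})\,B_iA_i^{-1}B_i^{-1}\wedge\delta B_i\,B_i^{-1}\rangle\Big)\\&+\tfrac{k}{2\pi}\,\delta\langle(\mu,s),w^{-1}\delta w\rangle+\tfrac{k}{4\pi}\langle K^{-1}\delta K\wedge\delta g_\infty\,g_\infty^{-1}\rangle+\tfrac{k}{4\pi}\langle(\delta\mu,\delta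 s)\wedge g_\infty^{-1}\delta g_\infty\rangle .\end{aligned}$$ Then $\Omega$ is exact; more precisely, the one-form in the brackets below is smooth and $$\Omega=\tfrac{k}{2\pi}\,\delta\Big(\langle(\mu,s),w^{-1}\delta w\rangle+\Theta+\langle j_K,\delta v_\infty v_\infty^{-1}\rangle-\langle\mathrm{Ad}^*(v_\infty)x_\infty-\tfrac12 s,\ \delta\mu\rangle\Big),$$ where, with $R(u)=\delta u\,u^{-1}$, $U_i=u_{M_i}\cdots u_{M_1}$, $u_{H_i}=u_{B_i}u_{A_i}^{-1}u_{B_i}^{-1}u_{A_i}$ and $W_i=u_{H_i}\cdots u_{H_1}u_{M_n}\cdots u_{M_1}$, $$\begin{aligned}\Theta=&\sum_{i=1}^n\langle R(U_{i-1})-R(v_{M_i}),\,j_{M_i}\rangle+\sum_{i=1}^g\langle R(W_{i-1})-R(u_{A_i}^{-1}u_{B_i}^{-1}u_{A_i}W_{i-1}),\,j_{A_i}\rangle\\&+\sum_{i=1}^g\langle R(u_{A_i}^{-1}u_{B_i}^{-1}u_{A_i}W_{i-1})-R(u_{B_i}^{-1}u_{A_i}W_{i-1}),\,j_{B_i}\rangle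 .\end{aligned}$$ -/

import Mathlib

open scoped Manifold ContDiff

noncomputable section

namespace FlatConn

/-! ### Lie groups: adjoint action, exponential, Maurer-Cartan forms, exterior derivative -/

section General

variable {V : Type*} [NormedAddCommGroup V] [NormedSpace ℝ V]
  {N : Type*} [TopologicalSpace N] (I : ModelWithCorners ℝ V N)
  {L : Type*} [TopologicalSpace L] [ChartedSpace N L] [Group L]

/-- The adjoint action of `a ∈ L` on the Lie algebra `T₁L = V`: the derivative at `1` of
conjugation by `a`. -/
def Ad (a : L) : V →L[ℝ] V :=
  mfderiv I I (fun y : L => a * y * a⁻¹) 1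

/-- `c = exp ξ`: the element `c` is the value at time one of a one-parameter subgroup with
initial velocity `ξ ∈ T₁L = V`. -/
def IsExp (ξ : V) (c : L) : Prop :=
  ∃ φ : ℝ → L, (∀ r t : ℝ, φ (r + t) = φ r * φ t) ∧
    HasMFDerivAt 𝓘(ℝ, ℝ) I φ 0 ((ContinuousLinearMap.id ℝ ℝ).smulRight ξ : ℝ →L[ℝ] V) ∧
    φ 1 = c

variable {F : Type*} [NormedAddCommGroup F] [NormedSpace ℝ F]
  {P : Type*} [TopologicalSpace P] [ChartedSpace F P]

/-- `h⁻¹ δh`: the pull-back of the left-invariant Maurer-Cartan form along `h : P → L`.  At `p`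
it is the differential of `y ↦ h(p)⁻¹ h(y)`, with values in `T₁L = V`. -/
def leftMC (h : P → L) (p : P) : F →L[ℝ] V :=
  mfderiv 𝓘(ℝ, F) I (fun y => (h p)⁻¹ * h y) p

/-- `δh h⁻¹`: the pull-back of the right-invariant Maurer-Cartan form along `h : P → L`.  At `p`
it is the differential of `y ↦ h(y) h(p)⁻¹`, with values in `T₁L = V`. -/
def rightMC (h : P → L) (p : P) : F →L[ℝ] V :=
  mfderiv 𝓘(ℝ, F) I (fun y => h y * (h p)⁻¹) p

/-- The differential `δf` of a vector-valued function on `P`. -/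
def dFun {W : Type*} [NormedAddCommGroup W] [NormedSpace ℝ W] (f : P → W) (p : P) : F →L[ℝ] W :=
  mfderiv 𝓘(ℝ, F) 𝓘(ℝ, W) f p

/-- The expression of a one-form on `P` in the preferred chart at `p₀`, i.e. its pull-back along
the inverse of that chart. -/
def chartForm (η : P → F →L[ℝ] ℝ) (p₀ : P) (z : F) : F →L[ℝ] ℝ :=
  (η ((extChartAt 𝓘(ℝ, F) p₀).symm z)).comp
    (mfderiv 𝓘(ℝ, F) 𝓘(ℝ, F) (extChartAt 𝓘(ℝ, F) p₀).symm z : F →L[ℝ] F)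

/-- A one-form on `P` is smooth if it is so in every preferred chart. -/
def SmoothOneForm (η : P → F →L[ℝ] ℝ) : Prop :=
  ∀ p₀ : P, ContDiffOn ℝ ∞ (chartForm η p₀) (extChartAt 𝓘(ℝ, F) p₀).target

/-- The exterior derivative of a one-form on `P`, computed at `p` in the preferred chart at `p`
(which identifies `T_pP` with `F`); normalised by
`dω(X, Y) = X(ω(Y)) - Y(ω(X)) - ω([X, Y])`. -/
def extD (η : P → F →L[ℝ] ℝ) (p : P) (X Y : F) : ℝ :=
  extDeriv
    (fun z => ContinuousAlternatingMap.ofSubsingleton ℝ F ℝ (0 : Fin 1) (chartForm η p z))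
    (extChartAt 𝓘(ℝ, F) p p) ![X, Y]

end General

/-! ### Words in the holonomies -/

section Words

variable {Q : Type*} [Group Q]

/-- `M_m ⋯ M_1`; the families are indexed from `0`, so `M_i` is `M (i - 1)`. -/
def prodM (M : ℕ → Q) : ℕ → Q
  | 0 => 1
  | m + 1 => M m * prodM M m

/-- `[B_l, A_l⁻¹] ⋯ [B_1, A_1⁻¹] M_n ⋯ M_1`, where `[b, a] = b a b⁻¹ a⁻¹`. -/
def prodH (n : ℕ) (M A B : ℕ → Q) : ℕ → Q
  | 0 => prodM M n
  | l + 1 => (B l * (A l)⁻¹ * (B l)⁻¹ * A l) * prodH n M A B l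

/-- The elements `K_i⁻¹`:
`K_i⁻¹ = M_i ⋯ M_1` for `i ≤ n`,
`K_{n+2l+1}⁻¹ = A_{l+1} [B_l, A_l⁻¹] ⋯ [B_1, A_1⁻¹] M_n ⋯ M_1`, and
`K_{n+2l}⁻¹ = [B_l, A_l⁻¹] ⋯ [B_1, A_1⁻¹] M_n ⋯ M_1`. -/
def Kinv (n : ℕ) (M A B : ℕ → Q) (i : ℕ) : Q :=
  if i ≤ n then prodM M i
  else if (i - n) % 2 = 1 then A ((i - n) / 2) * prodH n M A B ((i - n) / 2)
  else prodH n M A B ((i - n) / 2)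

end Words

/-! ### The group `G ⋉ 𝔤*`; here `𝔤 = T₁G = E` -/

section Semidirect

variable {E : Type*} [NormedAddCommGroup E] [NormedSpace ℝ E]
  {G : Type*} [TopologicalSpace G] [ChartedSpace E G] [Group G]

/-- `Ad*(u)`, the algebraic dual of `Ad(u)`: `⟨Ad*(u) j, ξ⟩ = ⟨j, Ad(u) ξ⟩`. -/
def coAd (u : G) (j : E →L[ℝ] ℝ) : E →L[ℝ] ℝ :=
  j.comp (Ad 𝓘(ℝ, E) u)

/-- The bracket of `𝔤`. -/
def lieBr (G : Type*) [TopologicalSpace G] [ChartedSpace E G] [Group G] (ξ ζ : E) : E :=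
  Bracket.bracket (L := GroupLieAlgebra 𝓘(ℝ, E) G) (M := GroupLieAlgebra 𝓘(ℝ, E) G) ξ ζ

/-- The bracket of `𝔤 ⊕ 𝔤*`, the Lie algebra of `G ⋉ 𝔤*`:
`[(ξ, a), (ζ, b)] = ([ξ, ζ], a ∘ ad ζ - b ∘ ad ξ)`.  The second component is given as a function
on `𝔤`. -/
def sdBracket (G : Type*) [TopologicalSpace G] [ChartedSpace E G] [Group G]
    (z z' : E × (E →L[ℝ] ℝ)) : E × (E → ℝ) :=
  (lieBr G z.1 z'.1, fun ξ => z.2 (lieBr G z'.1 ξ) - z'.2 (lieBr G z.1 ξ))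

variable (E G) in
/-- The underlying set `G × 𝔤*` of `G ⋉ 𝔤*`. -/
def SemiDual := G × (E →L[ℝ] ℝ)

instance : TopologicalSpace (SemiDual E G) :=
  inferInstanceAs (TopologicalSpace (G × (E →L[ℝ] ℝ)))

instance : ChartedSpace (ModelProd E (E →L[ℝ] ℝ)) (SemiDual E G) :=
  inferInstanceAs (ChartedSpace (ModelProd E (E →L[ℝ] ℝ)) (G × (E →L[ℝ] ℝ)))

variable (E) in
/-- The model of `G ⋉ 𝔤*` as a manifold; its tangent space at `1` is `𝔤 ⊕ 𝔤* = E × E*`. -/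
abbrev sdModel : ModelWithCorners ℝ (E × (E →L[ℝ] ℝ)) (ModelProd E (E →L[ℝ] ℝ)) :=
  𝓘(ℝ, E).prod 𝓘(ℝ, E →L[ℝ] ℝ)

/-- The element `(u, a)` of `G ⋉ 𝔤*`. -/
def SemiDual.mk (u : G) (a : E →L[ℝ] ℝ) : SemiDual E G := (u, a)

theorem Ad_one : Ad 𝓘(ℝ, E) (1 : G) = ContinuousLinearMap.id ℝ E := by
  have h : (fun y : G => 1 * y * 1⁻¹) = id := by funext y; simp
  unfold Ad
  rw [h]
  exact mfderiv_id

theorem Ad_mul [LieGroup 𝓘(ℝ, E) ∞ G] (u v : G) :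
    Ad 𝓘(ℝ, E) (u * v) = (Ad 𝓘(ℝ, E) u).comp (Ad 𝓘(ℝ, E) v) := by
  have hc : ∀ (w y : G), MDifferentiableAt 𝓘(ℝ, E) 𝓘(ℝ, E) (fun y : G => w * y * w⁻¹) y := by
    intro w y
    have h1 : ContMDiff 𝓘(ℝ, E) 𝓘(ℝ, E) ∞ (fun y : G => w * y * w⁻¹) :=
      (contMDiff_const.mul contMDiff_id).mul contMDiff_const
    exact (h1 y).mdifferentiableAt (by simp)
  have h : (fun y : G => u * v * y * (u * v)⁻¹)
      = (fun y : G => u * y * u⁻¹) ∘ (fun y : G => v * y * v⁻¹) := by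
    funext y; simp [mul_assoc]
  have hcomp := mfderiv_comp (I := 𝓘(ℝ, E)) (I' := 𝓘(ℝ, E)) (I'' := 𝓘(ℝ, E)) (1 : G)
    (hc u (v * 1 * v⁻¹)) (hc v 1)
  rw [← h] at hcomp
  have e : ∀ q : G, q = 1 →
      (mfderiv 𝓘(ℝ, E) 𝓘(ℝ, E) (fun y : G => u * y * u⁻¹) q : E →L[ℝ] E) = Ad 𝓘(ℝ, E) u := by
    rintro q rfl
    rfl
  exact hcomp.trans (congrArg (fun T : E →L[ℝ] E => T.comp (Ad 𝓘(ℝ, E) v))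
    (e (v * 1 * v⁻¹) (by simp)))

/-- The multiplication `(u₁, a₁) (u₂, a₂) = (u₁ u₂, a₁ + Ad*(u₁⁻¹) a₂)`. -/
instance [LieGroup 𝓘(ℝ, E) ∞ G] : Group (SemiDual E G) where
  mul h h' := (h.1 * h'.1, h.2 + coAd h.1⁻¹ h'.2)
  one := (1, 0)
  inv h := (h.1⁻¹, -coAd h.1 h.2)
  mul_assoc h h' h'' := by
    refine Prod.ext (mul_assoc h.1 h'.1 h''.1) ?_
    change h.2 + coAd h.1⁻¹ h'.2 + coAd (h.1 * h'.1)⁻¹ h''.2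
      = h.2 + coAd h.1⁻¹ (h'.2 + coAd h'.1⁻¹ h''.2)
    rw [mul_inv_rev]
    simp only [coAd, Ad_mul, ContinuousLinearMap.add_comp, ContinuousLinearMap.comp_assoc,
      add_assoc]
  one_mul h := by
    refine Prod.ext (one_mul h.1) ?_
    change 0 + coAd (1 : G)⁻¹ h.2 = h.2
    simp only [coAd, inv_one, Ad_one, zero_add, ContinuousLinearMap.comp_id]
  mul_one h := by
    refine Prod.ext (mul_one h.1) ?_
    change h.2 + coAd h.1⁻¹ 0 = h.2
    simp only [coAd, ContinuousLinearMap.zero_comp, add_zero]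
  inv_mul_cancel h := by
    refine Prod.ext (inv_mul_cancel h.1) ?_
    change -coAd h.1 h.2 + coAd h.1⁻¹⁻¹ h.2 = 0
    rw [inv_inv, neg_add_cancel]

/-- The element `(u, -Ad*(u⁻¹) j)` of `G ⋉ 𝔤*`. -/
def ofUJ (u : G) (j : E →L[ℝ] ℝ) : SemiDual E G :=
  SemiDual.mk u (-coAd u⁻¹ j)

/-- The linear form `⟨z, ·⟩` of the pairing `⟨(ξ, a), (ζ, b)⟩ = a(ζ) + b(ξ)` on `𝔤 ⊕ 𝔤*`. -/
def pairing (z : E × (E →L[ℝ] ℝ)) : E × (E →L[ℝ] ℝ) →L[ℝ] ℝ :=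
  z.2.comp (ContinuousLinearMap.fst ℝ E (E →L[ℝ] ℝ)) +
    (ContinuousLinearMap.apply ℝ ℝ z.1).comp (ContinuousLinearMap.snd ℝ E (E →L[ℝ] ℝ))

variable {F : Type*} [NormedAddCommGroup F] [NormedSpace ℝ F]
  {P : Type*} [TopologicalSpace P] [ChartedSpace F P]

/-- `⟨α ∧ β⟩(X, Y) = ⟨α(X), β(Y)⟩ - ⟨α(Y), β(X)⟩` for `𝔤 ⊕ 𝔤*`-valued one-forms `α`, `β`
at a point. -/
def wedge (α β : F →L[ℝ] E × (E →L[ℝ] ℝ)) (X Y : F) : ℝ :=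
  pairing (α X) (β Y) - pairing (α Y) (β X)

/-- The one-form `⟨(μ, s), w⁻¹ δw⟩`. -/
def cotangentPotential [LieGroup 𝓘(ℝ, E) ∞ G] (μ : P → E) (s : P → E →L[ℝ] ℝ)
    (w : P → SemiDual E G) (p : P) : F →L[ℝ] ℝ :=
  (pairing (μ p, s p)).comp (leftMC (sdModel E) w p)

/-- The two-form
`Ω = k/4π Σᵢ ⟨Cᵢ gᵢ⁻¹δgᵢ Cᵢ⁻¹ ∧ gᵢ⁻¹δgᵢ⟩ - k/4π Σᵢ ⟨δKᵢ Kᵢ⁻¹ ∧ δKᵢ₋₁ Kᵢ₋₁⁻¹⟩`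
`- k/4π Σᵢ (⟨Aᵢ⁻¹δAᵢ ∧ Bᵢ⁻¹δBᵢ⟩ + ⟨δ(BᵢAᵢBᵢ⁻¹) BᵢAᵢ⁻¹Bᵢ⁻¹ ∧ δBᵢ Bᵢ⁻¹⟩)`
`+ k/2π δ⟨(μ, s), w⁻¹δw⟩ + k/4π ⟨K⁻¹δK ∧ δg_∞ g_∞⁻¹⟩ + k/4π ⟨(δμ, δs) ∧ g_∞⁻¹δg_∞⟩`
with `K = K_{n+2g}`. -/
def Omega [LieGroup 𝓘(ℝ, E) ∞ G] (k : ℝ) (n g : ℕ) (C : ℕ → SemiDual E G)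
    (gM M A B : ℕ → P → SemiDual E G) (gInf w : P → SemiDual E G)
    (μ : P → E) (s : P → E →L[ℝ] ℝ) (p : P) (X Y : F) : ℝ :=
  let K : ℕ → P → SemiDual E G := fun i q =>
    (Kinv n (fun l => M l q) (fun l => A l q) (fun l => B l q) i)⁻¹
  k / (4 * Real.pi) * ∑ i ∈ Finset.range n,
      wedge ((Ad (sdModel E) (C i)).comp (leftMC (sdModel E) (gM i) p))
        (leftMC (sdModel E) (gM i) p) X Y
    - k / (4 * Real.pi) * ∑ i ∈ Finset.range (n + 2 * g),
      wedge (rightMC (sdModel E) (K (i + 1)) p) (rightMC (sdModel E) (K i) p) X Y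
    - k / (4 * Real.pi) * ∑ i ∈ Finset.range g,
      (wedge (leftMC (sdModel E) (A i) p) (leftMC (sdModel E) (B i) p) X Y
        + wedge (rightMC (sdModel E) (fun q => B i q * A i q * (B i q)⁻¹) p)
            (rightMC (sdModel E) (B i) p) X Y)
    + k / (2 * Real.pi) * extD (cotangentPotential μ s w) p X Y
    + k / (4 * Real.pi) *
      wedge (leftMC (sdModel E) (K (n + 2 * g)) p) (rightMC (sdModel E) gInf p) X Y
    + k / (4 * Real.pi) *
      wedge ((dFun μ p).prod (dFun s p)) (leftMC (sdModel E) gInf p) X Y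

/-- The one-form `⟨j, δu u⁻¹⟩` for functions `u : P → G` and `j : P → 𝔤*`. -/
def jdu (j : P → E →L[ℝ] ℝ) (u : P → G) (p : P) : F →L[ℝ] ℝ :=
  (j p).comp (rightMC 𝓘(ℝ, E) u p)

/-- The one-form `Θ`.  Here `prodM uM i = u_{M_i} ⋯ u_{M_1}` and
`prodH n uM uA uB i = u_{H_i} ⋯ u_{H_1} u_{M_n} ⋯ u_{M_1}` with
`u_{H_i} = u_{B_i} u_{A_i}⁻¹ u_{B_i}⁻¹ u_{A_i}`, taken pointwise. -/
def Theta (n g : ℕ) (vM uM : ℕ → P → G) (jM : ℕ → P → E →L[ℝ] ℝ)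
    (uA : ℕ → P → G) (jA : ℕ → P → E →L[ℝ] ℝ) (uB : ℕ → P → G) (jB : ℕ → P → E →L[ℝ] ℝ)
    (p : P) : F →L[ℝ] ℝ :=
  ∑ i ∈ Finset.range n, (jdu (jM i) (prodM uM i) p - jdu (jM i) (vM i) p)
  + ∑ i ∈ Finset.range g,
      (jdu (jA i) (prodH n uM uA uB i) p
        - jdu (jA i) ((uA i)⁻¹ * (uB i)⁻¹ * uA i * prodH n uM uA uB i) p)
  + ∑ i ∈ Finset.range g,
      (jdu (jB i) ((uA i)⁻¹ * (uB i)⁻¹ * uA i * prodH n uM uA uB i) p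
        - jdu (jB i) ((uB i)⁻¹ * uA i * prodH n uM uA uB i) p)

/-- The one-form
`⟨(μ, s), w⁻¹δw⟩ + Θ + ⟨j_K, δv_∞ v_∞⁻¹⟩ - ⟨Ad*(v_∞) x_∞ - s/2, δμ⟩`. -/
def potential [LieGroup 𝓘(ℝ, E) ∞ G] (n g : ℕ) (vM uM : ℕ → P → G) (jM : ℕ → P → E →L[ℝ] ℝ)
    (uA : ℕ → P → G) (jA : ℕ → P → E →L[ℝ] ℝ) (uB : ℕ → P → G) (jB : ℕ → P → E →L[ℝ] ℝ)
    (jK : P → E →L[ℝ] ℝ) (vInf : P → G) (xInf : P → E →L[ℝ] ℝ) (w : P → SemiDual E G)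
    (μ : P → E) (s : P → E →L[ℝ] ℝ) (p : P) : F →L[ℝ] ℝ :=
  cotangentPotential μ s w p + Theta n g vM uM jM uA jA uB jB p + jdu jK vInf p
    - (coAd (vInf p) (xInf p) - (1 / 2 : ℝ) • s p).comp (dFun μ p)

end Semidirect

end FlatConn

end

/-! # Exactness of the two-form `Ω`

Write an element of `G ⋉ 𝔤*` as `h = (u, -Ad*(u⁻¹) j)` with *base* `u` and *moment* `j`.  In these
coordinates `moment (h h') = moment h' + Ad*(u') (moment h)`, and the components of `h⁻¹δh` and
`δh h⁻¹` are expressed through `u⁻¹δu`, `δu u⁻¹` and `δj` (`leftMC_semiDual`, `rightMC_semiDual`).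

For a function `h` on `P` put `β(h) = ⟨δj ∧ u⁻¹δu⟩` (`beta`), and for two functions `h`, `h'` let
`θ(h, h') = ⟨j, δu' u'⁻¹⟩` (`crossForm`).  Everything rests on the Polyakov-Wiegmann identity
(`polyakovWiegmann`)

  `⟨h⁻¹δh ∧ δh' h'⁻¹⟩ = β(h h') - β(h) - β(h') - 2 δθ(h, h')`,

a consequence of the Maurer-Cartan equation `maurerCartan` and the invariance of the pairing: the
pairing of the Maurer-Cartan forms is a coboundary up to an exact term, and the exact term is
explicit.  Up to the factor `k/4π`, every term of `Ω` except the exact term with `w` is of this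
kind, and modulo exact forms:

* the terms of the ordinary punctures add up to `-∑ β(M_i)` (`puncture`);
* the sum of the `⟨δK_i K_i⁻¹ ∧ δK_{i-1} K_{i-1}⁻¹⟩`, which `Ω` contains with a minus sign,
  telescopes to `β(K⁻¹) - ∑ β(M_i)` once the terms with `A_i` and `B_i` have removed the `β` of the
  factors of the commutators (`handle`, `sum_wedge_prodM`, `sum_wedge_prodH`);
* the last two terms give `β(K⁻¹)` (`distinguishedPuncture`).

All the `β` cancel, and the forms `θ` add up to the potential (`sum_contributions`).

For the distinguished puncture one has to know that `δ(exp μ) (exp μ)⁻¹ = δμ`.  The values of `μ`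
commute with each other, so the one-parameter subgroups that they generate commute and combine to a
homomorphism from a finite-dimensional vector space to `G`, through which `exp μ` factors
(`exists_hom_of_commuting`, `rightMC_exp`).  That they commute follows from the uniqueness of
integral curves (`IsOneParam.unique`).

The derivatives at `1` of translations and of `Ad` are computed in the preferred chart at `1`, where
`ad` is the antisymmetrised second derivative of the multiplication (`adL`, `lieBr_eq`,
`hasD_Ad_one`). -/

-- The completeness and the Lie group instances are assumed for whole sections.
set_option linter.unusedSectionVars false

noncomputable section

namespace FlatConn

open Filter
open scoped Topology

/-! ### Derivatives of maps into a Lie group -/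

section HasDerivative

variable {V : Type*} [NormedAddCommGroup V] [NormedSpace ℝ V]
  {N : Type*} [TopologicalSpace N] {I : ModelWithCorners ℝ V N}
  {L : Type*} [TopologicalSpace L] [ChartedSpace N L]
  {V' : Type*} [NormedAddCommGroup V'] [NormedSpace ℝ V']
  {N' : Type*} [TopologicalSpace N'] {I' : ModelWithCorners ℝ V' N'}
  {L' : Type*} [TopologicalSpace L'] [ChartedSpace N' L']
  {V'' : Type*} [NormedAddCommGroup V''] [NormedSpace ℝ V'']
  {N'' : Type*} [TopologicalSpace N''] {I'' : ModelWithCorners ℝ V'' N''}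
  {L'' : Type*} [TopologicalSpace L''] [ChartedSpace N'' L'']

variable (I I') in
/-- `HasMFDerivAt` with the derivative regarded as a continuous linear map between the model vector
spaces.  The tangent spaces at two points that agree only propositionally thus need not be
distinguished. -/
def HasD (f : L → L') (p : L) (T : V →L[ℝ] V') : Prop :=
  HasMFDerivAt I I' f p T

theorem HasD.mfderiv_eq {f : L → L'} {p : L} {T : V →L[ℝ] V'} (h : HasD I I' f p T) :
    (mfderiv I I' f p : V →L[ℝ] V') = T :=
  HasMFDerivAt.mfderiv h

theorem HasD.unique {f : L → L'} {p : L} {T T' : V →L[ℝ] V'} (h : HasD I I' f p T)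
    (h' : HasD I I' f p T') : T = T' :=
  hasMFDerivAt_unique h h'

theorem hasD_mfderiv {f : L → L'} {p : L} (h : MDifferentiableAt I I' f p) :
    HasD I I' f p (mfderiv I I' f p) :=
  h.hasMFDerivAt

theorem HasD.comp {f : L → L'} {g : L' → L''} {p : L} {q : L'} {T : V →L[ℝ] V'}
    {S : V' →L[ℝ] V''} (hg : HasD I' I'' g q S) (hf : HasD I I' f p T) (hq : f p = q) :
    HasD I I'' (fun y => g (f y)) p (S.comp T) := by
  subst hq
  exact HasMFDerivAt.comp (x := p) hg hf

theorem HasD.prodMk {f : L → L'} {g : L → L''} {p : L} {T : V →L[ℝ] V'} {S : V →L[ℝ] V''}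
    (hf : HasD I I' f p T) (hg : HasD I I'' g p S) :
    HasD I (I'.prod I'') (fun y => (f y, g y)) p (T.prod S) :=
  HasMFDerivAt.prodMk hf hg

theorem HasD.congr_of_eventuallyEq {f f' : L → L'} {p : L} {T : V →L[ℝ] V'} (h : HasD I I' f p T)
    (hf : f' =ᶠ[𝓝 p] f) : HasD I I' f' p T :=
  HasMFDerivAt.congr_of_eventuallyEq h hf

theorem hasD_const (a : L') (p : L) : HasD I I' (fun _ : L => a) p 0 :=
  hasMFDerivAt_const a p

theorem hasD_id (p : L) : HasD I I (fun y : L => y) p (ContinuousLinearMap.id ℝ V) :=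
  hasMFDerivAt_id p

theorem hasD_iff_hasFDerivAt {f : V → V'} {p : V} {T : V →L[ℝ] V'} :
    HasD 𝓘(ℝ, V) 𝓘(ℝ, V') f p T ↔ HasFDerivAt f T p :=
  hasMFDerivAt_iff_hasFDerivAt

end HasDerivative

/-! ### Maurer-Cartan forms of products -/

section MaurerCartan

variable {V : Type*} [NormedAddCommGroup V] [NormedSpace ℝ V]
  {N : Type*} [TopologicalSpace N] {I : ModelWithCorners ℝ V N}
  {L : Type*} [TopologicalSpace L] [ChartedSpace N L] [Group L]
  {F : Type*} [NormedAddCommGroup F] [NormedSpace ℝ F]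
  {P : Type*} [TopologicalSpace P] [ChartedSpace F P]

theorem HasD.leftMC_eq {h : P → L} {p : P} {T : F →L[ℝ] V}
    (hh : HasD 𝓘(ℝ, F) I (fun y => (h p)⁻¹ * h y) p T) : leftMC I h p = T := hh.mfderiv_eq

theorem HasD.rightMC_eq {h : P → L} {p : P} {T : F →L[ℝ] V}
    (hh : HasD 𝓘(ℝ, F) I (fun y => h y * (h p)⁻¹) p T) : rightMC I h p = T := hh.mfderiv_eq

end MaurerCartan

section Group

variable {V : Type*} [NormedAddCommGroup V] [NormedSpace ℝ V]
  {N : Type*} [TopologicalSpace N] {I : ModelWithCorners ℝ V N}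
  {L : Type*} [TopologicalSpace L] [ChartedSpace N L] [Group L] [LieGroup I ∞ L]
  {V' : Type*} [NormedAddCommGroup V'] [NormedSpace ℝ V']
  {N' : Type*} [TopologicalSpace N'] {J : ModelWithCorners ℝ V' N'}
  {Q : Type*} [TopologicalSpace Q] [ChartedSpace N' Q]
  {F : Type*} [NormedAddCommGroup F] [NormedSpace ℝ F]
  {P : Type*} [TopologicalSpace P] [ChartedSpace F P]

variable (I) in
theorem hasD_conj (a : L) : HasD I I (fun y : L => a * y * a⁻¹) 1 (Ad I a) := by
  have h1 : ContMDiff I I ∞ (fun y : L => a * y * a⁻¹) :=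
    (contMDiff_const.mul contMDiff_id).mul contMDiff_const
  exact hasD_mfderiv ((h1 1).mdifferentiableAt (by simp))

/-- The derivative of multiplication at `(1, 1)` is addition. -/
theorem HasD.mul {f g : Q → L} {p : Q} {S T : V' →L[ℝ] V} (hf : HasD J I f p S)
    (hg : HasD J I g p T) (hf1 : f p = 1) (hg1 : g p = 1) :
    HasD J I (fun y => f y * g y) p (S + T) := by
  have hm : MDifferentiableAt (I.prod I) I (fun z : L × L => z.1 * z.2) (1, 1) :=
    ((contMDiff_mul I ∞) (1, 1)).mdifferentiableAt (by simp)
  obtain ⟨U, hU⟩ : ∃ U : V × V →L[ℝ] V,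
      HasD (I.prod I) I (fun z : L × L => z.1 * z.2) (1, 1) U := ⟨_, hasD_mfderiv hm⟩
  have h1 : HasD I I (fun y : L => y * 1) 1
      (U.comp ((ContinuousLinearMap.id ℝ V).prod 0)) :=
    hU.comp ((hasD_id (I := I) (1 : L)).prodMk (hasD_const (I' := I) (1 : L) (1 : L))) rfl
  have h2 : HasD I I (fun y : L => 1 * y) 1
      (U.comp ((0 : V →L[ℝ] V).prod (ContinuousLinearMap.id ℝ V))) :=
    hU.comp ((hasD_const (I' := I) (1 : L) (1 : L)).prodMk (hasD_id (I := I) (1 : L))) rfl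
  simp only [mul_one] at h1
  simp only [one_mul] at h2
  have e1 := h1.unique (hasD_id (1 : L))
  have e2 := h2.unique (hasD_id (1 : L))
  have hU' : U.comp (S.prod T) = S + T := by
    ext x
    have a1 := DFunLike.congr_fun e1 (S x)
    have a2 := DFunLike.congr_fun e2 (T x)
    simp only [ContinuousLinearMap.comp_apply, ContinuousLinearMap.prod_apply,
      ContinuousLinearMap.id_apply, zero_apply] at a1 a2 ⊢
    have : (S x, T x) = (S x, (0 : V)) + ((0 : V), T x) := by simp
    rw [this, map_add, a1, a2]; rfl
  rw [← hU']
  exact hU.comp (hf.prodMk hg) (by simp [hf1, hg1])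

theorem HasD.conj {f : Q → L} {p : Q} {S : V' →L[ℝ] V} (hf : HasD J I f p S)
    (hf1 : f p = 1) (a : L) : HasD J I (fun y => a * f y * a⁻¹) p ((Ad I a).comp S) :=
  (hasD_conj I a).comp hf hf1

variable (I) in
theorem Ad_map_one : Ad I (1 : L) = ContinuousLinearMap.id ℝ V := by
  refine (hasD_conj I (1 : L)).unique ?_
  simpa using hasD_id (I := I) (1 : L)

variable (I) in
theorem Ad_map_mul (u v : L) : Ad I (u * v) = (Ad I u).comp (Ad I v) := by
  refine (hasD_conj I (u * v)).unique ?_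
  have := (hasD_conj I v).conj (by simp) u
  simpa [mul_assoc] using this

variable (I) in
theorem Ad_Ad_inv (u : L) (x : V) : Ad I u (Ad I u⁻¹ x) = x := by
  have := Ad_map_mul I u u⁻¹
  rw [mul_inv_cancel, Ad_map_one] at this
  exact (DFunLike.congr_fun this x).symm

variable (I) in
theorem Ad_inv_Ad (u : L) (x : V) : Ad I u⁻¹ (Ad I u x) = x := by
  simpa using Ad_Ad_inv I u⁻¹ x

theorem hasD_rightMC {h : P → L} {p : P} (hh : MDifferentiableAt 𝓘(ℝ, F) I h p) :
    HasD 𝓘(ℝ, F) I (fun y => h y * (h p)⁻¹) p (rightMC (F := F) I h p) := by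
  refine hasD_mfderiv ?_
  have h1 : ContMDiff I I ∞ (fun y : L => y * (h p)⁻¹) := contMDiff_id.mul contMDiff_const
  exact ((h1 (h p)).mdifferentiableAt (by simp)).comp p hh

theorem leftMC_eq {h : P → L} {p : P} (hh : MDifferentiableAt 𝓘(ℝ, F) I h p) :
    leftMC (F := F) I h p = (Ad I (h p)⁻¹).comp (rightMC (F := F) I h p) := by
  refine HasD.leftMC_eq ?_
  have := (hasD_rightMC hh).conj (by simp) (h p)⁻¹
  simpa [mul_assoc] using this

theorem rightMC_mul {h h' : P → L} {p : P} (hh : MDifferentiableAt 𝓘(ℝ, F) I h p)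
    (hh' : MDifferentiableAt 𝓘(ℝ, F) I h' p) :
    rightMC (F := F) I (h * h') p
      = rightMC (F := F) I h p + (Ad I (h p)).comp (rightMC (F := F) I h' p) := by
  refine HasD.rightMC_eq ?_
  have := (hasD_rightMC hh).mul ((hasD_rightMC hh').conj (by simp) (h p)) (by simp) (by simp)
  simpa [mul_assoc] using this

theorem rightMC_const (a : L) (p : P) : rightMC (F := F) I (fun _ : P => a) p = 0 :=
  HasD.rightMC_eq (hasD_const _ _)

theorem leftMC_const (a : L) (p : P) : leftMC (F := F) I (fun _ : P => a) p = 0 :=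
  HasD.leftMC_eq (hasD_const _ _)

variable (I) in
theorem mdifferentiableAt_mul {h h' : P → L} {p : P} (hh : MDifferentiableAt 𝓘(ℝ, F) I h p)
    (hh' : MDifferentiableAt 𝓘(ℝ, F) I h' p) : MDifferentiableAt 𝓘(ℝ, F) I (h * h') p := by
  have hm : MDifferentiableAt (I.prod I) I (fun z : L × L => z.1 * z.2) (h p, h' p) :=
    ((contMDiff_mul I ∞) _).mdifferentiableAt (by simp)
  exact MDifferentiableAt.comp (f := fun y => (h y, h' y)) p hm (hh.prodMk hh')

variable (I) in
theorem mdifferentiableAt_inv {h : P → L} {p : P} (hh : MDifferentiableAt 𝓘(ℝ, F) I h p) :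
    MDifferentiableAt 𝓘(ℝ, F) I h⁻¹ p := by
  have hm : MDifferentiableAt I I (fun z : L => z⁻¹) (h p) :=
    ((contMDiff_inv I ∞) _).mdifferentiableAt (by simp)
  exact hm.comp p hh

theorem rightMC_inv {h : P → L} {p : P} (hh : MDifferentiableAt 𝓘(ℝ, F) I h p) :
    rightMC (F := F) I h⁻¹ p = -leftMC (F := F) I h p := by
  have h1 := rightMC_mul (mdifferentiableAt_inv I hh) hh
  have h0 : rightMC (F := F) I (h⁻¹ * h) p = 0 := by
    rw [inv_mul_cancel]; exact rightMC_const 1 p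
  rw [h0] at h1
  rw [leftMC_eq hh]
  exact (neg_eq_of_add_eq_zero_left h1.symm).symm

theorem leftMC_mul {h h' : P → L} {p : P} (hh : MDifferentiableAt 𝓘(ℝ, F) I h p)
    (hh' : MDifferentiableAt 𝓘(ℝ, F) I h' p) :
    leftMC (F := F) I (h * h') p
      = (Ad I (h' p)⁻¹).comp (leftMC (F := F) I h p + rightMC (F := F) I h' p) := by
  rw [leftMC_eq (mdifferentiableAt_mul I hh hh'), rightMC_mul hh hh', leftMC_eq hh,
    show (h * h') p = h p * h' p from rfl, mul_inv_rev, Ad_map_mul]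
  ext x
  simp [Ad_inv_Ad]

end Group

/-! ### The multiplication in the chart at `1` -/

section Chart

variable {E : Type*} [NormedAddCommGroup E] [NormedSpace ℝ E]
  {F : Type*} [NormedAddCommGroup F] [NormedSpace ℝ F]
  (G : Type*) [TopologicalSpace G] [ChartedSpace E G] [Group G]

/-- The coordinates of `1 ∈ G` in the preferred chart at `1`. -/
def chartOne : E := extChartAt 𝓘(ℝ, E) (1 : G) 1

/-- The multiplication of `G` in the preferred chart at `1`. -/
def chartMul (z : E × E) : E :=
  extChartAt 𝓘(ℝ, E) (1 : G)
    ((extChartAt 𝓘(ℝ, E) (1 : G)).symm z.1 * (extChartAt 𝓘(ℝ, E) (1 : G)).symm z.2)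

/-- The differential at `1` of right translation by the point with coordinates `x`, in the
preferred chart at `1`. -/
def rightTrans (x : E) : E →L[ℝ] E :=
  (fderiv ℝ (chartMul G) (chartOne G, x)).comp (ContinuousLinearMap.inl ℝ E E)

/-- The differential at `1` of left translation by the point with coordinates `x`, in the
preferred chart at `1`. -/
def leftTrans (x : E) : E →L[ℝ] E :=
  (fderiv ℝ (chartMul G) (x, chartOne G)).comp (ContinuousLinearMap.inr ℝ E E)

/-- The operator `ad` of the Lie algebra `T₁G = E`, in the chart at `1`. -/
def adL : E →L[ℝ] E →L[ℝ] E :=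
  let B : E →L[ℝ] E →L[ℝ] E := fderiv ℝ (leftTrans G) (chartOne G)
  B - B.flip

variable {G} in
theorem adL_apply (ξ ζ : E) : adL G ξ ζ =
    fderiv ℝ (leftTrans G) (chartOne G) ξ ζ - fderiv ℝ (leftTrans G) (chartOne G) ζ ξ := rfl

theorem adL_swap (ξ ζ : E) : adL G ξ ζ = -adL G ζ ξ := by
  simp [adL_apply]

theorem symm_chartOne : (extChartAt 𝓘(ℝ, E) (1 : G)).symm (chartOne G) = 1 :=
  extChartAt_to_inv (I := 𝓘(ℝ, E)) (1 : G)

theorem chartOne_mem : (chartOne G : E) ∈ (extChartAt 𝓘(ℝ, E) (1 : G)).target :=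
  mem_extChartAt_target (I := 𝓘(ℝ, E)) (1 : G)

theorem target_mem_nhds : (extChartAt 𝓘(ℝ, E) (1 : G)).target ∈ 𝓝 (chartOne G : E) :=
  extChartAt_target_mem_nhds (I := 𝓘(ℝ, E)) (1 : G)

variable [LieGroup 𝓘(ℝ, E) ∞ G]

theorem isManifold_one : IsManifold 𝓘(ℝ, E) 1 G := IsManifold.of_le (n := ∞) (by simp)

theorem hasD_extChartAt_one :
    HasD 𝓘(ℝ, E) 𝓘(ℝ, E) (extChartAt 𝓘(ℝ, E) (1 : G)) 1 (ContinuousLinearMap.id ℝ E) := by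
  have := isManifold_one (E := E) G
  have h := hasD_mfderiv (I := 𝓘(ℝ, E)) (I' := 𝓘(ℝ, E))
    (mdifferentiableAt_extChartAt (I := 𝓘(ℝ, E)) (mem_chart_source E (1 : G)))
  have e : (mfderiv 𝓘(ℝ, E) 𝓘(ℝ, E) (extChartAt 𝓘(ℝ, E) (1 : G)) 1 : E →L[ℝ] E)
      = ContinuousLinearMap.id ℝ E := mfderiv_extChartAt_self (I := 𝓘(ℝ, E)) (x := (1 : G))
  rwa [e] at h

theorem hasD_extChartAt_one_symm :
    HasD 𝓘(ℝ, E) 𝓘(ℝ, E) (extChartAt 𝓘(ℝ, E) (1 : G)).symm (chartOne G)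
      (ContinuousLinearMap.id ℝ E) := by
  have := isManifold_one (E := E) G
  have hd : MDifferentiableAt 𝓘(ℝ, E) 𝓘(ℝ, E) (extChartAt 𝓘(ℝ, E) (1 : G)).symm
      (chartOne G) := by
    have := mdifferentiableWithinAt_extChartAt_symm (I := 𝓘(ℝ, E)) (chartOne_mem (E := E) G)
    simpa [mdifferentiableWithinAt_univ] using this
  have h := hasD_mfderiv hd
  have h2 := (hasD_extChartAt_one (E := E) G).comp h (symm_chartOne G)
  have h3 : HasD 𝓘(ℝ, E) 𝓘(ℝ, E) (fun y : E => extChartAt 𝓘(ℝ, E) (1 : G)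
      ((extChartAt 𝓘(ℝ, E) (1 : G)).symm y)) (chartOne G) (ContinuousLinearMap.id ℝ E) := by
    refine (hasD_id (I := 𝓘(ℝ, E)) (chartOne G : E)).congr_of_eventuallyEq ?_
    filter_upwards [target_mem_nhds (E := E) G] with y hy
    exact PartialEquiv.right_inv _ hy
  have e := h2.unique h3
  have h' : (mfderiv 𝓘(ℝ, E) 𝓘(ℝ, E) (extChartAt 𝓘(ℝ, E) (1 : G)).symm (chartOne G) : E →L[ℝ] E)
      = ContinuousLinearMap.id ℝ E := e
  rwa [h'] at h

theorem contMDiffAt_extChartAt_symm_of_mem {x : E}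
    (hx : x ∈ (extChartAt 𝓘(ℝ, E) (1 : G)).target) :
    ContMDiffAt 𝓘(ℝ, E) 𝓘(ℝ, E) ∞ (extChartAt 𝓘(ℝ, E) (1 : G)).symm x :=
  (contMDiffOn_extChartAt_symm (I := 𝓘(ℝ, E)) (n := ∞) (1 : G)).contMDiffAt
    ((isOpen_extChartAt_target (I := 𝓘(ℝ, E)) (1 : G)).mem_nhds hx)

theorem contDiffAt_chartMul : ContDiffAt ℝ ∞ (chartMul (E := E) G) (chartOne G, chartOne G) := by
  rw [← contMDiffAt_iff_contDiffAt]
  have h1 : ContMDiffAt 𝓘(ℝ, E × E) 𝓘(ℝ, E) ∞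
      (fun z : E × E => (extChartAt 𝓘(ℝ, E) (1 : G)).symm z.1 *
        (extChartAt 𝓘(ℝ, E) (1 : G)).symm z.2) (chartOne G, chartOne G) := by
    have a := contMDiffAt_extChartAt_symm_of_mem (E := E) G (chartOne_mem G)
    refine ContMDiffAt.mul ?_ ?_
    · exact ContMDiffAt.comp (I' := 𝓘(ℝ, E)) (g := (extChartAt 𝓘(ℝ, E) (1 : G)).symm)
        (f := fun z : E × E => z.1) _ a contDiffAt_fst.contMDiffAt
    · exact ContMDiffAt.comp (I' := 𝓘(ℝ, E)) (g := (extChartAt 𝓘(ℝ, E) (1 : G)).symm)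
        (f := fun z : E × E => z.2) _ a contDiffAt_snd.contMDiffAt
  have h2 : ContMDiffAt 𝓘(ℝ, E) 𝓘(ℝ, E) ∞ (extChartAt 𝓘(ℝ, E) (1 : G)) (1 : G) :=
    contMDiffAt_extChartAt
  exact ContMDiffAt.comp_of_eq (g := extChartAt 𝓘(ℝ, E) (1 : G)) h2 h1
    (by simp only [symm_chartOne, mul_one])

theorem eventually_differentiableAt_chartMul :
    ∀ᶠ z in 𝓝 ((chartOne G, chartOne G) : E × E), DifferentiableAt ℝ (chartMul G) z := by
  have h := ((contDiffAt_chartMul (E := E) G).of_le (m := 1) (by simp)).eventually (by simp)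
  exact h.mono fun z hz => hz.differentiableAt (by simp)

theorem contDiffAt_fderiv_chartMul :
    ContDiffAt ℝ ∞ (fderiv ℝ (chartMul (E := E) G)) (chartOne G, chartOne G) :=
  (contDiffAt_chartMul G).fderiv_right (by simp)

theorem contDiffAt_rightTrans : ContDiffAt ℝ ∞ (rightTrans (E := E) G) (chartOne G) := by
  have h : ContDiffAt ℝ ∞ (fun x : E => fderiv ℝ (chartMul (E := E) G) (chartOne G, x))
      (chartOne G) :=
    ContDiffAt.comp (chartOne G) (f := fun x : E => ((chartOne G, x) : E × E))
      (contDiffAt_fderiv_chartMul G) (contDiffAt_const.prodMk contDiffAt_id)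
  exact h.clm_comp contDiffAt_const

theorem contDiffAt_leftTrans : ContDiffAt ℝ ∞ (leftTrans (E := E) G) (chartOne G) := by
  have h : ContDiffAt ℝ ∞ (fun x : E => fderiv ℝ (chartMul (E := E) G) (x, chartOne G))
      (chartOne G) :=
    ContDiffAt.comp (chartOne G) (f := fun x : E => ((x, chartOne G) : E × E))
      (contDiffAt_fderiv_chartMul G) (contDiffAt_id.prodMk contDiffAt_const)
  exact h.clm_comp contDiffAt_const

theorem rightTrans_chartOne : rightTrans G (chartOne G) = ContinuousLinearMap.id ℝ E := by
  have h : HasFDerivAt (fun x : E => chartMul G (x, chartOne G))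
      (rightTrans G (chartOne G)) (chartOne G) := by
    have h1 := ((contDiffAt_chartMul (E := E) G).differentiableAt (by simp)).hasFDerivAt
    exact h1.comp (chartOne G) (f := fun x : E => (x, (chartOne G : E)))
      (hasFDerivAt_prodMk_left _ _)
  refine h.unique ((hasFDerivAt_id (chartOne G : E)).congr_of_eventuallyEq ?_)
  filter_upwards [target_mem_nhds (E := E) G] with y hy
  simp only [chartMul, symm_chartOne, mul_one, id]
  exact PartialEquiv.right_inv _ hy

theorem leftTrans_chartOne : leftTrans G (chartOne G) = ContinuousLinearMap.id ℝ E := by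
  have h : HasFDerivAt (fun x : E => chartMul G (chartOne G, x))
      (leftTrans G (chartOne G)) (chartOne G) := by
    have h1 := ((contDiffAt_chartMul (E := E) G).differentiableAt (by simp)).hasFDerivAt
    exact h1.comp (chartOne G) (f := fun x : E => ((chartOne G : E), x))
      (hasFDerivAt_prodMk_right _ _)
  refine h.unique ((hasFDerivAt_id (chartOne G : E)).congr_of_eventuallyEq ?_)
  filter_upwards [target_mem_nhds (E := E) G] with y hy
  simp only [chartMul, symm_chartOne, one_mul, id]
  exact PartialEquiv.right_inv _ hy

/-- Both derivatives are the mixed second derivative of the multiplication at `(1, 1)`. -/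
theorem fderiv_rightTrans (ξ ζ : E) :
    fderiv ℝ (rightTrans G) (chartOne G) ζ ξ = fderiv ℝ (leftTrans G) (chartOne G) ξ ζ := by
  have hd := ((contDiffAt_fderiv_chartMul (E := E) G).differentiableAt (by simp)).hasFDerivAt
  set D := fderiv ℝ (fderiv ℝ (chartMul (E := E) G)) (chartOne G, chartOne G) with hD
  have h1 : HasFDerivAt (fun x : E => fderiv ℝ (chartMul (E := E) G) (chartOne G, x))
      (D.comp (ContinuousLinearMap.inr ℝ E E)) (chartOne G) :=
    hd.comp (chartOne G) (f := fun x : E => ((chartOne G : E), x)) (hasFDerivAt_prodMk_right _ _)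
  have h2 : HasFDerivAt (fun x : E => fderiv ℝ (chartMul (E := E) G) (x, chartOne G))
      (D.comp (ContinuousLinearMap.inl ℝ E E)) (chartOne G) :=
    hd.comp (chartOne G) (f := fun x : E => (x, (chartOne G : E))) (hasFDerivAt_prodMk_left _ _)
  have h1' := (h1.clm_comp (hasFDerivAt_const (ContinuousLinearMap.inl ℝ E E) _)).fderiv
  have h2' := (h2.clm_comp (hasFDerivAt_const (ContinuousLinearMap.inr ℝ E E) _)).fderiv
  have e1 : fderiv ℝ (rightTrans G) (chartOne G) ζ ξ = D (0, ζ) (ξ, 0) := by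
    change fderiv ℝ (fun x : E => (fderiv ℝ (chartMul G) (chartOne G, x)).comp
      (ContinuousLinearMap.inl ℝ E E)) (chartOne G) ζ ξ = _
    rw [h1']; simp
  have e2 : fderiv ℝ (leftTrans G) (chartOne G) ξ ζ = D (ξ, 0) (0, ζ) := by
    change fderiv ℝ (fun x : E => (fderiv ℝ (chartMul G) (x, chartOne G)).comp
      (ContinuousLinearMap.inr ℝ E E)) (chartOne G) ξ ζ = _
    rw [h2']; simp
  rw [e1, e2]
  exact ((contDiffAt_chartMul (E := E) G).isSymmSndFDerivAt
    (by
      rw [minSmoothness_of_isRCLikeNormedField]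
      exact WithTop.coe_le_coe.2 (le_top (a := (2 : ℕ∞))))) _ _

end Chart

/-! ### The Lie bracket and the differential of `Ad` in the chart at `1` -/

section Chart

variable {E : Type*} [NormedAddCommGroup E] [NormedSpace ℝ E]
  {F : Type*} [NormedAddCommGroup F] [NormedSpace ℝ F]
  (G : Type*) [TopologicalSpace G] [ChartedSpace E G] [Group G] [LieGroup 𝓘(ℝ, E) ∞ G]

variable {G} in
theorem inverse_apply_self {A : E →L[ℝ] E} (hA : A.IsInvertible) (v : E) :
    A.inverse (A v) = v := by
  obtain ⟨M, rfl⟩ := hA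
  rw [ContinuousLinearMap.inverse_equiv]
  exact M.symm_apply_apply v

/-- In the chart at `1`, the left-invariant field with value `ζ` at `1` is `x ↦ leftTrans G x ζ`. -/
theorem mpullbackWithin_mulInvariantVectorField (ζ : E) :
    ∀ᶠ x in 𝓝 (chartOne G : E),
      VectorField.mpullbackWithin 𝓘(ℝ, E) 𝓘(ℝ, E) (extChartAt 𝓘(ℝ, E) (1 : G)).symm
        (mulInvariantVectorField (I := 𝓘(ℝ, E)) (G := G) ζ) (Set.range 𝓘(ℝ, E)) x
        = (leftTrans G x ζ : E) := by
  have := isManifold_one (E := E) G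
  have hd : ∀ᶠ x in 𝓝 (chartOne G : E), DifferentiableAt ℝ (chartMul G) (x, chartOne G) :=
    (Continuous.tendsto (f := fun x : E => (x, (chartOne G : E))) (by fun_prop) _).eventually
      (eventually_differentiableAt_chartMul G)
  filter_upwards [target_mem_nhds (E := E) G, hd] with x hx hdx
  set φ := extChartAt 𝓘(ℝ, E) (1 : G) with hφ
  set g := φ.symm x with hg
  obtain ⟨A, hA⟩ : ∃ A : E →L[ℝ] E, HasD 𝓘(ℝ, E) 𝓘(ℝ, E) φ.symm x A :=
    ⟨_, hasD_mfderiv ((contMDiffAt_extChartAt_symm_of_mem G hx).mdifferentiableAt (by simp))⟩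
  have hx0 : chartMul G (x, chartOne G) = x := by
    simp only [chartMul, symm_chartOne, mul_one]
    exact PartialEquiv.right_inv _ hx
  have h1 : HasD 𝓘(ℝ, E) 𝓘(ℝ, E) (fun y : E => chartMul G (x, y)) (chartOne G)
      (leftTrans G x) :=
    hasD_iff_hasFDerivAt.2 (hdx.hasFDerivAt.comp (chartOne G)
      (f := fun y : E => (x, y)) (hasFDerivAt_prodMk_right _ _))
  have h2 := hA.comp h1 hx0
  obtain ⟨B, hB⟩ : ∃ B : E →L[ℝ] E, HasD 𝓘(ℝ, E) 𝓘(ℝ, E) (fun y : G => g * y) 1 B := by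
    have : ContMDiff 𝓘(ℝ, E) 𝓘(ℝ, E) ∞ (fun y : G => g * y) := contMDiff_const.mul contMDiff_id
    exact ⟨_, hasD_mfderiv ((this 1).mdifferentiableAt (by simp))⟩
  have h3 := hB.comp (hasD_extChartAt_one_symm G) (symm_chartOne G)
  have h4 : HasD 𝓘(ℝ, E) 𝓘(ℝ, E) (fun y : E => φ.symm (chartMul G (x, y))) (chartOne G)
      (B.comp (ContinuousLinearMap.id ℝ E)) := by
    refine h3.congr_of_eventuallyEq ?_
    have hs : ∀ᶠ y in 𝓝 (chartOne G : E), g * φ.symm y ∈ φ.source := by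
      refine h3.continuousAt.eventually_mem ?_
      rw [symm_chartOne, mul_one]
      exact (isOpen_extChartAt_source (I := 𝓘(ℝ, E)) (1 : G)).mem_nhds (φ.map_target hx)
    filter_upwards [hs] with y hy
    exact φ.left_inv hy
  have e := h2.unique h4
  have hAi : A.IsInvertible := by
    have h := isInvertible_mfderivWithin_extChartAt_symm (I := 𝓘(ℝ, E)) hx
    have e' : (mfderivWithin 𝓘(ℝ, E) 𝓘(ℝ, E) φ.symm (Set.range 𝓘(ℝ, E)) x : E →L[ℝ] E) = A := by
      simp only [modelWithCornersSelf_coe, Set.range_id, mfderivWithin_univ]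
      exact hA.mfderiv_eq
    exact e' ▸ h
  have e' : (mfderivWithin 𝓘(ℝ, E) 𝓘(ℝ, E) φ.symm (Set.range 𝓘(ℝ, E)) x : E →L[ℝ] E) = A := by
    simp only [modelWithCornersSelf_coe, Set.range_id, mfderivWithin_univ]
    exact hA.mfderiv_eq
  have hBζ : (mulInvariantVectorField (I := 𝓘(ℝ, E)) (G := G) ζ g : E) = B ζ :=
    DFunLike.congr_fun hB.mfderiv_eq ζ
  change (ContinuousLinearMap.inverse
    (mfderivWithin 𝓘(ℝ, E) 𝓘(ℝ, E) φ.symm (Set.range 𝓘(ℝ, E)) x : E →L[ℝ] E))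
    (mulInvariantVectorField (I := 𝓘(ℝ, E)) (G := G) ζ g : E) = _
  rw [e', hBζ]
  have : B ζ = A (leftTrans G x ζ) := by
    have := DFunLike.congr_fun e ζ
    simpa using this.symm
  rw [this]
  exact inverse_apply_self hAi _

/-- The bracket of left-invariant vector fields, computed in the chart at `1`. -/
theorem lieBr_eq (ξ ζ : E) : lieBr G ξ ζ = adL G ξ ζ := by
  have := isManifold_one (E := E) G
  change VectorField.mlieBracketWithin 𝓘(ℝ, E)
    (mulInvariantVectorField (I := 𝓘(ℝ, E)) (G := G) ξ)
    (mulInvariantVectorField (I := 𝓘(ℝ, E)) (G := G) ζ) Set.univ (1 : G) = _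
  rw [VectorField.mlieBracketWithin_apply]
  have h1 : (mfderiv 𝓘(ℝ, E) 𝓘(ℝ, E) (extChartAt 𝓘(ℝ, E) (1 : G)) 1 : E →L[ℝ] E)
      = ContinuousLinearMap.id ℝ E := (hasD_extChartAt_one G).mfderiv_eq
  have hinv : ∀ (A : E →L[ℝ] E) (v : E), A = ContinuousLinearMap.id ℝ E → A.inverse v = v := by
    rintro A v rfl
    simp
  refine (hinv _ _ h1).trans ?_
  have hset : (extChartAt 𝓘(ℝ, E) (1 : G)).symm ⁻¹' Set.univ ∩ Set.range 𝓘(ℝ, E) = Set.univ := by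
    simp
  rw [hset]
  refine (congrFun VectorField.lieBracketWithin_univ _).trans ?_
  have key := Filter.EventuallyEq.lieBracket_vectorField_eq (𝕜 := ℝ)
    (mpullbackWithin_mulInvariantVectorField G ξ) (mpullbackWithin_mulInvariantVectorField G ζ)
  refine key.trans ?_
  have hL := ((contDiffAt_leftTrans (E := E) G).differentiableAt (by simp)).hasFDerivAt
  have hd : ∀ v : E, fderiv ℝ (fun x => leftTrans G x v) (chartOne G)
      = (fderiv ℝ (leftTrans G) (chartOne G)).flip v := by
    intro v
    have := (hL.clm_apply (hasFDerivAt_const v _)).fderiv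
    rw [this]; ext w; simp
  rw [VectorField.lieBracket_eq]
  change fderiv ℝ (fun x => leftTrans G x ζ) (chartOne G) (leftTrans G (chartOne G) ξ) -
    fderiv ℝ (fun x => leftTrans G x ξ) (chartOne G) (leftTrans G (chartOne G) ζ) = _
  rw [hd, hd, leftTrans_chartOne]
  rfl

/-- `x y = (x y x⁻¹) x`, differentiated in `y` at `1`. -/
theorem leftTrans_eq : ∀ᶠ x in 𝓝 (chartOne G : E),
    leftTrans G x = (rightTrans G x).comp
      (Ad 𝓘(ℝ, E) ((extChartAt 𝓘(ℝ, E) (1 : G)).symm x)) := by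
  have hd : ∀ᶠ x in 𝓝 (chartOne G : E), DifferentiableAt ℝ (chartMul G) (x, chartOne G) :=
    (Continuous.tendsto (f := fun x : E => (x, (chartOne G : E))) (by fun_prop) _).eventually
      (eventually_differentiableAt_chartMul G)
  have hd' : ∀ᶠ x in 𝓝 (chartOne G : E), DifferentiableAt ℝ (chartMul G) (chartOne G, x) :=
    (Continuous.tendsto (f := fun x : E => ((chartOne G : E), x)) (by fun_prop) _).eventually
      (eventually_differentiableAt_chartMul G)
  filter_upwards [target_mem_nhds (E := E) G, hd, hd'] with x hx hdx hdx'
  set φ := extChartAt 𝓘(ℝ, E) (1 : G) with hφ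
  set g := φ.symm x with hg
  have h1 : HasFDerivAt (fun y : E => chartMul G (x, y)) (leftTrans G x) (chartOne G) :=
    (hdx.hasFDerivAt.comp (chartOne G)
      (f := fun y : E => (x, y)) (hasFDerivAt_prodMk_right _ _))
  have h2 : HasD 𝓘(ℝ, E) 𝓘(ℝ, E) (fun y : E => g * φ.symm y * g⁻¹) (chartOne G)
      ((Ad 𝓘(ℝ, E) g).comp (ContinuousLinearMap.id ℝ E)) :=
    (hasD_extChartAt_one_symm G).conj (symm_chartOne G) g
  have h3 := hasD_iff_hasFDerivAt.1
    ((hasD_extChartAt_one G).comp h2 (by rw [symm_chartOne, mul_one, mul_inv_cancel]))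
  have h4 : HasFDerivAt (fun y : E => chartMul G (y, x)) (rightTrans G x) (chartOne G) :=
    (hdx'.hasFDerivAt.comp (chartOne G)
      (f := fun y : E => (y, x)) (hasFDerivAt_prodMk_left _ _))
  have h5 : φ (g * φ.symm (chartOne G) * g⁻¹) = (chartOne G : E) := by
    rw [symm_chartOne, mul_one, mul_inv_cancel]; rfl
  have h6 := HasFDerivAt.comp (chartOne G : E) (f := fun y : E => φ (g * φ.symm y * g⁻¹))
    (g := fun y : E => chartMul G (y, x)) (by rw [h5]; exact h4) h3
  refine h1.unique ((h6.congr_of_eventuallyEq ?_).congr_fderiv (by simp))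
  have hs : ∀ᶠ y in 𝓝 (chartOne G : E), g * φ.symm y * g⁻¹ ∈ φ.source := by
    refine h2.continuousAt.eventually_mem ?_
    rw [symm_chartOne, mul_one, mul_inv_cancel]
    exact (isOpen_extChartAt_source (I := 𝓘(ℝ, E)) (1 : G)).mem_nhds
      (mem_extChartAt_source (I := 𝓘(ℝ, E)) (1 : G))
  filter_upwards [hs] with y hy
  change φ (φ.symm x * φ.symm y) = φ (φ.symm (φ (g * φ.symm y * g⁻¹)) * φ.symm x)
  rw [φ.left_inv hy, ← hg]
  simp

variable [CompleteSpace E]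

theorem eventually_isInvertible_rightTrans :
    ∀ᶠ x in 𝓝 (chartOne G : E), (rightTrans G x).IsInvertible := by
  have h := (contDiffAt_rightTrans (E := E) G).continuousAt
  have h1 : (rightTrans G (chartOne G) : E →L[ℝ] E).IsInvertible := by
    rw [rightTrans_chartOne]; exact ⟨ContinuousLinearEquiv.refl ℝ E, rfl⟩
  obtain ⟨M, hM⟩ := h1
  refine h.eventually ?_
  rw [← hM]
  exact ContinuousLinearEquiv.nhds M

theorem contDiffAt_inverse_rightTrans :
    ContDiffAt ℝ ∞ (fun x : E => (rightTrans G x).inverse) (chartOne G) := by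
  obtain ⟨M, hM⟩ := (eventually_isInvertible_rightTrans (E := E) G).self_of_nhds
  have h := contDiffAt_map_inverse (𝕜 := ℝ) (n := ∞) M
  rw [hM] at h
  exact ContDiffAt.comp (chartOne G) h (contDiffAt_rightTrans G)

theorem Ad_symm_eq : (fun x : E => Ad 𝓘(ℝ, E) ((extChartAt 𝓘(ℝ, E) (1 : G)).symm x))
    =ᶠ[𝓝 (chartOne G)] fun x => (rightTrans G x).inverse.comp (leftTrans G x) := by
  filter_upwards [leftTrans_eq (E := E) G, eventually_isInvertible_rightTrans (E := E) G]
    with x hx hi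
  rw [hx, ← ContinuousLinearMap.comp_assoc, hi.inverse_comp_self, ContinuousLinearMap.id_comp]

theorem contDiffAt_Ad_symm :
    ContDiffAt ℝ ∞ (fun x : E => Ad 𝓘(ℝ, E) ((extChartAt 𝓘(ℝ, E) (1 : G)).symm x))
      (chartOne G) :=
  ((contDiffAt_inverse_rightTrans G).clm_comp (contDiffAt_leftTrans G)).congr_of_eventuallyEq
    (Ad_symm_eq G)

/-- The differential of `Ad` at `1` is `ad`. -/
theorem hasFDerivAt_Ad_symm :
    HasFDerivAt (fun x : E => Ad 𝓘(ℝ, E) ((extChartAt 𝓘(ℝ, E) (1 : G)).symm x)) (adL G)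
      (chartOne G) := by
  have hA := ((contDiffAt_Ad_symm (E := E) G).differentiableAt (by simp)).hasFDerivAt
  set D := fderiv ℝ (fun x : E => Ad 𝓘(ℝ, E) ((extChartAt 𝓘(ℝ, E) (1 : G)).symm x)) (chartOne G)
  have hS := ((contDiffAt_rightTrans (E := E) G).differentiableAt (by simp)).hasFDerivAt
  have hL := ((contDiffAt_leftTrans (E := E) G).differentiableAt (by simp)).hasFDerivAt
  have h := (hS.clm_comp hA).congr_of_eventuallyEq (leftTrans_eq G)
  have e := hL.unique h
  have : D = adL G := by
    ext ξ ζ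
    have e1 := DFunLike.congr_fun (DFunLike.congr_fun e ξ) ζ
    simp only [symm_chartOne, Ad_map_one, rightTrans_chartOne, add_apply,
      ContinuousLinearMap.comp_apply, ContinuousLinearMap.compL_apply,
      ContinuousLinearMap.flip_apply, ContinuousLinearMap.id_apply] at e1
    rw [fderiv_rightTrans] at e1
    rw [adL_apply, e1]
    abel
  exact this ▸ hA

/-- `Ad` is smooth near `1` by its expression through translations, and everywhere by
`Ad(u) = Ad(g) Ad(g⁻¹ u)`. -/
theorem contMDiff_Ad : ContMDiff 𝓘(ℝ, E) 𝓘(ℝ, E →L[ℝ] E) ∞ (fun u : G => Ad 𝓘(ℝ, E) u) := by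
  have h1 : ContMDiffAt 𝓘(ℝ, E) 𝓘(ℝ, E →L[ℝ] E) ∞ (fun u : G => Ad 𝓘(ℝ, E) u) 1 := by
    have h2 : ContMDiffAt 𝓘(ℝ, E) 𝓘(ℝ, E) ∞ (extChartAt 𝓘(ℝ, E) (1 : G)) (1 : G) :=
      contMDiffAt_extChartAt
    have h3 := ContMDiffAt.comp (I' := 𝓘(ℝ, E)) (1 : G)
      (f := extChartAt 𝓘(ℝ, E) (1 : G))
      (g := fun x : E => Ad 𝓘(ℝ, E) ((extChartAt 𝓘(ℝ, E) (1 : G)).symm x))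
      (contDiffAt_Ad_symm G).contMDiffAt h2
    refine h3.congr_of_eventuallyEq ?_
    filter_upwards [extChartAt_source_mem_nhds (I := 𝓘(ℝ, E)) (1 : G)] with y hy
    simp only [Function.comp_apply]
    rw [PartialEquiv.left_inv _ hy]
  intro g
  have h2 : ContMDiffAt 𝓘(ℝ, E) 𝓘(ℝ, E) ∞ (fun u : G => g⁻¹ * u) g :=
    (contMDiff_const.mul contMDiff_id) g
  have h3 := ContMDiffAt.comp_of_eq (g := fun u : G => Ad 𝓘(ℝ, E) u) h1 h2 (by simp)
  have h4 : ContMDiffAt 𝓘(ℝ, E) 𝓘(ℝ, E →L[ℝ] E) ∞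
      (fun u : G => (Ad 𝓘(ℝ, E) g).comp (Ad 𝓘(ℝ, E) (g⁻¹ * u))) g :=
    contMDiffAt_const.clm_comp h3
  refine h4.congr_of_eventuallyEq (Eventually.of_forall fun u => ?_)
  change Ad 𝓘(ℝ, E) u = (Ad 𝓘(ℝ, E) g).comp (Ad 𝓘(ℝ, E) (g⁻¹ * u))
  rw [← Ad_map_mul, mul_inv_cancel_left]

end Chart

section DerivAd

variable {E : Type*} [NormedAddCommGroup E] [NormedSpace ℝ E] [CompleteSpace E]
  {G : Type*} [TopologicalSpace G] [ChartedSpace E G] [Group G] [LieGroup 𝓘(ℝ, E) ∞ G]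
  {V' : Type*} [NormedAddCommGroup V'] [NormedSpace ℝ V']
  {N' : Type*} [TopologicalSpace N'] {J : ModelWithCorners ℝ V' N'}
  {Q : Type*} [TopologicalSpace Q] [ChartedSpace N' Q]
  {F : Type*} [NormedAddCommGroup F] [NormedSpace ℝ F]
  {P : Type*} [TopologicalSpace P] [ChartedSpace F P]

theorem hasD_Ad_one : HasD 𝓘(ℝ, E) 𝓘(ℝ, E →L[ℝ] E) (fun u : G => Ad 𝓘(ℝ, E) u) 1 (adL G) := by
  have h := (hasD_iff_hasFDerivAt.2 (hasFDerivAt_Ad_symm (E := E) G)).comp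
    (hasD_extChartAt_one (E := E) G) rfl
  rw [ContinuousLinearMap.comp_id] at h
  refine h.congr_of_eventuallyEq ?_
  filter_upwards [extChartAt_source_mem_nhds (I := 𝓘(ℝ, E)) (1 : G)] with y hy
  rw [PartialEquiv.left_inv _ hy]

theorem HasD.Ad {f : Q → G} {p : Q} {S : V' →L[ℝ] E} (hf : HasD J 𝓘(ℝ, E) f p S)
    (hf1 : f p = 1) :
    HasD J 𝓘(ℝ, E →L[ℝ] E) (fun y => Ad 𝓘(ℝ, E) (f y)) p ((adL G).comp S) :=
  hasD_Ad_one.comp hf hf1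

end DerivAd

/-! ### The Maurer-Cartan equation -/

section MaurerCartanEquation

variable {E : Type*} [NormedAddCommGroup E] [NormedSpace ℝ E]
  {F : Type*} [NormedAddCommGroup F] [NormedSpace ℝ F]
  {G : Type*} [TopologicalSpace G] [ChartedSpace E G] [Group G] [LieGroup 𝓘(ℝ, E) ∞ G]

/-- `n(y) = (n(y) n(z)⁻¹) n(z)`, differentiated in `y` at `z`, in the chart at `1`. -/
theorem rightTrans_comp_rightMC {n : F → G} {z₀ : F} (hn : ContMDiffAt 𝓘(ℝ, F) 𝓘(ℝ, E) ∞ n z₀)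
    (h1 : n z₀ = 1) : ∀ᶠ z in 𝓝 z₀,
      (rightTrans G (extChartAt 𝓘(ℝ, E) (1 : G) (n z))).comp (rightMC (F := F) 𝓘(ℝ, E) n z)
        = fderiv ℝ (fun y => extChartAt 𝓘(ℝ, E) (1 : G) (n y)) z := by
  have hφ0 : Tendsto (fun z => extChartAt 𝓘(ℝ, E) (1 : G) (n z)) (𝓝 z₀) (𝓝 (chartOne G : E)) := by
    have := (continuousAt_extChartAt (I := 𝓘(ℝ, E)) (1 : G)).comp_of_eq hn.continuousAt h1
    have h2 := this.tendsto
    simp only [Function.comp_apply, h1] at h2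
    exact h2
  have hd' : ∀ᶠ x in 𝓝 (chartOne G : E), DifferentiableAt ℝ (chartMul G) (chartOne G, x) :=
    (Continuous.tendsto (f := fun x : E => ((chartOne G : E), x)) (by fun_prop) _).eventually
      (eventually_differentiableAt_chartMul G)
  have hs : ∀ᶠ z in 𝓝 z₀, n z ∈ (extChartAt 𝓘(ℝ, E) (1 : G)).source :=
    hn.continuousAt.eventually_mem
      (by rw [h1]; exact extChartAt_source_mem_nhds (I := 𝓘(ℝ, E)) (1 : G))
  have hm : ∀ᶠ z in 𝓝 z₀, MDifferentiableAt 𝓘(ℝ, F) 𝓘(ℝ, E) n z := by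
    have := isManifold_one (E := E) G
    have h := (contMDiffAt_iff_contMDiffAt_nhds (n := 1) (by simp)).1 (hn.of_le (by simp))
    exact h.mono fun z hz => hz.mdifferentiableAt (by simp)
  filter_upwards [hφ0.eventually hd', hs, hm] with z hdz hsz hmz
  set φ := extChartAt 𝓘(ℝ, E) (1 : G)
  have h2 := hasD_rightMC hmz
  have h3 := hasD_iff_hasFDerivAt.1 ((hasD_extChartAt_one (E := E) G).comp h2 (by simp))
  have h4 : HasFDerivAt (fun y : E => chartMul G (y, φ (n z))) (rightTrans G (φ (n z)))
      (chartOne G) :=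
    (hdz.hasFDerivAt.comp (chartOne G)
      (f := fun y : E => (y, φ (n z))) (hasFDerivAt_prodMk_left _ _))
  have h6 := HasFDerivAt.comp z (f := fun y : F => φ (n y * (n z)⁻¹))
    (g := fun y : E => chartMul G (y, φ (n z)))
    (by rw [mul_inv_cancel]; exact h4) h3
  have h7 : HasFDerivAt (fun y => φ (n y))
      ((rightTrans G (φ (n z))).comp ((ContinuousLinearMap.id ℝ E).comp
        (rightMC (F := F) 𝓘(ℝ, E) n z))) z := by
    refine h6.congr_of_eventuallyEq ?_
    have hs2 : ∀ᶠ y in 𝓝 z, n y * (n z)⁻¹ ∈ φ.source := by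
      refine h2.continuousAt.eventually_mem ?_
      rw [mul_inv_cancel]
      exact extChartAt_source_mem_nhds (I := 𝓘(ℝ, E)) (1 : G)
    filter_upwards [hs2] with y hy
    change φ (n y) = φ (φ.symm (φ (n y * (n z)⁻¹)) * φ.symm (φ (n z)))
    rw [φ.left_inv hy, φ.left_inv hsz, inv_mul_cancel_right]
  rw [h7.fderiv, ContinuousLinearMap.id_comp]

theorem contDiffAt_chart_comp {n : F → G} {z₀ : F} (hn : ContMDiffAt 𝓘(ℝ, F) 𝓘(ℝ, E) ∞ n z₀)
    (h1 : n z₀ = 1) : ContDiffAt ℝ ∞ (fun y => extChartAt 𝓘(ℝ, E) (1 : G) (n y)) z₀ := by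
  rw [← contMDiffAt_iff_contDiffAt]
  have h2 : ContMDiffAt 𝓘(ℝ, E) 𝓘(ℝ, E) ∞ (extChartAt 𝓘(ℝ, E) (1 : G)) (1 : G) :=
    contMDiffAt_extChartAt
  exact ContMDiffAt.comp_of_eq (g := extChartAt 𝓘(ℝ, E) (1 : G)) h2 hn h1

theorem rightMC_mul_const (u : F → G) (a : G) (z : F) :
    rightMC (F := F) 𝓘(ℝ, E) (fun y => u y * a) z = rightMC (F := F) 𝓘(ℝ, E) u z := by
  have : (fun y => u y * a * (u z * a)⁻¹) = fun y => u y * (u z)⁻¹ := by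
    funext y; group
  unfold rightMC
  rw [this]

variable [CompleteSpace E]

/-- `δu u⁻¹` depends smoothly on the point: near `z₀` it is the differential of the coordinates of
`u u(z₀)⁻¹`, corrected by the inverse of a right translation. -/
theorem contDiffAt_rightMC {u : F → G} {z₀ : F} (hu : ContMDiffAt 𝓘(ℝ, F) 𝓘(ℝ, E) ∞ u z₀) :
    ContDiffAt ℝ ∞ (fun z => rightMC (F := F) 𝓘(ℝ, E) u z) z₀ := by
  have hn : ContMDiffAt 𝓘(ℝ, F) 𝓘(ℝ, E) ∞ (fun y => u y * (u z₀)⁻¹) z₀ :=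
    hu.mul contMDiffAt_const
  have h1 : u z₀ * (u z₀)⁻¹ = 1 := mul_inv_cancel _
  have hc := contDiffAt_chart_comp hn h1
  have hφ0 : extChartAt 𝓘(ℝ, E) (1 : G) (u z₀ * (u z₀)⁻¹) = (chartOne G : E) := by
    rw [h1]; rfl
  have hi := ContDiffAt.comp z₀ (f := fun y => extChartAt 𝓘(ℝ, E) (1 : G) (u y * (u z₀)⁻¹))
    (by rw [hφ0]; exact contDiffAt_inverse_rightTrans (E := E) G) hc
  have h2 := hi.clm_comp (hc.fderiv_right (m := ∞) (by simp))
  refine h2.congr_of_eventuallyEq ?_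
  have ht : Tendsto (fun y => extChartAt 𝓘(ℝ, E) (1 : G) (u y * (u z₀)⁻¹)) (𝓝 z₀)
      (𝓝 (chartOne G)) := by
    rw [← hφ0]; exact hc.continuousAt
  have h3 := ht.eventually (eventually_isInvertible_rightTrans (E := E) G)
  filter_upwards [rightTrans_comp_rightMC hn h1, h3] with z hz hiz
  rw [← rightMC_mul_const u (u z₀)⁻¹ z, ← hz, Function.comp_apply,
    ← ContinuousLinearMap.comp_assoc, hiz.inverse_comp_self, ContinuousLinearMap.id_comp]

/-- The Maurer-Cartan equation `δ(δu u⁻¹)(X, Y) = [δu u⁻¹(X), δu u⁻¹(Y)]`. -/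
theorem maurerCartan {u : F → G} {z₀ : F} (hu : ContMDiffAt 𝓘(ℝ, F) 𝓘(ℝ, E) ∞ u z₀) (X Y : F) :
    fderiv ℝ (fun z => rightMC (F := F) 𝓘(ℝ, E) u z) z₀ X Y
      - fderiv ℝ (fun z => rightMC (F := F) 𝓘(ℝ, E) u z) z₀ Y X
      = adL G (rightMC (F := F) 𝓘(ℝ, E) u z₀ X) (rightMC (F := F) 𝓘(ℝ, E) u z₀ Y) := by
  have hn : ContMDiffAt 𝓘(ℝ, F) 𝓘(ℝ, E) ∞ (fun y => u y * (u z₀)⁻¹) z₀ :=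
    hu.mul contMDiffAt_const
  have h1 : u z₀ * (u z₀)⁻¹ = 1 := mul_inv_cancel _
  have hc := contDiffAt_chart_comp hn h1
  have hR := ((contDiffAt_rightMC hu).differentiableAt (by simp)).hasFDerivAt
  have hev := rightTrans_comp_rightMC hn h1
  simp only [rightMC_mul_const] at hev
  have hφ0 : extChartAt 𝓘(ℝ, E) (1 : G) (u z₀ * (u z₀)⁻¹) = (chartOne G : E) := by
    rw [h1]; rfl
  have hc' := (hc.differentiableAt (by simp)).hasFDerivAt
  have hS := ((contDiffAt_rightTrans (E := E) G).differentiableAt (by simp)).hasFDerivAt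
  have hS' := HasFDerivAt.comp z₀ (f := fun y => extChartAt 𝓘(ℝ, E) (1 : G) (u y * (u z₀)⁻¹))
    (g := rightTrans G) (by rw [hφ0]; exact hS) hc'
  have h2 := (hS'.clm_comp hR).congr_of_eventuallyEq (hev.mono fun z hz => hz.symm)
  have hsymm : ∀ X Y,
      fderiv ℝ (fderiv ℝ fun y => extChartAt 𝓘(ℝ, E) (1 : G) (u y * (u z₀)⁻¹)) z₀ X Y
        = fderiv ℝ (fderiv ℝ fun y => extChartAt 𝓘(ℝ, E) (1 : G) (u y * (u z₀)⁻¹)) z₀ Y X :=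
    fun X Y => (hc.isSymmSndFDerivAt (by
      rw [minSmoothness_of_isRCLikeNormedField]
      exact WithTop.coe_le_coe.2 (le_top (a := (2 : ℕ∞))))) X Y
  have hν := hev.self_of_nhds
  simp only [hφ0] at hν
  rw [rightTrans_chartOne, ContinuousLinearMap.id_comp] at hν
  have key := hsymm X Y
  rw [h2.fderiv] at key
  simp only [Function.comp_apply, hφ0, rightTrans_chartOne, add_apply,
    ContinuousLinearMap.comp_apply, ContinuousLinearMap.compL_apply,
    ContinuousLinearMap.flip_apply, ContinuousLinearMap.id_apply, ← hν, fderiv_rightTrans] at key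
  rw [adL_apply]
  have := sub_eq_zero.2 key
  rw [← sub_eq_zero, ← this]
  abel

end MaurerCartanEquation

/-! ### One-forms on `P` and their exterior derivatives -/

section Forms

variable {E : Type*} [NormedAddCommGroup E] [NormedSpace ℝ E]
  {F : Type*} [NormedAddCommGroup F] [NormedSpace ℝ F]
  {W : Type*} [NormedAddCommGroup W] [NormedSpace ℝ W]
  {G : Type*} [TopologicalSpace G] [ChartedSpace E G] [Group G] [LieGroup 𝓘(ℝ, E) ∞ G]
  {P : Type*} [TopologicalSpace P] [ChartedSpace F P]

theorem extDeriv_ofSubsingleton {θ : F → F →L[ℝ] ℝ} {x : F} (hθ : DifferentiableAt ℝ θ x)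
    (X Y : F) :
    extDeriv (fun z => ContinuousAlternatingMap.ofSubsingleton ℝ F ℝ (0 : Fin 1) (θ z)) x ![X, Y]
      = fderiv ℝ θ x X Y - fderiv ℝ θ x Y X := by
  let e := ContinuousAlternatingMap.ofSubsingletonLIE (𝕜 := ℝ) (E := F) (F := ℝ) (0 : Fin 1)
  have he : DifferentiableAt ℝ
      (fun z => ContinuousAlternatingMap.ofSubsingleton ℝ F ℝ (0 : Fin 1) (θ z)) x :=
    e.toContinuousLinearEquiv.differentiableAt.comp x hθ
  rw [extDeriv_apply he]
  have hc : ∀ v : Fin 1 → F, fderiv ℝ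
      (fun z => ContinuousAlternatingMap.ofSubsingleton ℝ F ℝ (0 : Fin 1) (θ z) v) x
      = (fderiv ℝ θ x).flip (v 0) := by
    intro v
    have h : (fun z => ContinuousAlternatingMap.ofSubsingleton ℝ F ℝ (0 : Fin 1) (θ z) v)
        = fun z => θ z (v 0) := by
      funext z; simp
    rw [h, (hθ.hasFDerivAt.clm_apply (hasFDerivAt_const (v 0) x)).fderiv]
    ext w; simp
  rw [Fin.sum_univ_two, hc, hc]
  simp [Fin.removeNth, sub_eq_add_neg]

theorem SmoothOneForm.contDiffAt {η : P → F →L[ℝ] ℝ} (hη : SmoothOneForm η) (p : P) :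
    ContDiffAt ℝ ∞ (chartForm η p) (extChartAt 𝓘(ℝ, F) p p) :=
  (hη p).contDiffAt (extChartAt_target_mem_nhds (I := 𝓘(ℝ, F)) p)

theorem extD_eq {η : P → F →L[ℝ] ℝ} (hη : SmoothOneForm η) (p : P) (X Y : F) :
    extD η p X Y = fderiv ℝ (chartForm η p) (extChartAt 𝓘(ℝ, F) p p) X Y
      - fderiv ℝ (chartForm η p) (extChartAt 𝓘(ℝ, F) p p) Y X :=
  extDeriv_ofSubsingleton ((hη.contDiffAt p).differentiableAt (by simp)) X Y

theorem chartForm_add (η θ : P → F →L[ℝ] ℝ) (p₀ : P) :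
    chartForm (η + θ) p₀ = chartForm η p₀ + chartForm θ p₀ := by
  funext z
  exact ContinuousLinearMap.add_comp _ _ _

theorem chartForm_smul (a : ℝ) (η : P → F →L[ℝ] ℝ) (p₀ : P) :
    chartForm (a • η) p₀ = a • chartForm η p₀ := by
  funext z
  exact ContinuousLinearMap.smul_comp _ _ _

theorem SmoothOneForm.add {η θ : P → F →L[ℝ] ℝ} (hη : SmoothOneForm η) (hθ : SmoothOneForm θ) :
    SmoothOneForm (η + θ) := by
  intro p₀
  rw [chartForm_add]
  exact (hη p₀).add (hθ p₀)

theorem SmoothOneForm.smul {η : P → F →L[ℝ] ℝ} (hη : SmoothOneForm η) (a : ℝ) :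
    SmoothOneForm (a • η) := by
  intro p₀
  rw [chartForm_smul]
  exact (hη p₀).const_smul a

theorem extD_add {η θ : P → F →L[ℝ] ℝ} (hη : SmoothOneForm η) (hθ : SmoothOneForm θ) (p : P)
    (X Y : F) : extD (η + θ) p X Y = extD η p X Y + extD θ p X Y := by
  rw [extD_eq hη, extD_eq hθ, extD_eq (hη.add hθ), chartForm_add,
    fderiv_add ((hη.contDiffAt p).differentiableAt (by simp))
      ((hθ.contDiffAt p).differentiableAt (by simp))]
  simp only [add_apply]
  ring

theorem extD_smul {η : P → F →L[ℝ] ℝ} (hη : SmoothOneForm η) (a : ℝ) (p : P)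
    (X Y : F) : extD (a • η) p X Y = a * extD η p X Y := by
  rw [extD_eq hη, extD_eq (hη.smul a), chartForm_smul,
    fderiv_const_smul ((hη.contDiffAt p).differentiableAt (by simp))]
  simp only [smul_apply, smul_eq_mul]
  ring

theorem SmoothOneForm.neg {η : P → F →L[ℝ] ℝ} (hη : SmoothOneForm η) : SmoothOneForm (-η) := by
  rw [← neg_one_smul ℝ η]
  exact hη.smul (-1)

theorem SmoothOneForm.sub {η θ : P → F →L[ℝ] ℝ} (hη : SmoothOneForm η) (hθ : SmoothOneForm θ) :
    SmoothOneForm (η - θ) := by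
  simpa [sub_eq_add_neg] using hη.add hθ.neg

theorem extD_neg {η : P → F →L[ℝ] ℝ} (hη : SmoothOneForm η) (p : P)
    (X Y : F) : extD (-η) p X Y = -extD η p X Y := by
  rw [← neg_one_smul ℝ η, extD_smul hη, neg_one_mul]

theorem extD_sub {η θ : P → F →L[ℝ] ℝ} (hη : SmoothOneForm η) (hθ : SmoothOneForm θ) (p : P)
    (X Y : F) : extD (η - θ) p X Y = extD η p X Y - extD θ p X Y := by
  rw [sub_eq_add_neg, extD_add hη hθ.neg, extD_neg hθ, sub_eq_add_neg]

theorem SmoothOneForm.zero : SmoothOneForm (0 : P → F →L[ℝ] ℝ) := by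
  intro p₀
  have : chartForm (0 : P → F →L[ℝ] ℝ) p₀ = fun _ => 0 := by
    funext z; exact ContinuousLinearMap.zero_comp _
  rw [this]
  exact contDiffOn_const

theorem SmoothOneForm.sum {n : ℕ} {η : ℕ → P → F →L[ℝ] ℝ} (hη : ∀ i < n, SmoothOneForm (η i)) :
    SmoothOneForm (∑ i ∈ Finset.range n, η i) := by
  induction n with
  | zero => simpa using SmoothOneForm.zero
  | succ n ih =>
    rw [Finset.sum_range_succ]
    exact (ih fun i hi => hη i (by omega)).add (hη n (by omega))

theorem extD_sum {n : ℕ} {η : ℕ → P → F →L[ℝ] ℝ} (hη : ∀ i < n, SmoothOneForm (η i)) (p : P)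
    (X Y : F) :
    extD (∑ i ∈ Finset.range n, η i) p X Y = ∑ i ∈ Finset.range n, extD (η i) p X Y := by
  induction n with
  | zero =>
    have := extD_smul (SmoothOneForm.zero (P := P) (F := F)) 0 p X Y
    simpa using this
  | succ n ih =>
    rw [Finset.sum_range_succ, Finset.sum_range_succ,
      extD_add (SmoothOneForm.sum fun i hi => hη i (by omega)) (hη n (by omega)),
      ih fun i hi => hη i (by omega)]

variable [IsManifold 𝓘(ℝ, F) ∞ P]

theorem contMDiffAt_extChartAt_symm {p₀ : P} {z : F} (hz : z ∈ (extChartAt 𝓘(ℝ, F) p₀).target) :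
    ContMDiffAt 𝓘(ℝ, F) 𝓘(ℝ, F) ∞ (extChartAt 𝓘(ℝ, F) p₀).symm z :=
  (contMDiffOn_extChartAt_symm (I := 𝓘(ℝ, F)) (n := ∞) p₀).contMDiffAt
    ((isOpen_extChartAt_target (I := 𝓘(ℝ, F)) p₀).mem_nhds hz)

/-- In the preferred chart at `p`, the tangent space `T_pP` is identified with `F`. -/
theorem hasD_extChartAt_symm (p : P) :
    HasD 𝓘(ℝ, F) 𝓘(ℝ, F) (extChartAt 𝓘(ℝ, F) p).symm (extChartAt 𝓘(ℝ, F) p p)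
      (ContinuousLinearMap.id ℝ F) := by
  have : IsManifold 𝓘(ℝ, F) 1 P := IsManifold.of_le (n := ∞) (by simp)
  have h1 := hasD_mfderiv (I := 𝓘(ℝ, F)) (I' := 𝓘(ℝ, F))
    (mdifferentiableAt_extChartAt (I := 𝓘(ℝ, F)) (mem_chart_source F p))
  have e : (mfderiv 𝓘(ℝ, F) 𝓘(ℝ, F) (extChartAt 𝓘(ℝ, F) p) p : F →L[ℝ] F)
      = ContinuousLinearMap.id ℝ F := mfderiv_extChartAt_self (I := 𝓘(ℝ, F)) (x := p)
  rw [e] at h1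
  have h := hasD_mfderiv ((contMDiffAt_extChartAt_symm
    (mem_extChartAt_target (I := 𝓘(ℝ, F)) p)).mdifferentiableAt (by simp))
  have h2 := h1.comp h (extChartAt_to_inv (I := 𝓘(ℝ, F)) p)
  have h3 : HasD 𝓘(ℝ, F) 𝓘(ℝ, F) (fun y : F => extChartAt 𝓘(ℝ, F) p
      ((extChartAt 𝓘(ℝ, F) p).symm y)) (extChartAt 𝓘(ℝ, F) p p) (ContinuousLinearMap.id ℝ F) := by
    refine (hasD_id (I := 𝓘(ℝ, F)) (extChartAt 𝓘(ℝ, F) p p)).congr_of_eventuallyEq ?_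
    filter_upwards [extChartAt_target_mem_nhds (I := 𝓘(ℝ, F)) p] with y hy
    exact PartialEquiv.right_inv _ hy
  have e' : (mfderiv 𝓘(ℝ, F) 𝓘(ℝ, F) (extChartAt 𝓘(ℝ, F) p).symm (extChartAt 𝓘(ℝ, F) p p)
      : F →L[ℝ] F) = ContinuousLinearMap.id ℝ F := h2.unique h3
  rwa [e'] at h

theorem contMDiff_comp_extChartAt_symm {V N L : Type*} [NormedAddCommGroup V] [NormedSpace ℝ V]
    [TopologicalSpace N] {I : ModelWithCorners ℝ V N} [TopologicalSpace L] [ChartedSpace N L]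
    {f : P → L} (hf : ContMDiff 𝓘(ℝ, F) I ∞ f) {p₀ : P} {z : F}
    (hz : z ∈ (extChartAt 𝓘(ℝ, F) p₀).target) :
    ContMDiffAt 𝓘(ℝ, F) I ∞ (fun y => f ((extChartAt 𝓘(ℝ, F) p₀).symm y)) z :=
  (hf _).comp z (contMDiffAt_extChartAt_symm hz)

theorem rightMC_chart {u : P → G} (hu : ContMDiff 𝓘(ℝ, F) 𝓘(ℝ, E) ∞ u) {p₀ : P} {z : F}
    (hz : z ∈ (extChartAt 𝓘(ℝ, F) p₀).target) :
    (rightMC (F := F) 𝓘(ℝ, E) u ((extChartAt 𝓘(ℝ, F) p₀).symm z)).comp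
      (mfderiv 𝓘(ℝ, F) 𝓘(ℝ, F) (extChartAt 𝓘(ℝ, F) p₀).symm z : F →L[ℝ] F)
      = rightMC (F := F) 𝓘(ℝ, E) (fun y => u ((extChartAt 𝓘(ℝ, F) p₀).symm y)) z := by
  symm
  exact HasD.rightMC_eq ((hasD_rightMC ((hu _).mdifferentiableAt (by simp))).comp
    (hasD_mfderiv ((contMDiffAt_extChartAt_symm hz).mdifferentiableAt (by simp))) rfl)

theorem chartForm_jdu (j : P → E →L[ℝ] ℝ) {u : P → G} (hu : ContMDiff 𝓘(ℝ, F) 𝓘(ℝ, E) ∞ u)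
    (p₀ : P) : Set.EqOn (chartForm (jdu j u) p₀)
      (fun z => (j ((extChartAt 𝓘(ℝ, F) p₀).symm z)).comp
        (rightMC (F := F) 𝓘(ℝ, E) (fun y => u ((extChartAt 𝓘(ℝ, F) p₀).symm y)) z))
      (extChartAt 𝓘(ℝ, F) p₀).target := by
  intro z hz
  change ((j _).comp (rightMC (F := F) 𝓘(ℝ, E) u _)).comp _ = (j _).comp _
  rw [← rightMC_chart hu hz]
  rfl

theorem SmoothOneForm.comp_dFun {b : P → W →L[ℝ] ℝ} {f : P → W}
    (hb : ContMDiff 𝓘(ℝ, F) 𝓘(ℝ, W →L[ℝ] ℝ) ∞ b) (hf : ContMDiff 𝓘(ℝ, F) 𝓘(ℝ, W) ∞ f) :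
    SmoothOneForm (F := F) (fun p => (b p).comp (dFun f p)) := by
  intro p₀
  have he : Set.EqOn (chartForm (fun p => (b p).comp (dFun (F := F) f p)) p₀)
      (fun z => (b ((extChartAt 𝓘(ℝ, F) p₀).symm z)).comp
        (fderiv ℝ (fun y => f ((extChartAt 𝓘(ℝ, F) p₀).symm y)) z))
      (extChartAt 𝓘(ℝ, F) p₀).target := by
    intro z hz
    have h : HasD 𝓘(ℝ, F) 𝓘(ℝ, W) f ((extChartAt 𝓘(ℝ, F) p₀).symm z)
        (dFun (F := F) f ((extChartAt 𝓘(ℝ, F) p₀).symm z)) :=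
      hasD_mfderiv ((hf _).mdifferentiableAt (by simp))
    have h' := hasD_iff_hasFDerivAt.1 (h.comp (hasD_mfderiv
      ((contMDiffAt_extChartAt_symm hz).mdifferentiableAt (by simp))) rfl)
    change ((b _).comp (dFun (F := F) f _)).comp _ = (b _).comp _
    rw [h'.fderiv]
    rfl
  refine ContDiffOn.congr (fun z hz => ?_) he
  have h1 := (contMDiff_comp_extChartAt_symm hb hz).contDiffAt
  have h2 := ((contMDiff_comp_extChartAt_symm hf hz).contDiffAt).fderiv_right (m := ∞) (by simp)
  exact (h1.clm_comp h2).contDiffWithinAt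

variable [CompleteSpace E]

theorem SmoothOneForm.jdu {j : P → E →L[ℝ] ℝ} {u : P → G}
    (hj : ContMDiff 𝓘(ℝ, F) 𝓘(ℝ, E →L[ℝ] ℝ) ∞ j) (hu : ContMDiff 𝓘(ℝ, F) 𝓘(ℝ, E) ∞ u) :
    SmoothOneForm (F := F) (jdu j u) := by
  intro p₀
  refine ContDiffOn.congr (fun z hz => ?_) (chartForm_jdu j hu p₀)
  have h1 := (contMDiff_comp_extChartAt_symm hj hz).contDiffAt
  have h2 := contDiffAt_rightMC (contMDiff_comp_extChartAt_symm hu hz)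
  exact (h1.clm_comp h2).contDiffWithinAt

/-- `δ⟨j, δu u⁻¹⟩ = ⟨δj ∧ δu u⁻¹⟩ + ⟨j, [δu u⁻¹, δu u⁻¹]⟩`, by the Maurer-Cartan equation. -/
theorem extD_jdu {j : P → E →L[ℝ] ℝ} {u : P → G}
    (hj : ContMDiff 𝓘(ℝ, F) 𝓘(ℝ, E →L[ℝ] ℝ) ∞ j) (hu : ContMDiff 𝓘(ℝ, F) 𝓘(ℝ, E) ∞ u)
    (p : P) (X Y : F) :
    extD (FlatConn.jdu j u) p X Y
      = dFun (F := F) j p X (rightMC (F := F) 𝓘(ℝ, E) u p Y)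
        - dFun (F := F) j p Y (rightMC (F := F) 𝓘(ℝ, E) u p X)
        + j p (adL G (rightMC (F := F) 𝓘(ℝ, E) u p X) (rightMC (F := F) 𝓘(ℝ, E) u p Y)) := by
  set z := extChartAt 𝓘(ℝ, F) p p with hz
  have hzt : z ∈ (extChartAt 𝓘(ℝ, F) p).target := mem_extChartAt_target (I := 𝓘(ℝ, F)) p
  have hzp : (extChartAt 𝓘(ℝ, F) p).symm z = p := extChartAt_to_inv (I := 𝓘(ℝ, F)) p
  rw [extD_eq (SmoothOneForm.jdu hj hu), ← hz]
  have hu' := contMDiff_comp_extChartAt_symm hu hzt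
  have h1 : HasFDerivAt (fun y => j ((extChartAt 𝓘(ℝ, F) p).symm y)) (dFun (F := F) j p) z := by
    have h : HasD 𝓘(ℝ, F) 𝓘(ℝ, E →L[ℝ] ℝ) j p (dFun (F := F) j p) :=
      hasD_mfderiv ((hj _).mdifferentiableAt (by simp))
    have := hasD_iff_hasFDerivAt.1 (h.comp (hasD_extChartAt_symm p) hzp)
    rwa [ContinuousLinearMap.comp_id] at this
  have h2 := ((contDiffAt_rightMC hu').differentiableAt (by simp)).hasFDerivAt
  have h3 := (h1.clm_comp h2).congr_of_eventuallyEq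
    ((chartForm_jdu j hu p).eventuallyEq_of_mem (extChartAt_target_mem_nhds (I := 𝓘(ℝ, F)) p))
  have h4 : rightMC (F := F) 𝓘(ℝ, E) (fun y => u ((extChartAt 𝓘(ℝ, F) p).symm y)) z
      = rightMC (F := F) 𝓘(ℝ, E) u p := by
    refine HasD.rightMC_eq ?_
    have := (hasD_rightMC ((hu p).mdifferentiableAt (by simp))).comp (hasD_extChartAt_symm p) hzp
    rw [ContinuousLinearMap.comp_id] at this
    rwa [hzp]
  have h5 := maurerCartan hu' X Y
  rw [h3.fderiv]
  rw [h4] at h5 ⊢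
  simp only [add_apply,
    ContinuousLinearMap.comp_apply, ContinuousLinearMap.compL_apply,
    ContinuousLinearMap.flip_apply, hzp]
  rw [← h5, map_sub]
  ring

end Forms

/-! ### Equivariance of the bracket, and calculus with `HasD` -/

section AdEquivariance

variable {E : Type*} [NormedAddCommGroup E] [NormedSpace ℝ E] [CompleteSpace E]
  {G : Type*} [TopologicalSpace G] [ChartedSpace E G] [Group G] [LieGroup 𝓘(ℝ, E) ∞ G]

/-- `Ad(u)` preserves the bracket; differentiate `Ad(u x u⁻¹) = Ad(u) Ad(x) Ad(u⁻¹)` at `x = 1`. -/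
theorem adL_Ad (u : G) (ξ ζ : E) :
    adL G (Ad 𝓘(ℝ, E) u ξ) (Ad 𝓘(ℝ, E) u ζ) = Ad 𝓘(ℝ, E) u (adL G ξ ζ) := by
  have h1 : HasD 𝓘(ℝ, E) 𝓘(ℝ, E →L[ℝ] E) (fun x : G => Ad 𝓘(ℝ, E) (u * x * u⁻¹)) 1
      ((adL G).comp (Ad 𝓘(ℝ, E) u)) := (hasD_conj 𝓘(ℝ, E) u).Ad (by simp)
  let T : (E →L[ℝ] E) →L[ℝ] (E →L[ℝ] E) :=
    (ContinuousLinearMap.compL ℝ E E E (Ad 𝓘(ℝ, E) u)).comp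
      ((ContinuousLinearMap.compL ℝ E E E).flip (Ad 𝓘(ℝ, E) u⁻¹))
  have h2 : HasD 𝓘(ℝ, E) 𝓘(ℝ, E →L[ℝ] E) (fun x : G => T (Ad 𝓘(ℝ, E) x)) 1 (T.comp (adL G)) :=
    (hasD_iff_hasFDerivAt.2 T.hasFDerivAt).comp hasD_Ad_one rfl
  have e : (fun x : G => T (Ad 𝓘(ℝ, E) x)) = fun x : G => Ad 𝓘(ℝ, E) (u * x * u⁻¹) := by
    funext x
    rw [Ad_map_mul, Ad_map_mul]
    rfl
  rw [e] at h2
  have h3 := DFunLike.congr_fun (DFunLike.congr_fun (h1.unique h2) ξ) (Ad 𝓘(ℝ, E) u ζ)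
  refine h3.trans ?_
  change Ad 𝓘(ℝ, E) u (adL G ξ (Ad 𝓘(ℝ, E) u⁻¹ (Ad 𝓘(ℝ, E) u ζ))) = _
  rw [Ad_inv_Ad]

variable {V' : Type*} [NormedAddCommGroup V'] [NormedSpace ℝ V']
  {N' : Type*} [TopologicalSpace N'] {J : ModelWithCorners ℝ V' N'}
  {Q : Type*} [TopologicalSpace Q] [ChartedSpace N' Q]

/-- The derivative of inversion at `1` is `-id`. -/
theorem HasD.inv {f : Q → G} {p : Q} {S : V' →L[ℝ] E} (hf : HasD J 𝓘(ℝ, E) f p S)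
    (hf1 : f p = 1) : HasD J 𝓘(ℝ, E) (fun y => (f y)⁻¹) p (-S) := by
  have hm : MDifferentiableAt 𝓘(ℝ, E) 𝓘(ℝ, E) (fun z : G => z⁻¹) (f p) :=
    ((contMDiff_inv 𝓘(ℝ, E) ∞) _).mdifferentiableAt (by simp)
  obtain ⟨T, hT⟩ : ∃ T : E →L[ℝ] E, HasD 𝓘(ℝ, E) 𝓘(ℝ, E) (fun z : G => z⁻¹) (f p) T :=
    ⟨_, hasD_mfderiv hm⟩
  have h1 := hT.comp hf rfl
  have h2 := hf.mul h1 hf1 (by simp [hf1])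
  have h3 : HasD J 𝓘(ℝ, E) (fun y => f y * (f y)⁻¹) p (0 : V' →L[ℝ] E) := by
    simpa using hasD_const (I := J) (I' := 𝓘(ℝ, E)) (1 : G) p
  rwa [← neg_eq_of_add_eq_zero_right (h2.unique h3)] at h1

theorem HasD.prodMk_space {V W : Type*} [NormedAddCommGroup V] [NormedSpace ℝ V]
    [NormedAddCommGroup W] [NormedSpace ℝ W] {f : Q → V} {g : Q → W} {p : Q} {S : V' →L[ℝ] V}
    {T : V' →L[ℝ] W} (hf : HasD J 𝓘(ℝ, V) f p S) (hg : HasD J 𝓘(ℝ, W) g p T) :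
    HasD J 𝓘(ℝ, V × W) (fun y => (f y, g y)) p (S.prod T) :=
  ⟨hf.continuousAt.prodMk hg.continuousAt, HasFDerivWithinAt.prodMk hf.2 hg.2⟩

/-- The product rule for the composition of operators. -/
theorem HasD.clm_comp {U V W : Type*} [NormedAddCommGroup U] [NormedSpace ℝ U]
    [NormedAddCommGroup V] [NormedSpace ℝ V] [NormedAddCommGroup W] [NormedSpace ℝ W]
    {j : Q → V →L[ℝ] W} {f : Q → U →L[ℝ] V} {p : Q} {S : V' →L[ℝ] V →L[ℝ] W}
    {T : V' →L[ℝ] U →L[ℝ] V} (hj : HasD J 𝓘(ℝ, V →L[ℝ] W) j p S)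
    (hf : HasD J 𝓘(ℝ, U →L[ℝ] V) f p T) :
    HasD J 𝓘(ℝ, U →L[ℝ] W) (fun y => (j y).comp (f y)) p
      ((ContinuousLinearMap.compL ℝ U V W (j p)).comp T +
        ((ContinuousLinearMap.compL ℝ U V W).flip (f p)).comp S) := by
  have h1 : HasD J 𝓘(ℝ, (V →L[ℝ] W) × (U →L[ℝ] V)) (fun y => (j y, f y)) p (S.prod T) :=
    hj.prodMk_space hf
  have h2 : HasFDerivAt (fun z : (V →L[ℝ] W) × (U →L[ℝ] V) => z.1.comp z.2)
      ((ContinuousLinearMap.compL ℝ U V W (j p)).comp (ContinuousLinearMap.snd ℝ _ _) +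
        ((ContinuousLinearMap.compL ℝ U V W).flip (f p)).comp (ContinuousLinearMap.fst ℝ _ _))
      (j p, f p) :=
    HasFDerivAt.clm_comp (x := (j p, f p)) hasFDerivAt_fst hasFDerivAt_snd
  have h3 := (hasD_iff_hasFDerivAt.2 h2).comp h1 rfl
  exact h3

end AdEquivariance

/-! ### The Lie group `G ⋉ 𝔤*` -/

section Semidirect

variable {E : Type*} [NormedAddCommGroup E] [NormedSpace ℝ E]
  {G : Type*} [TopologicalSpace G] [ChartedSpace E G] [Group G] [LieGroup 𝓘(ℝ, E) ∞ G]

/-- The component `u` of `(u, -Ad*(u⁻¹) j)`. -/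
def SemiDual.base (h : SemiDual E G) : G := h.1

/-- The component `j` of `(u, -Ad*(u⁻¹) j)`. -/
def SemiDual.moment (h : SemiDual E G) : E →L[ℝ] ℝ := -coAd h.1 h.2

theorem coAd_mul (u v : G) (j : E →L[ℝ] ℝ) : coAd (u * v) j = coAd v (coAd u j) := by
  simp only [coAd, Ad_map_mul, ContinuousLinearMap.comp_assoc]

theorem coAd_one (j : E →L[ℝ] ℝ) : coAd (1 : G) j = j := by
  simp only [coAd, Ad_map_one, ContinuousLinearMap.comp_id]

theorem coAd_apply (u : G) (j : E →L[ℝ] ℝ) (ξ : E) : coAd u j ξ = j (Ad 𝓘(ℝ, E) u ξ) := rfl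

theorem coAd_add (u : G) (j j' : E →L[ℝ] ℝ) : coAd u (j + j') = coAd u j + coAd u j' := rfl

theorem coAd_neg (u : G) (j : E →L[ℝ] ℝ) : coAd u (-j) = -coAd u j := rfl

theorem coAd_inv_coAd (u : G) (j : E →L[ℝ] ℝ) : coAd u⁻¹ (coAd u j) = j := by
  rw [← coAd_mul, mul_inv_cancel, coAd_one]

theorem coAd_coAd_inv (u : G) (j : E →L[ℝ] ℝ) : coAd u (coAd u⁻¹ j) = j := by
  rw [← coAd_mul, inv_mul_cancel, coAd_one]

namespace SemiDual

@[simp] theorem base_mul (h h' : SemiDual E G) : (h * h').base = h.base * h'.base := rfl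

@[simp] theorem base_inv (h : SemiDual E G) : h⁻¹.base = h.base⁻¹ := rfl

@[simp] theorem base_one : (1 : SemiDual E G).base = 1 := rfl

@[simp] theorem base_mk (u : G) (a : E →L[ℝ] ℝ) : (mk u a).base = u := rfl

theorem moment_mk (u : G) (a : E →L[ℝ] ℝ) : (mk u a).moment = -coAd u a := rfl

@[simp] theorem moment_ofUJ (u : G) (j : E →L[ℝ] ℝ) : (ofUJ u j).moment = j := by
  change -coAd u (-coAd u⁻¹ j) = j
  rw [coAd_neg, coAd_coAd_inv, neg_neg]

theorem moment_mul (h h' : SemiDual E G) :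
    (h * h').moment = h'.moment + coAd h'.base h.moment := by
  change -coAd (h.1 * h'.1) (h.2 + coAd h.1⁻¹ h'.2) = -coAd h'.1 h'.2 + coAd h'.1 (-coAd h.1 h.2)
  rw [coAd_mul, coAd_add, coAd_coAd_inv, coAd_add, coAd_neg]
  abel

theorem moment_inv (h : SemiDual E G) : h⁻¹.moment = -coAd h.base⁻¹ h.moment := by
  change -coAd h.1⁻¹ (-coAd h.1 h.2) = -coAd h.1⁻¹ (-coAd h.1 h.2)
  rfl

end SemiDual

variable [CompleteSpace E]

instance : IsManifold (sdModel E) ∞ (SemiDual E G) :=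
  inferInstanceAs (IsManifold (𝓘(ℝ, E).prod 𝓘(ℝ, E →L[ℝ] ℝ)) ∞ (G × (E →L[ℝ] ℝ)))

section Smooth

variable {V' : Type*} [NormedAddCommGroup V'] [NormedSpace ℝ V']
  {N' : Type*} [TopologicalSpace N'] {J : ModelWithCorners ℝ V' N'}
  {Q : Type*} [TopologicalSpace Q] [ChartedSpace N' Q]

theorem contMDiff_coAd {u : Q → G} {j : Q → E →L[ℝ] ℝ} (hu : ContMDiff J 𝓘(ℝ, E) ∞ u)
    (hj : ContMDiff J 𝓘(ℝ, E →L[ℝ] ℝ) ∞ j) :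
    ContMDiff J 𝓘(ℝ, E →L[ℝ] ℝ) ∞ (fun p => coAd (u p) (j p)) :=
  hj.clm_comp ((contMDiff_Ad G).comp hu)

theorem contMDiff_semiDual_mk {u : Q → G} {a : Q → E →L[ℝ] ℝ} (hu : ContMDiff J 𝓘(ℝ, E) ∞ u)
    (ha : ContMDiff J 𝓘(ℝ, E →L[ℝ] ℝ) ∞ a) :
    ContMDiff J (sdModel E) ∞ (fun p => SemiDual.mk (u p) (a p)) :=
  ContMDiff.prodMk hu ha

theorem contMDiff_base {h : Q → SemiDual E G} (hh : ContMDiff J (sdModel E) ∞ h) :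
    ContMDiff J 𝓘(ℝ, E) ∞ (fun p => (h p).base) :=
  contMDiff_fst.comp (M' := G × (E →L[ℝ] ℝ)) hh

theorem contMDiff_dual {h : Q → SemiDual E G} (hh : ContMDiff J (sdModel E) ∞ h) :
    ContMDiff J 𝓘(ℝ, E →L[ℝ] ℝ) ∞ (fun p => (h p).2) :=
  contMDiff_snd.comp (M' := G × (E →L[ℝ] ℝ)) hh

theorem contMDiff_moment {h : Q → SemiDual E G} (hh : ContMDiff J (sdModel E) ∞ h) :
    ContMDiff J 𝓘(ℝ, E →L[ℝ] ℝ) ∞ (fun p => (h p).moment) :=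
  (contMDiff_coAd (contMDiff_base hh) (contMDiff_dual hh)).neg

theorem contMDiff_ofUJ {u : Q → G} {j : Q → E →L[ℝ] ℝ} (hu : ContMDiff J 𝓘(ℝ, E) ∞ u)
    (hj : ContMDiff J 𝓘(ℝ, E →L[ℝ] ℝ) ∞ j) :
    ContMDiff J (sdModel E) ∞ (fun p => ofUJ (u p) (j p)) :=
  contMDiff_semiDual_mk hu (contMDiff_coAd hu.inv hj).neg

end Smooth

instance : LieGroup (sdModel E) ∞ (SemiDual E G) where
  contMDiff_mul := by
    have h1 : ContMDiff ((sdModel E).prod (sdModel E)) (sdModel E) ∞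
      (fun z : SemiDual E G × SemiDual E G => z.1) := contMDiff_fst
    have h2 : ContMDiff ((sdModel E).prod (sdModel E)) (sdModel E) ∞
      (fun z : SemiDual E G × SemiDual E G => z.2) := contMDiff_snd
    exact contMDiff_semiDual_mk ((contMDiff_base h1).mul (contMDiff_base h2))
      ((contMDiff_dual h1).add (contMDiff_coAd (contMDiff_base h1).inv (contMDiff_dual h2)))
  contMDiff_inv := by
    have h1 : ContMDiff (sdModel E) (sdModel E) ∞ (fun z : SemiDual E G => z) := contMDiff_id
    exact contMDiff_semiDual_mk (contMDiff_base h1).inv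
      (contMDiff_coAd (contMDiff_base h1) (contMDiff_dual h1)).neg

end Semidirect

/-! ### The adjoint action and the Maurer-Cartan forms of `G ⋉ 𝔤*` -/

section Semidirect

variable {E : Type*} [NormedAddCommGroup E] [NormedSpace ℝ E] [CompleteSpace E]
  {G : Type*} [TopologicalSpace G] [ChartedSpace E G] [Group G] [LieGroup 𝓘(ℝ, E) ∞ G]
  {F : Type*} [NormedAddCommGroup F] [NormedSpace ℝ F]
  {P : Type*} [TopologicalSpace P] [ChartedSpace F P]

theorem hasD_dFun {W : Type*} [NormedAddCommGroup W] [NormedSpace ℝ W] {f : P → W} {p : P}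
    (hf : MDifferentiableAt 𝓘(ℝ, F) 𝓘(ℝ, W) f p) : HasD 𝓘(ℝ, F) 𝓘(ℝ, W) f p (dFun (F := F) f p) :=
  hasD_mfderiv hf

/-- `Ad(u, -Ad*(u⁻¹) j) (ξ, β) = (Ad(u) ξ, Ad*(u⁻¹) (β - j ∘ ad ξ))`. -/
theorem Ad_semiDual (h : SemiDual E G) (z : E × (E →L[ℝ] ℝ)) :
    Ad (sdModel E) h z = (Ad 𝓘(ℝ, E) h.base z.1,
      coAd h.base⁻¹ (z.2 - h.moment.comp (adL G z.1))) := by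
  have h1 : HasD (sdModel E) 𝓘(ℝ, E) (fun y : SemiDual E G => y.base) 1
      (ContinuousLinearMap.fst ℝ E (E →L[ℝ] ℝ)) :=
    hasMFDerivAt_fst (M := G) (M' := E →L[ℝ] ℝ) (I := 𝓘(ℝ, E)) (I' := 𝓘(ℝ, E →L[ℝ] ℝ))
      (x := ((1 : G), (0 : E →L[ℝ] ℝ)))
  have h2 : HasD (sdModel E) 𝓘(ℝ, E →L[ℝ] ℝ) (fun y : SemiDual E G => y.2) 1
      (ContinuousLinearMap.snd ℝ E (E →L[ℝ] ℝ)) :=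
    hasMFDerivAt_snd (M := G) (M' := E →L[ℝ] ℝ) (I := 𝓘(ℝ, E)) (I' := 𝓘(ℝ, E →L[ℝ] ℝ))
      (x := ((1 : G), (0 : E →L[ℝ] ℝ)))
  have h3 := h1.conj rfl h.base
  have h4 := (h1.inv rfl).Ad (by simp)
  let Φ : (E →L[ℝ] ℝ) × (E →L[ℝ] E) →L[ℝ] (E →L[ℝ] ℝ) :=
    ((ContinuousLinearMap.compL ℝ E E ℝ).flip (Ad 𝓘(ℝ, E) h.base⁻¹)).comp
      (ContinuousLinearMap.fst ℝ _ _ +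
        (ContinuousLinearMap.compL ℝ E E ℝ h.moment).comp (ContinuousLinearMap.snd ℝ _ _))
  have h5 := (hasD_iff_hasFDerivAt.2 ((Φ.hasFDerivAt (x := ((1 : SemiDual E G).2,
    Ad 𝓘(ℝ, E) (1 : SemiDual E G).base⁻¹))).const_add h.2)).comp (h2.prodMk_space h4) rfl
  have h6 := h3.prodMk h5
  have he : (fun y : SemiDual E G => ((h.base * y.base * h.base⁻¹,
      h.2 + Φ (y.2, Ad 𝓘(ℝ, E) y.base⁻¹)) : G × (E →L[ℝ] ℝ)))
      = fun y : SemiDual E G => h * y * h⁻¹ := by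
    funext y
    refine Prod.ext rfl ?_
    change h.2 + coAd h.base⁻¹ (y.2 + coAd y.base⁻¹ h.moment)
      = h.2 + coAd h.base⁻¹ y.2 + coAd (h.base * y.base)⁻¹ (-coAd h.base h.2)
    rw [coAd_add, ← add_assoc, ← coAd_mul, ← mul_inv_rev]
    rfl
  rw [he] at h6
  have h7 := (hasD_conj (sdModel E) h).unique h6
  rw [h7]
  refine Prod.ext rfl ?_
  ext ξ
  simp [Φ, coAd_apply, sub_eq_add_neg]

theorem pairing_apply (z z' : E × (E →L[ℝ] ℝ)) : pairing z z' = z.2 z'.1 + z'.2 z.1 := rfl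

theorem pairing_Ad (h : SemiDual E G) (z z' : E × (E →L[ℝ] ℝ)) :
    pairing (Ad (sdModel E) h z) (Ad (sdModel E) h z') = pairing z z' := by
  rw [Ad_semiDual, Ad_semiDual, pairing_apply, pairing_apply]
  simp only [coAd_apply, Ad_inv_Ad, sub_apply, ContinuousLinearMap.comp_apply]
  rw [adL_swap G z'.1 z.1, map_neg]
  ring

variable {h h' : P → SemiDual E G} {p : P}

theorem rightMC_semiDual (hh : ContMDiff 𝓘(ℝ, F) (sdModel E) ∞ h) (X : F) :
    rightMC (F := F) (sdModel E) h p X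
      = (rightMC (F := F) 𝓘(ℝ, E) (fun q => (h q).base) p X,
        -coAd (h p).base⁻¹ (dFun (F := F) (fun q => (h q).moment) p X)) := by
  have hb := hasD_rightMC ((contMDiff_base hh p).mdifferentiableAt (by simp))
  have hm := hasD_dFun ((contMDiff_moment hh p).mdifferentiableAt (by simp))
  obtain ⟨T, hA⟩ : ∃ T : F →L[ℝ] E →L[ℝ] E,
      HasD 𝓘(ℝ, F) 𝓘(ℝ, E →L[ℝ] E) (fun y => Ad 𝓘(ℝ, E) (h y).base⁻¹) p T :=
    ⟨_, hasD_mfderiv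
      (((contMDiff_Ad G).comp (contMDiff_base hh).inv p).mdifferentiableAt (by simp))⟩
  have hs : HasD 𝓘(ℝ, F) 𝓘(ℝ, E →L[ℝ] ℝ) (fun q => (h p).moment - (h q).moment) p
      (-dFun (F := F) (fun q => (h q).moment) p) := by
    have := (hasFDerivAt_id (𝕜 := ℝ) (h p).moment).const_sub (h p).moment
    have := (hasD_iff_hasFDerivAt.2 this).comp hm rfl
    simpa using this
  have hc := hb.prodMk (hs.clm_comp hA)
  have he : ∀ q, (h q * (h p)⁻¹ : SemiDual E G) = SemiDual.mk ((h q).base * (h p).base⁻¹)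
      (((h p).moment - (h q).moment).comp (Ad 𝓘(ℝ, E) (h q).base⁻¹)) := by
    intro q
    refine Prod.ext rfl ?_
    change (h q).2 + coAd (h q).1⁻¹ (-coAd (h p).1 (h p).2)
      = coAd (h q).1⁻¹ (-coAd (h p).1 (h p).2 - -coAd (h q).1 (h q).2)
    rw [sub_neg_eq_add, coAd_add, coAd_inv_coAd, add_comm]
  have hR : HasD 𝓘(ℝ, F) (sdModel E) (fun q => h q * (h p)⁻¹) p _ :=
    hasD_rightMC ((hh p).mdifferentiableAt (by simp))
  simp only [he] at hR
  have := DFunLike.congr_fun (hR.unique hc) X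
  rw [this]
  refine Prod.ext rfl ?_
  simp [coAd]

theorem leftMC_semiDual (hh : ContMDiff 𝓘(ℝ, F) (sdModel E) ∞ h) (X : F) :
    leftMC (F := F) (sdModel E) h p X
      = (leftMC (F := F) 𝓘(ℝ, E) (fun q => (h q).base) p X,
        (h p).moment.comp (adL G (leftMC (F := F) 𝓘(ℝ, E) (fun q => (h q).base) p X))
          - dFun (F := F) (fun q => (h q).moment) p X) := by
  rw [leftMC_eq ((hh p).mdifferentiableAt (by simp)),
    leftMC_eq ((contMDiff_base hh p).mdifferentiableAt (by simp)),
    ContinuousLinearMap.comp_apply, Ad_semiDual, rightMC_semiDual hh]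
  refine Prod.ext rfl ?_
  ext ξ
  simp only [SemiDual.base_inv, SemiDual.moment_inv, inv_inv, coAd_apply, sub_apply, neg_apply,
    ContinuousLinearMap.comp_apply, Ad_inv_Ad, ← adL_Ad]
  ring

end Semidirect

/-! ### The Polyakov-Wiegmann identity -/

section PolyakovWiegmann

variable {E : Type*} [NormedAddCommGroup E] [NormedSpace ℝ E] [CompleteSpace E]
  {G : Type*} [TopologicalSpace G] [ChartedSpace E G] [Group G] [LieGroup 𝓘(ℝ, E) ∞ G]
  {F : Type*} [NormedAddCommGroup F] [NormedSpace ℝ F]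
  {P : Type*} [TopologicalSpace P] [ChartedSpace F P]

/-- The two-form `⟨δj ∧ u⁻¹δu⟩` of a function `h = (u, -Ad*(u⁻¹) j)` with values in `G ⋉ 𝔤*`. -/
def beta (h : P → SemiDual E G) (p : P) (X Y : F) : ℝ :=
  dFun (F := F) (fun q => (h q).moment) p X (leftMC (F := F) 𝓘(ℝ, E) (fun q => (h q).base) p Y)
    - dFun (F := F) (fun q => (h q).moment) p Y
      (leftMC (F := F) 𝓘(ℝ, E) (fun q => (h q).base) p X)

/-- The one-form `⟨j, δv v⁻¹⟩` of `h = (u, -Ad*(u⁻¹) j)` and `h'` with base component `v`. -/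
def crossForm (h h' : P → SemiDual E G) : P → F →L[ℝ] ℝ :=
  jdu (fun q => (h q).moment) (fun q => (h' q).base)

theorem HasD.dFun_eq {W : Type*} [NormedAddCommGroup W] [NormedSpace ℝ W] {f : P → W} {p : P}
    {T : F →L[ℝ] W} (hf : HasD 𝓘(ℝ, F) 𝓘(ℝ, W) f p T) : dFun (F := F) f p = T :=
  hf.mfderiv_eq

theorem dFun_coAd {u : P → G} {j : P → E →L[ℝ] ℝ} {p : P}
    (hu : ContMDiff 𝓘(ℝ, F) 𝓘(ℝ, E) ∞ u) (hj : ContMDiff 𝓘(ℝ, F) 𝓘(ℝ, E →L[ℝ] ℝ) ∞ j) (X : F) :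
    dFun (F := F) (fun q => coAd (u q) (j q)) p X
      = coAd (u p) (dFun (F := F) j p X
        + (j p).comp (adL G (rightMC (F := F) 𝓘(ℝ, E) u p X))) := by
  have h1 := (hasD_rightMC ((hu p).mdifferentiableAt (by simp))).Ad (by simp)
  have h2 := h1.clm_comp (hasD_const (I := 𝓘(ℝ, F)) (I' := 𝓘(ℝ, E →L[ℝ] E)) (Ad 𝓘(ℝ, E) (u p)) p)
  have e : (fun q => (Ad 𝓘(ℝ, E) (u q * (u p)⁻¹)).comp (Ad 𝓘(ℝ, E) (u p)))
      = fun q => Ad 𝓘(ℝ, E) (u q) := by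
    funext q
    rw [← Ad_map_mul, inv_mul_cancel_right]
  rw [e] at h2
  have h3 := (hasD_dFun (F := F) ((hj p).mdifferentiableAt (by simp))).clm_comp h2
  refine (DFunLike.congr_fun h3.dFun_eq X).trans ?_
  ext ξ
  simp [coAd_apply, add_comm]

variable {h h' : P → SemiDual E G} {p : P}

theorem dFun_moment_mul (hh : ContMDiff 𝓘(ℝ, F) (sdModel E) ∞ h)
    (hh' : ContMDiff 𝓘(ℝ, F) (sdModel E) ∞ h') (X : F) :
    dFun (F := F) (fun q => ((h * h') q).moment) p X
      = dFun (F := F) (fun q => (h' q).moment) p X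
        + coAd (h' p).base (dFun (F := F) (fun q => (h q).moment) p X
          + (h p).moment.comp (adL G (rightMC (F := F) 𝓘(ℝ, E) (fun q => (h' q).base) p X))) := by
  have h1 := hasD_dFun (F := F) ((contMDiff_moment hh' p).mdifferentiableAt (by simp))
  have h2 := hasD_dFun (F := F) ((contMDiff_coAd (contMDiff_base hh') (contMDiff_moment hh)
    p).mdifferentiableAt (by simp))
  have h3 : HasD 𝓘(ℝ, F) 𝓘(ℝ, E →L[ℝ] ℝ) (fun q => ((h * h') q).moment) p
      (dFun (F := F) (fun q => (h' q).moment) p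
        + dFun (F := F) (fun q => coAd (h' q).base (h q).moment) p) := by
    simp only [Pi.mul_apply, SemiDual.moment_mul]
    exact HasMFDerivAt.add h1 h2
  rw [← dFun_coAd (contMDiff_base hh') (contMDiff_moment hh), h3.dFun_eq]
  rfl

variable [IsManifold 𝓘(ℝ, F) ∞ P]

/-- The Polyakov-Wiegmann identity: `⟨h⁻¹δh ∧ δh' h'⁻¹⟩` is, up to an exact form, the coboundary
of `beta`. -/
theorem polyakovWiegmann (hh : ContMDiff 𝓘(ℝ, F) (sdModel E) ∞ h)
    (hh' : ContMDiff 𝓘(ℝ, F) (sdModel E) ∞ h') (X Y : F) :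
    wedge (leftMC (F := F) (sdModel E) h p) (rightMC (F := F) (sdModel E) h' p) X Y
      = beta (h * h') p X Y - beta h p X Y - beta h' p X Y
        - 2 * extD (crossForm h h') p X Y := by
  have hb := contMDiff_base hh
  have hb' := contMDiff_base hh'
  have hL : leftMC (F := F) 𝓘(ℝ, E) (fun q => ((h * h') q).base) p
      = (Ad 𝓘(ℝ, E) (h' p).base⁻¹).comp (leftMC (F := F) 𝓘(ℝ, E) (fun q => (h q).base) p
        + rightMC (F := F) 𝓘(ℝ, E) (fun q => (h' q).base) p) :=
    leftMC_mul ((hb p).mdifferentiableAt (by simp)) ((hb' p).mdifferentiableAt (by simp))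
  have hL' := leftMC_eq ((hb' p).mdifferentiableAt (by simp))
  unfold wedge beta crossForm
  rw [extD_jdu (contMDiff_moment hh) hb', hL, hL']
  simp only [leftMC_semiDual hh, rightMC_semiDual hh', dFun_moment_mul hh hh', pairing_apply]
  generalize leftMC (F := F) 𝓘(ℝ, E) (fun q => (h q).base) p = l
  generalize rightMC (F := F) 𝓘(ℝ, E) (fun q => (h' q).base) p = r
  simp only [sub_apply, add_apply, neg_apply, ContinuousLinearMap.comp_apply, coAd_apply,
    Ad_Ad_inv, map_add, add_apply]
  rw [adL_swap G (r Y) (r X), adL_swap G (r X) (l Y), adL_swap G (r Y) (l X)]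
  simp only [map_neg]
  ring

theorem wedge_self (α : F →L[ℝ] E × (E →L[ℝ] ℝ)) (X Y : F) : wedge α α X Y = 0 := by
  simp only [wedge, pairing_apply]; ring

theorem wedge_neg_left (α β : F →L[ℝ] E × (E →L[ℝ] ℝ)) (X Y : F) :
    wedge (-α) β X Y = -wedge α β X Y := by
  simp only [wedge, pairing_apply, neg_apply, Prod.fst_neg, Prod.snd_neg, map_neg]; ring

theorem wedge_neg_right (α β : F →L[ℝ] E × (E →L[ℝ] ℝ)) (X Y : F) :
    wedge α (-β) X Y = -wedge α β X Y := by
  simp only [wedge, pairing_apply, neg_apply, map_neg]; ring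

theorem wedge_add_left (α α' β : F →L[ℝ] E × (E →L[ℝ] ℝ)) (X Y : F) :
    wedge (α + α') β X Y = wedge α β X Y + wedge α' β X Y := by
  simp only [wedge, pairing_apply, add_apply, Prod.fst_add, Prod.snd_add, map_add]; ring

theorem wedge_swap (α β : F →L[ℝ] E × (E →L[ℝ] ℝ)) (X Y : F) :
    wedge α β X Y = -wedge β α X Y := by
  simp only [wedge, pairing_apply]; ring

theorem wedge_Ad (a : SemiDual E G) (α β : F →L[ℝ] E × (E →L[ℝ] ℝ)) (X Y : F) :
    wedge ((Ad (sdModel E) a).comp α) ((Ad (sdModel E) a).comp β) X Y = wedge α β X Y := by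
  simp only [wedge, ContinuousLinearMap.comp_apply, pairing_Ad]

theorem beta_const (a : SemiDual E G) (X Y : F) : beta (F := F) (fun _ : P => a) p X Y = 0 := by
  have : leftMC (F := F) 𝓘(ℝ, E) (fun _ : P => a.base) p = 0 := leftMC_const _ _
  simp [beta, this]

/-- `ContMDiff.inv` for the inverse in the group of functions `P → G ⋉ 𝔤*`. -/
theorem contMDiff_pinv (hh : ContMDiff 𝓘(ℝ, F) (sdModel E) ∞ h) :
    ContMDiff 𝓘(ℝ, F) (sdModel E) ∞ h⁻¹ := hh.inv

/-- `ContMDiff.mul` for the product in the group of functions `P → G ⋉ 𝔤*`. -/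
theorem contMDiff_pmul (hh : ContMDiff 𝓘(ℝ, F) (sdModel E) ∞ h)
    (hh' : ContMDiff 𝓘(ℝ, F) (sdModel E) ∞ h') :
    ContMDiff 𝓘(ℝ, F) (sdModel E) ∞ (h * h') := hh.mul hh'

theorem beta_inv (hh : ContMDiff 𝓘(ℝ, F) (sdModel E) ∞ h) (X Y : F) :
    beta h⁻¹ p X Y = -beta h p X Y - 2 * extD (crossForm h h⁻¹) p X Y := by
  have h1 := polyakovWiegmann (p := p) hh (contMDiff_pinv hh) X Y
  rw [rightMC_inv ((hh p).mdifferentiableAt (by simp)), wedge_neg_right, wedge_self,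
    mul_inv_cancel] at h1
  have h2 : beta (F := F) (1 : P → SemiDual E G) p X Y = 0 := beta_const 1 X Y
  rw [h2] at h1
  linarith

/-- The terms `⟨δK_i K_i⁻¹ ∧ δK_{i-1} K_{i-1}⁻¹⟩` for `K_i⁻¹ = h K_{i-1}⁻¹` and `K_{i-1}⁻¹ = h'`. -/
theorem wedge_rightMC_inv_mul (hh : ContMDiff 𝓘(ℝ, F) (sdModel E) ∞ h)
    (hh' : ContMDiff 𝓘(ℝ, F) (sdModel E) ∞ h') (X Y : F) :
    wedge (rightMC (F := F) (sdModel E) (h * h')⁻¹ p) (rightMC (F := F) (sdModel E) h'⁻¹ p) X Y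
      = beta (h * h') p X Y - beta h p X Y - beta h' p X Y
        - 2 * extD (crossForm h h') p X Y := by
  have m := (hh p).mdifferentiableAt (n := ∞) (by simp)
  have m' := (hh' p).mdifferentiableAt (n := ∞) (by simp)
  rw [← polyakovWiegmann hh hh', rightMC_inv (mdifferentiableAt_mul (sdModel E) m m'),
    rightMC_inv m', leftMC_mul m m', leftMC_eq m', wedge_neg_left, wedge_neg_right, neg_neg,
    wedge_Ad, wedge_add_left, wedge_self, add_zero]

theorem smooth_crossForm (hh : ContMDiff 𝓘(ℝ, F) (sdModel E) ∞ h)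
    (hh' : ContMDiff 𝓘(ℝ, F) (sdModel E) ∞ h') : SmoothOneForm (F := F) (crossForm h h') :=
  SmoothOneForm.jdu (contMDiff_moment hh) (contMDiff_base hh')

end PolyakovWiegmann

/-! ### One-parameter subgroups -/

section OneParam

variable {E : Type*} [NormedAddCommGroup E] [NormedSpace ℝ E] [CompleteSpace E]
  {G : Type*} [TopologicalSpace G] [ChartedSpace E G] [Group G] [LieGroup 𝓘(ℝ, E) ∞ G]

/-- `φ` is a one-parameter subgroup with initial velocity `ξ`. -/
def IsOneParam (φ : ℝ → G) (ξ : E) : Prop :=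
  (∀ r t : ℝ, φ (r + t) = φ r * φ t) ∧
    HasD 𝓘(ℝ, ℝ) 𝓘(ℝ, E) φ 0 ((ContinuousLinearMap.id ℝ ℝ).smulRight ξ)

theorem IsExp.exists_isOneParam {ξ : E} {c : G} (h : IsExp 𝓘(ℝ, E) ξ c) :
    ∃ φ : ℝ → G, IsOneParam φ ξ ∧ φ 1 = c := by
  obtain ⟨φ, h1, h2, h3⟩ := h
  exact ⟨φ, ⟨h1, h2⟩, h3⟩

namespace IsOneParam

variable {φ ψ : ℝ → G} {ξ ζ : E}

theorem map_zero (h : IsOneParam φ ξ) : φ 0 = 1 := by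
  have := h.1 0 0
  rw [add_zero] at this
  exact left_eq_mul.1 this

theorem map_neg (h : IsOneParam φ ξ) (t : ℝ) : φ (-t) = (φ t)⁻¹ := by
  refine eq_inv_of_mul_eq_one_left ?_
  rw [← h.1, neg_add_cancel, h.map_zero]

theorem hasD_sub (h : IsOneParam φ ξ) (t : ℝ) :
    HasD 𝓘(ℝ, ℝ) 𝓘(ℝ, E) (fun r => φ (r - t)) t ((ContinuousLinearMap.id ℝ ℝ).smulRight ξ) := by
  have h1 : HasFDerivAt (fun r : ℝ => r - t) (ContinuousLinearMap.id ℝ ℝ) t :=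
    (hasFDerivAt_id t).sub_const t
  have := h.2.comp (hasD_iff_hasFDerivAt.2 h1) (sub_self t)
  rwa [ContinuousLinearMap.comp_id] at this

theorem hasFDerivAt_Ad (h : IsOneParam φ ξ) (t : ℝ) :
    HasFDerivAt (fun r => Ad 𝓘(ℝ, E) (φ (r - t)))
      ((adL G).comp ((ContinuousLinearMap.id ℝ ℝ).smulRight ξ)) t :=
  hasD_iff_hasFDerivAt.1 ((h.hasD_sub t).Ad (by rw [sub_self, h.map_zero]))

/-- A linear form that vanishes on the image of `ad ξ` is invariant under `exp ξ`. -/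
theorem apply_Ad_eq (h : IsOneParam φ ξ) (s : E →L[ℝ] ℝ) (hs : ∀ ζ, s (adL G ξ ζ) = 0) (t : ℝ)
    (ζ : E) : s (Ad 𝓘(ℝ, E) (φ t) ζ) = s ζ := by
  have hd : ∀ t, HasFDerivAt (fun r => s (Ad 𝓘(ℝ, E) (φ r) ζ)) (0 : ℝ →L[ℝ] ℝ) t := by
    intro t
    have h1 := (h.hasFDerivAt_Ad t).clm_apply (hasFDerivAt_const (Ad 𝓘(ℝ, E) (φ t) ζ) t)
    have h2 := s.hasFDerivAt.comp t h1
    have e : (s ∘ fun r => Ad 𝓘(ℝ, E) (φ (r - t)) (Ad 𝓘(ℝ, E) (φ t) ζ))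
        = fun r => s (Ad 𝓘(ℝ, E) (φ r) ζ) := by
      funext r
      change s (((Ad 𝓘(ℝ, E) (φ (r - t))).comp (Ad 𝓘(ℝ, E) (φ t))) ζ) = _
      rw [← Ad_map_mul, ← h.1, sub_add_cancel]
    rw [e] at h2
    refine h2.congr_fderiv ?_
    ext
    simp [hs]
  have := is_const_of_fderiv_eq_zero (𝕜 := ℝ) (fun t => (hd t).differentiableAt)
    (fun t => (hd t).fderiv) t 0
  simpa [h.map_zero, Ad_map_one] using this

/-- An element that commutes with `ξ` is fixed by `Ad (exp ξ)`. -/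
theorem Ad_eq (h : IsOneParam φ ξ) (hζ : adL G ξ ζ = 0) (t : ℝ) : Ad 𝓘(ℝ, E) (φ t) ζ = ζ := by
  have hd : ∀ t, HasFDerivAt (fun r => Ad 𝓘(ℝ, E) (φ r) ζ) (0 : ℝ →L[ℝ] E) t := by
    intro t
    have h1 := (h.hasFDerivAt_Ad t).clm_apply (hasFDerivAt_const ζ t)
    have h2 := (Ad 𝓘(ℝ, E) (φ t)).hasFDerivAt.comp t h1
    have e : ((Ad 𝓘(ℝ, E) (φ t)) ∘ fun r => Ad 𝓘(ℝ, E) (φ (r - t)) ζ)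
        = fun r => Ad 𝓘(ℝ, E) (φ r) ζ := by
      funext r
      change ((Ad 𝓘(ℝ, E) (φ t)).comp (Ad 𝓘(ℝ, E) (φ (r - t)))) ζ = _
      rw [← Ad_map_mul, ← h.1, add_sub_cancel]
    rw [e] at h2
    refine h2.congr_fderiv ?_
    ext
    simp [hζ]
  have := is_const_of_fderiv_eq_zero (𝕜 := ℝ) (fun t => (hd t).differentiableAt)
    (fun t => (hd t).fderiv) t 0
  simpa [h.map_zero, Ad_map_one] using this

/-- A one-parameter subgroup is an integral curve of a left-invariant vector field. -/
theorem isMIntegralCurve (h : IsOneParam φ ξ) :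
    IsMIntegralCurve (I := 𝓘(ℝ, E)) φ (mulInvariantVectorField (I := 𝓘(ℝ, E)) (G := G) ξ) := by
  intro t
  have h1 : ContMDiff 𝓘(ℝ, E) 𝓘(ℝ, E) ∞ (fun y : G => φ t * y) := contMDiff_const.mul contMDiff_id
  obtain ⟨B, hB⟩ : ∃ B : E →L[ℝ] E, HasD 𝓘(ℝ, E) 𝓘(ℝ, E) (fun y : G => φ t * y) 1 B :=
    ⟨_, hasD_mfderiv ((h1 1).mdifferentiableAt (by simp))⟩
  have h2 := hB.comp (h.hasD_sub t) (by rw [sub_self, h.map_zero])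
  have e : (fun r => φ t * φ (r - t)) = φ := by
    funext r; rw [← h.1, add_sub_cancel]
  rw [e] at h2
  have h3 : (mulInvariantVectorField (I := 𝓘(ℝ, E)) (G := G) ξ (φ t) : E) = B ξ :=
    DFunLike.congr_fun hB.mfderiv_eq ξ
  have h4 : B.comp ((ContinuousLinearMap.id ℝ ℝ).smulRight ξ) = (1 : ℝ →L[ℝ] ℝ).smulRight
      (mulInvariantVectorField (I := 𝓘(ℝ, E)) (G := G) ξ (φ t) : E) := by
    refine Eq.trans ?_ (congrArg (fun v : E => (1 : ℝ →L[ℝ] ℝ).smulRight v) h3.symm)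
    ext; simp
  rw [h4] at h2
  exact h2

/-- One-parameter subgroups with the same initial velocity agree, by the uniqueness of integral
curves. -/
theorem unique (h : IsOneParam φ ξ) (h' : IsOneParam ψ ξ) : φ = ψ := by
  have : IsManifold 𝓘(ℝ, E) 1 G := isManifold_one G
  have : IsTopologicalGroup G := topologicalGroup_of_lieGroup 𝓘(ℝ, E) ∞
  -- with `T1Space`, the topological group `G` is Hausdorff, as uniqueness requires
  have : T1Space G := ModelWithCorners.t1Space 𝓘(ℝ, E) G
  have : LieGroup 𝓘(ℝ, E) (minSmoothness ℝ 3) G := LieGroup.of_le (n := ∞) (by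
    rw [minSmoothness_of_isRCLikeNormedField]
    exact WithTop.coe_le_coe.2 (le_top (a := (3 : ℕ∞))))
  refine isMIntegralCurve_Ioo_eq_of_contMDiff_boundaryless (I := 𝓘(ℝ, E)) (t₀ := 0) ?_
    h.isMIntegralCurve h'.isMIntegralCurve (by rw [h.map_zero, h'.map_zero])
  exact (contMDiff_mulInvariantVectorField (I := 𝓘(ℝ, E)) (G := G) ξ).of_le (by
    rw [minSmoothness_of_isRCLikeNormedField]; norm_num)

/-- For `[ξ, ζ] = 0`, conjugation by `exp (rξ)` fixes the velocity `ζ`, hence the subgroup it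
generates. -/
theorem commute (h : IsOneParam φ ξ) (h' : IsOneParam ψ ζ) (hξζ : adL G ξ ζ = 0) (r t : ℝ) :
    Commute (φ r) (ψ t) := by
  have h1 : IsOneParam (fun t => φ r * ψ t * (φ r)⁻¹) ζ := by
    refine ⟨fun a b => by simp only [h'.1]; group, ?_⟩
    have := h'.2.conj h'.map_zero (φ r)
    have e : (Ad 𝓘(ℝ, E) (φ r)).comp ((ContinuousLinearMap.id ℝ ℝ).smulRight ζ)
        = (ContinuousLinearMap.id ℝ ℝ).smulRight ζ := by
      ext; simp [h.Ad_eq hξζ]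
    rwa [e] at this
  have h2 := congrFun (h1.unique h') t
  exact mul_inv_eq_iff_eq_mul.1 h2

end IsOneParam

/-- Commuting one-parameter subgroups combine to a homomorphism from a vector space.  The last
clause lets the induction on the number of subgroups go through. -/
theorem exists_hom_of_commuting (m : ℕ) (b : Fin m → E) (φ : Fin m → ℝ → G)
    (hb : ∀ i k, adL G (b i) (b k) = 0) (hφ : ∀ i, IsOneParam (φ i) (b i)) :
    ∃ ψ : (Fin m → ℝ) → G, (∀ x y, ψ (x + y) = ψ x * ψ y) ∧
      HasD 𝓘(ℝ, Fin m → ℝ) 𝓘(ℝ, E) ψ 0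
        (∑ i, (ContinuousLinearMap.proj (R := ℝ) (φ := fun _ : Fin m => ℝ) i).smulRight (b i)) ∧
      ∀ a : G, (∀ i r, Commute a (φ i r)) → ∀ x, Commute a (ψ x) := by
  induction m with
  | zero =>
    refine ⟨fun _ => 1, by simp, ?_, by simp⟩
    simpa using hasD_const (I := 𝓘(ℝ, Fin 0 → ℝ)) (I' := 𝓘(ℝ, E)) (1 : G) (0 : Fin 0 → ℝ)
  | succ m ih =>
    obtain ⟨ψ, h1, h2, h3⟩ := ih (fun i => b i.succ) (fun i => φ i.succ)
      (fun i k => hb _ _) (fun i => hφ _)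
    have hψ0 : ψ 0 = 1 := by
      have := h1 0 0
      rw [add_zero] at this
      exact left_eq_mul.1 this
    let τ : (Fin (m + 1) → ℝ) →L[ℝ] (Fin m → ℝ) :=
      ContinuousLinearMap.pi fun i => ContinuousLinearMap.proj i.succ
    let π₀ : (Fin (m + 1) → ℝ) →L[ℝ] ℝ := ContinuousLinearMap.proj 0
    have hcomm : ∀ r x, Commute (φ 0 r) (ψ x) := fun r x =>
      h3 _ (fun i t => (hφ 0).commute (hφ i.succ) (hb _ _) r t) x
    refine ⟨fun x => φ 0 (π₀ x) * ψ (τ x), ?_, ?_, ?_⟩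
    · intro x y
      simp only [map_add, h1, (hφ 0).1]
      rw [mul_assoc, mul_assoc, ← mul_assoc (φ 0 (π₀ y)), (hcomm _ _).eq, mul_assoc]
    · have d1 := (hφ 0).2.comp (hasD_iff_hasFDerivAt.2 (π₀.hasFDerivAt (x := 0))) (map_zero _)
      have d2 := h2.comp (hasD_iff_hasFDerivAt.2 (τ.hasFDerivAt (x := 0))) (map_zero _)
      have d3 := d1.mul d2 (by rw [map_zero, (hφ 0).map_zero]) (by rw [map_zero, hψ0])
      have e : ((ContinuousLinearMap.id ℝ ℝ).smulRight (b 0)).comp π₀ +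
          (∑ i : Fin m, (ContinuousLinearMap.proj (R := ℝ) (φ := fun _ : Fin m => ℝ) i).smulRight
            (b i.succ)).comp τ = ∑ i, (ContinuousLinearMap.proj (R := ℝ)
              (φ := fun _ : Fin (m + 1) => ℝ) i).smulRight (b i) := by
        rw [Fin.sum_univ_succ, ContinuousLinearMap.finsetSum_comp]
        rfl
      rwa [e] at d3
    · intro a ha x
      exact (ha 0 _).mul_right (h3 a (fun i r => ha _ _) _)

variable {F : Type*} [NormedAddCommGroup F] [NormedSpace ℝ F]
  {P : Type*} [TopologicalSpace P] [ChartedSpace F P]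

/-- If the values of `ν` commute with each other, then `δ(exp ν) (exp ν)⁻¹ = δν`: on the span of
these values `exp` is a homomorphism `ψ`, so `c(q) c(p)⁻¹ = ψ(ν(q) - ν(p))`, and the differential of
`ψ` at `0` is the inclusion. -/
theorem rightMC_exp [FiniteDimensional ℝ E] {ν : P → E} {c : P → G} {p : P}
    (hν : MDifferentiableAt 𝓘(ℝ, F) 𝓘(ℝ, E) ν p) (hcomm : ∀ q q', adL G (ν q) (ν q') = 0)
    (hc : ∀ q, IsExp 𝓘(ℝ, E) (ν q) (c q)) :
    rightMC (F := F) 𝓘(ℝ, E) c p = dFun (F := F) ν p := by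
  choose χ hχ hχc using fun q => (hc q).exists_isOneParam
  obtain ⟨B, hBs, hBspan, hBli⟩ := exists_linearIndependent ℝ (Set.range ν)
  have hBfin : B.Finite := hBli.setFinite
  obtain ⟨m, b, -, hb⟩ := hBfin.fin_param
  have hbν : ∀ i, ∃ q, ν q = b i := fun i => hBs (hb ▸ Set.mem_range_self i)
  choose q hq using hbν
  obtain ⟨ψ, hψ, hψd, -⟩ := exists_hom_of_commuting m b (fun i => χ (q i))
    (fun i k => by rw [← hq i, ← hq k]; exact hcomm _ _) (fun i => hq i ▸ hχ (q i))
  set β : (Fin m → ℝ) →L[ℝ] E :=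
    ∑ i, (ContinuousLinearMap.proj (R := ℝ) (φ := fun _ : Fin m => ℝ) i).smulRight (b i) with hβ
  -- a linear section of `β` over the span of the values of `ν`
  obtain ⟨σ, hσ⟩ : ∃ σ : E →L[ℝ] (Fin m → ℝ), ∀ r, β (σ (ν r)) = ν r := by
    obtain ⟨f, hf⟩ := β.toLinearMap.rangeRestrict.exists_rightInverse_of_surjective
      (LinearMap.range_rangeRestrict _)
    obtain ⟨f', hf'⟩ := f.exists_extend
    refine ⟨f'.toContinuousLinearMap, fun r => ?_⟩
    have hr : ν r ∈ LinearMap.range β.toLinearMap := by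
      have h1 : ν r ∈ Submodule.span ℝ (Set.range b) := by
        rw [hb, hBspan]
        exact Submodule.subset_span ⟨r, rfl⟩
      refine (Submodule.span_le.2 ?_) h1
      rintro _ ⟨i, rfl⟩
      refine ⟨Pi.single i 1, ?_⟩
      simp [hβ, Pi.single_apply]
    have h2 := DFunLike.congr_fun hf ⟨ν r, hr⟩
    have h3 := DFunLike.congr_fun hf' ⟨ν r, hr⟩
    have h4 := congrArg Subtype.val h2
    simp only [LinearMap.comp_apply, Submodule.subtype_apply] at h3
    change β (f' (ν r)) = ν r
    rw [h3]
    exact h4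
  have hψ0 : ψ 0 = 1 := by
    have := hψ 0 0
    rw [add_zero] at this
    exact left_eq_mul.1 this
  have hcψ : ∀ r, c r = ψ (σ (ν r)) := by
    intro r
    have h1 : IsOneParam (fun t : ℝ => ψ (t • σ (ν r))) (ν r) := by
      refine ⟨fun a t => by simp only [add_smul, hψ], ?_⟩
      have hl : HasFDerivAt (fun t : ℝ => t • σ (ν r))
          ((ContinuousLinearMap.id ℝ ℝ).smulRight (σ (ν r))) 0 :=
        ((ContinuousLinearMap.id ℝ ℝ).smulRight (σ (ν r))).hasFDerivAt
      have := hψd.comp (hasD_iff_hasFDerivAt.2 hl) (zero_smul _ _)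
      have e : β.comp ((ContinuousLinearMap.id ℝ ℝ).smulRight (σ (ν r)))
          = (ContinuousLinearMap.id ℝ ℝ).smulRight (ν r) := by
        ext; simp [hσ]
      rwa [e] at this
    have h2 := congrFun ((hχ r).unique h1) 1
    simpa [hχc] using h2
  have hd := hasD_dFun (F := F) hν
  have h1 : HasD 𝓘(ℝ, F) 𝓘(ℝ, Fin m → ℝ) (fun r => σ (ν r) - σ (ν p)) p
      (σ.comp (dFun (F := F) ν p)) :=
    (hasD_iff_hasFDerivAt.2 (σ.hasFDerivAt.sub_const _)).comp hd rfl
  have h2 := hψd.comp h1 (sub_self _)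
  have h3 : HasD 𝓘(ℝ, F) 𝓘(ℝ, E) (fun r => β (σ (ν r))) p
      ((β.comp σ).comp (dFun (F := F) ν p)) :=
    (hasD_iff_hasFDerivAt.2 (β.comp σ).hasFDerivAt).comp hd rfl
  simp only [hσ] at h3
  have h4 := h3.unique hd
  have e : (fun r => ψ (σ (ν r) - σ (ν p))) = fun r => c r * (c p)⁻¹ := by
    funext r
    rw [hcψ, hcψ, eq_mul_inv_iff_mul_eq, ← hψ, sub_add_cancel]
  rw [e, ← ContinuousLinearMap.comp_assoc, h4] at h2
  exact h2.rightMC_eq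

end OneParam

/-! ### Contributions of punctures and handles -/

section Contributions

variable {E : Type*} [NormedAddCommGroup E] [NormedSpace ℝ E] [CompleteSpace E]
  {G : Type*} [TopologicalSpace G] [ChartedSpace E G] [Group G] [LieGroup 𝓘(ℝ, E) ∞ G]
  {F : Type*} [NormedAddCommGroup F] [NormedSpace ℝ F]
  {P : Type*} [TopologicalSpace P] [ChartedSpace F P]

/-- The one-form `δu u⁻¹` of the base component `u` of `h`. -/
def baseMC (h : P → SemiDual E G) (p : P) : F →L[ℝ] E :=
  rightMC (F := F) 𝓘(ℝ, E) (fun q => (h q).base) p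

theorem baseMC_mul {h h' : P → SemiDual E G} (hh : ContMDiff 𝓘(ℝ, F) (sdModel E) ∞ h)
    (hh' : ContMDiff 𝓘(ℝ, F) (sdModel E) ∞ h') (p : P) (X : F) :
    baseMC (h * h') p X = baseMC h p X + Ad 𝓘(ℝ, E) (h p).base (baseMC h' p X) :=
  DFunLike.congr_fun (rightMC_mul ((contMDiff_base hh p).mdifferentiableAt (by simp))
    ((contMDiff_base hh' p).mdifferentiableAt (by simp))) X

theorem baseMC_inv {h : P → SemiDual E G} (hh : ContMDiff 𝓘(ℝ, F) (sdModel E) ∞ h) (p : P)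
    (X : F) : baseMC h⁻¹ p X = -Ad 𝓘(ℝ, E) (h p).base⁻¹ (baseMC h p X) := by
  have m := (contMDiff_base hh p).mdifferentiableAt (n := ∞) (by simp)
  have h1 := DFunLike.congr_fun (rightMC_inv m) X
  rw [leftMC_eq m] at h1
  exact h1

theorem crossForm_apply (h h' : P → SemiDual E G) (p : P) (X : F) :
    crossForm h h' p X = (h p).moment (baseMC h' p X) := rfl

variable [IsManifold 𝓘(ℝ, F) ∞ P]

/-- The contribution of a puncture with holonomy `g C⁻¹ g⁻¹`, where `C` is constant. -/
theorem puncture {g : P → SemiDual E G} (hg : ContMDiff 𝓘(ℝ, F) (sdModel E) ∞ g)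
    (C : SemiDual E G) (p : P) (X Y : F) :
    wedge ((Ad (sdModel E) C).comp (leftMC (F := F) (sdModel E) g p))
        (leftMC (F := F) (sdModel E) g p) X Y
      = -beta (g * (fun _ => C⁻¹) * g⁻¹) p X Y
        - 2 * extD (crossForm (g * (fun _ => C⁻¹) * g⁻¹) g) p X Y := by
  -- the Polyakov-Wiegmann identity for `(g c) g⁻¹` and for `g c`, with `c = C⁻¹` constant
  set c : P → SemiDual E G := fun _ => C⁻¹ with hc
  have hcs : ContMDiff 𝓘(ℝ, F) (sdModel E) ∞ c := contMDiff_const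
  have hgc := contMDiff_pmul hg hcs
  have hgi := contMDiff_pinv hg
  have mg := (hg p).mdifferentiableAt (n := ∞) (by simp)
  have mc := (hcs p).mdifferentiableAt (n := ∞) (by simp)
  have hR : rightMC (F := F) (sdModel E) c p = 0 := rightMC_const _ _
  have h1 := polyakovWiegmann (p := p) hgc hgi X Y
  have h2 := polyakovWiegmann (p := p) hg hcs X Y
  have h3 := beta_inv (p := p) hg X Y
  have h4 : beta (F := F) c p X Y = 0 := beta_const _ _ _
  have h5 : crossForm (F := F) g c = 0 := by
    funext q
    ext Z
    have : baseMC (F := F) c q = 0 := rightMC_const _ _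
    rw [crossForm_apply, this]
    simp
  have h6 : wedge (leftMC (F := F) (sdModel E) g p) 0 X Y = 0 := by simp [wedge]
  have h7 : extD (0 : P → F →L[ℝ] ℝ) p X Y = 0 := by
    have := extD_smul (SmoothOneForm.zero (P := P) (F := F)) 0 p X Y
    simpa using this
  rw [hR, h4, h5, h6, h7] at h2
  have e : c p = C⁻¹ := rfl
  rw [leftMC_mul mg mc, hR, add_zero, rightMC_inv mg, wedge_neg_right, e, inv_inv] at h1
  have h8 : crossForm (F := F) (g * c * g⁻¹) g = crossForm g g⁻¹ - crossForm (g * c) g⁻¹ := by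
    funext q
    ext Z
    simp only [Pi.sub_apply, sub_apply, crossForm_apply, baseMC_inv hg, Pi.mul_apply, Pi.inv_apply,
      SemiDual.moment_mul, SemiDual.moment_inv, SemiDual.base_inv, add_apply, neg_apply,
      coAd_apply, map_neg]
    ring
  rw [h8, extD_sub (smooth_crossForm hg hgi) (smooth_crossForm hgc hgi)]
  linarith

/-- The contribution of a handle with holonomies `A` and `B`.  Here `N` stands for the product
`[B_{i-1}, A_{i-1}⁻¹] ⋯ [B_1, A_1⁻¹] M_n ⋯ M_1` of the preceding holonomies. -/
theorem handle {A B N : P → SemiDual E G} (hA : ContMDiff 𝓘(ℝ, F) (sdModel E) ∞ A)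
    (hB : ContMDiff 𝓘(ℝ, F) (sdModel E) ∞ B) (hN : ContMDiff 𝓘(ℝ, F) (sdModel E) ∞ N)
    (p : P) (X Y : F) :
    wedge (rightMC (F := F) (sdModel E) (A * N)⁻¹ p) (rightMC (F := F) (sdModel E) N⁻¹ p) X Y
      + wedge (rightMC (F := F) (sdModel E) (B * A⁻¹ * B⁻¹ * A * N)⁻¹ p)
        (rightMC (F := F) (sdModel E) (A * N)⁻¹ p) X Y
      + (wedge (leftMC (F := F) (sdModel E) A p) (leftMC (F := F) (sdModel E) B p) X Y
        + wedge (rightMC (F := F) (sdModel E) (B * A * B⁻¹) p)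
            (rightMC (F := F) (sdModel E) B p) X Y)
      = beta (B * A⁻¹ * B⁻¹ * A * N) p X Y - beta N p X Y
        - 2 * (extD (crossForm A N - crossForm A (A⁻¹ * B⁻¹ * A * N)) p X Y
          + extD (crossForm B (A⁻¹ * B⁻¹ * A * N) - crossForm B (B⁻¹ * A * N)) p X Y) := by
  have hAi := contMDiff_pinv hA
  have hBi := contMDiff_pinv hB
  have hAN := contMDiff_pmul hA hN
  have hBA := contMDiff_pmul hB hAi
  have hQ := contMDiff_pmul hBA hBi
  have hAB := contMDiff_pmul hA hBi
  have hABi := contMDiff_pinv hAB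
  have hA2 := contMDiff_pmul hAi hBi
  have hA3 := contMDiff_pmul hA2 hA
  have hA4 := contMDiff_pmul hA3 hN
  have hB3 := contMDiff_pmul hBi hA
  have hB4 := contMDiff_pmul hB3 hN
  have mB := (hB p).mdifferentiableAt (n := ∞) (by simp)
  have mQ := (hQ p).mdifferentiableAt (n := ∞) (by simp)
  have e1 : B * A⁻¹ * B⁻¹ * A * N = (B * A⁻¹ * B⁻¹) * (A * N) := by group
  have e2 : B * A * B⁻¹ = (B * A⁻¹ * B⁻¹)⁻¹ := by group
  have e3 : B * A⁻¹ * B⁻¹ * B = (A * B⁻¹)⁻¹ := by group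
  have h1 := wedge_rightMC_inv_mul (p := p) hA hN X Y
  have h2 := wedge_rightMC_inv_mul (p := p) hQ hAN X Y
  have h3 := polyakovWiegmann (p := p) hA hBi X Y
  have h4 := polyakovWiegmann (p := p) hQ hB X Y
  have h5 := beta_inv (p := p) hAB X Y
  have h6 := beta_inv (p := p) hB X Y
  rw [rightMC_inv mB, wedge_neg_right] at h3
  rw [e3] at h4
  rw [e1, e2, rightMC_inv mQ, wedge_neg_left]
  have s1 := smooth_crossForm (F := F) hA hN
  have s2 := smooth_crossForm (F := F) hQ hAN
  have s3 := smooth_crossForm (F := F) hA hBi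
  have s4 := smooth_crossForm (F := F) hQ hB
  have s5 := smooth_crossForm (F := F) hB hBi
  have s6 := smooth_crossForm (F := F) hAB hABi
  -- the cross terms of the Polyakov-Wiegmann identities above; the `β` of `A`, `B`, `A B⁻¹` and
  -- `B A⁻¹ B⁻¹` cancel
  have key : (crossForm (F := F) A N - crossForm A (A⁻¹ * B⁻¹ * A * N))
      + (crossForm B (A⁻¹ * B⁻¹ * A * N) - crossForm B (B⁻¹ * A * N))
      = crossForm A N + crossForm (B * A⁻¹ * B⁻¹) (A * N) - crossForm A B⁻¹
        - crossForm (B * A⁻¹ * B⁻¹) B + crossForm B B⁻¹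
        - crossForm (A * B⁻¹) (A * B⁻¹)⁻¹ := by
    funext q
    ext Z
    simp only [Pi.sub_apply, Pi.add_apply, sub_apply, crossForm_apply, baseMC_inv hA,
      baseMC_inv hB, baseMC_mul hB hAi, baseMC_mul hA3 hN, baseMC_mul hA2 hA,
      baseMC_mul hAi hBi, baseMC_mul hB3 hN, baseMC_mul hBi hA, baseMC_mul hA hN,
      Pi.mul_apply, Pi.inv_apply,
      SemiDual.moment_mul, SemiDual.moment_inv, SemiDual.base_inv, SemiDual.base_mul, add_apply,
      neg_apply, coAd_apply, map_neg, map_add, mul_inv_rev, Ad_map_mul,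
      ContinuousLinearMap.comp_apply, Ad_inv_Ad, inv_inv]
    ring
  have k1 := extD_add ((smooth_crossForm (F := F) hA hN).sub (smooth_crossForm hA hA4))
    ((smooth_crossForm (F := F) hB hA4).sub (smooth_crossForm hB hB4)) p X Y
  rw [key, extD_sub ((((s1.add s2).sub s3).sub s4).add s5) s6,
    extD_add (((s1.add s2).sub s3).sub s4) s5, extD_sub ((s1.add s2).sub s3) s4,
    extD_sub (s1.add s2) s3, extD_add s1 s2] at k1
  linarith

/-- The contribution of the distinguished puncture, with holonomy `g d⁻¹ g⁻¹`, where
`d = (exp μ, s)` depends on the point.  The hypotheses on `d` express `δ(exp μ) (exp μ)⁻¹ = δμ` and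
that `s`, `δs` and `δμ` commute with `μ` and `s` with `δμ`. -/
theorem distinguishedPuncture {g d : P → SemiDual E G} {μ : P → E} {s : P → E →L[ℝ] ℝ}
    (hg : ContMDiff 𝓘(ℝ, F) (sdModel E) ∞ g) (hd : ContMDiff 𝓘(ℝ, F) (sdModel E) ∞ d)
    (hs : ContMDiff 𝓘(ℝ, F) 𝓘(ℝ, E →L[ℝ] ℝ) ∞ s)
    (hdμ : ∀ p, baseMC (F := F) d p = dFun (F := F) μ p)
    (hfix : ∀ p X, Ad 𝓘(ℝ, E) (d p).base⁻¹ (dFun (F := F) μ p X) = dFun (F := F) μ p X)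
    (hmom : ∀ p, (d p).moment = -s p)
    (hsfix : ∀ p, coAd (d p).base⁻¹ (s p) = s p)
    (hdsfix : ∀ p X, coAd (d p).base⁻¹ (dFun (F := F) s p X) = dFun (F := F) s p X)
    (hsad : ∀ p X ζ, s p (adL G (dFun (F := F) μ p X) ζ) = 0) :
    SmoothOneForm (F := F)
      (fun p => (coAd (g p).base (g p).2 - (1 / 2 : ℝ) • s p).comp (dFun μ p)) ∧
    ∀ (p : P) (X Y : F),
    wedge (leftMC (F := F) (sdModel E) (g * d⁻¹ * g⁻¹)⁻¹ p) (rightMC (F := F) (sdModel E) g p) X Y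
      + wedge ((dFun (F := F) μ p).prod (dFun (F := F) s p))
          (leftMC (F := F) (sdModel E) g p) X Y
      = beta (g * d⁻¹ * g⁻¹) p X Y
        + 2 * (extD (crossForm (g * d⁻¹ * g⁻¹) g) p X Y
          - extD (fun p => (coAd (g p).base (g p).2 - (1 / 2 : ℝ) • s p).comp (dFun μ p))
            p X Y) := by
  set M := g * d⁻¹ * g⁻¹ with hMdef
  have hM : ContMDiff 𝓘(ℝ, F) (sdModel E) ∞ M :=
    contMDiff_pmul (contMDiff_pmul hg (contMDiff_pinv hd)) (contMDiff_pinv hg)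
  have hMi := contMDiff_pinv hM
  have hgd := contMDiff_pmul hg hd
  have hb := contMDiff_base hd
  have sj := SmoothOneForm.jdu (F := F) hs hb
  have s1 := smooth_crossForm (F := F) hg hd
  have s2 := smooth_crossForm (F := F) hM hMi
  have s3 := smooth_crossForm (F := F) hMi hg
  have s4 := smooth_crossForm (F := F) hM hg
  have e1 : M⁻¹ * g = g * d := by rw [hMdef]; group
  -- the Polyakov-Wiegmann identity is applied to `M⁻¹ g = g d`, `M M⁻¹ = 1` and `g d`; `s/2` comes
  -- from `β(d) = -δ⟨s, δμ⟩`
  have key : (fun p => (coAd (g p).base (g p).2 - (1 / 2 : ℝ) • s p).comp (dFun (F := F) μ p))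
      = crossForm M g + (1 / 2 : ℝ) • jdu s (fun q => (d q).base) - crossForm g d
        - crossForm M M⁻¹ + crossForm M⁻¹ g := by
    funext q
    ext Z
    have hjs : jdu (F := F) s (fun q => (d q).base) q Z = s q (baseMC (F := F) d q Z) := rfl
    have hg2 : coAd (g q).base (g q).2 = -(g q).moment := (neg_neg _).symm
    have hs2 : ∀ ζ, s q (Ad 𝓘(ℝ, E) (d q).base⁻¹ ζ) = s q ζ :=
      fun ζ => DFunLike.congr_fun (hsfix q) ζ
    have hB : baseMC (F := F) M⁻¹ q Z = baseMC (F := F) g q Z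
        + Ad 𝓘(ℝ, E) (g q).base (dFun (F := F) μ q Z)
        - Ad 𝓘(ℝ, E) (M q).base⁻¹ (baseMC (F := F) g q Z) := by
      have := baseMC_mul (F := F) hMi hg q Z
      rw [e1, baseMC_mul hg hd, hdμ] at this
      rw [this]
      simp
    simp only [Pi.sub_apply, Pi.add_apply, Pi.smul_apply, sub_apply, add_apply, smul_apply,
      crossForm_apply, hjs, hB, hdμ, hg2, ContinuousLinearMap.comp_apply]
    rw [Pi.inv_apply, SemiDual.moment_inv]
    have hm : (M q).moment (Ad 𝓘(ℝ, E) (g q).base (dFun (F := F) μ q Z))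
        = s q (dFun (F := F) μ q Z) := by
      simp only [hMdef, Pi.mul_apply, Pi.inv_apply, SemiDual.moment_mul, SemiDual.moment_inv,
        SemiDual.base_inv, add_apply, neg_apply, coAd_apply, Ad_inv_Ad, hfix, hmom, neg_neg]
      ring
    simp only [map_add, map_sub, hm, neg_apply, coAd_apply, smul_eq_mul]
    ring
  rw [key]
  refine ⟨(((s4.add (sj.smul _)).sub s1).sub s2).add s3, fun p X Y => ?_⟩
  rw [extD_add (((s4.add (sj.smul _)).sub s1).sub s2) s3,
    extD_sub ((s4.add (sj.smul _)).sub s1) s2, extD_sub (s4.add (sj.smul _)) s1,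
    extD_add s4 (sj.smul _), extD_smul sj]
  have h1 := polyakovWiegmann (p := p) hMi hg X Y
  have h2 := beta_inv (p := p) hM X Y
  have h3 := polyakovWiegmann (p := p) hg hd X Y
  rw [e1] at h1
  have hds : ∀ X, dFun (F := F) (fun q => (d q).moment) p X = -dFun (F := F) s p X := by
    intro X
    have := (hasD_dFun (F := F) ((hs p).mdifferentiableAt (by simp)))
    have h4 : HasD 𝓘(ℝ, F) 𝓘(ℝ, E →L[ℝ] ℝ) (fun q => (d q).moment) p (-dFun (F := F) s p) := by
      simp only [hmom]
      exact HasMFDerivAt.neg this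
    rw [h4.dFun_eq]; rfl
  have hRd : rightMC (F := F) (sdModel E) d p = (dFun (F := F) μ p).prod (dFun (F := F) s p) := by
    ext1 X
    rw [rightMC_semiDual hd, hds, coAd_neg, neg_neg, hdsfix]
    exact Prod.ext (DFunLike.congr_fun (hdμ p) X) rfl
  rw [hRd, wedge_swap] at h3
  have hLd : ∀ X, leftMC (F := F) 𝓘(ℝ, E) (fun q => (d q).base) p X = dFun (F := F) μ p X := by
    intro X
    have hdμ' : rightMC (F := F) 𝓘(ℝ, E) (fun q => (d q).base) p = dFun (F := F) μ p := hdμ p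
    rw [leftMC_eq ((hb p).mdifferentiableAt (by simp)), hdμ']
    exact hfix p X
  have hβ : beta d p X Y = -extD (jdu s (fun q => (d q).base)) p X Y := by
    have hdμ' : rightMC (F := F) 𝓘(ℝ, E) (fun q => (d q).base) p = dFun (F := F) μ p := hdμ p
    rw [extD_jdu hs hb, hdμ', hsad, beta, hds, hds, hLd, hLd]
    simp only [neg_apply]
    ring
  linarith

theorem smooth_cotangentPotential {μ : P → E} {s : P → E →L[ℝ] ℝ} {w : P → SemiDual E G}
    (hμ : ContMDiff 𝓘(ℝ, F) 𝓘(ℝ, E) ∞ μ) (hs : ContMDiff 𝓘(ℝ, F) 𝓘(ℝ, E →L[ℝ] ℝ) ∞ s)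
    (hw : ContMDiff 𝓘(ℝ, F) (sdModel E) ∞ w) :
    SmoothOneForm (F := F) (cotangentPotential μ s w) := by
  have hb := contMDiff_base hw
  have hm := contMDiff_moment hw
  have had : ContMDiff 𝓘(ℝ, F) 𝓘(ℝ, E →L[ℝ] E) ∞ (fun p => adL G (μ p)) :=
    (adL G).contMDiff.comp hμ
  let T : E →L[ℝ] (E →L[ℝ] ℝ) →L[ℝ] ℝ := ContinuousLinearMap.apply ℝ ℝ
  have hT : ContMDiff 𝓘(ℝ, E) 𝓘(ℝ, (E →L[ℝ] ℝ) →L[ℝ] ℝ) ∞ T := by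
    rw [contMDiff_iff_contDiff]
    exact ContinuousLinearMap.contDiff (𝕜 := ℝ) (E := E) (F := (E →L[ℝ] ℝ) →L[ℝ] ℝ) T
  have hev : ContMDiff 𝓘(ℝ, F) 𝓘(ℝ, (E →L[ℝ] ℝ) →L[ℝ] ℝ) ∞ (fun p => T (μ p)) :=
    ContMDiff.comp (g := T) hT hμ
  -- `w⁻¹δw` in terms of the moment and of `δu u⁻¹` for the base `u` of `w`
  have key : cotangentPotential (F := F) μ s w
      = jdu (fun p => coAd (w p).base⁻¹ (s p - (w p).moment.comp (adL G (μ p))))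
          (fun p => (w p).base)
        - fun p => (T (μ p)).comp
            (dFun (F := F) (fun q => (w q).moment) p) := by
    funext p
    ext X
    change pairing (μ p, s p) (leftMC (F := F) (sdModel E) w p X)
      = (s p - (w p).moment.comp (adL G (μ p))) (Ad 𝓘(ℝ, E) (w p).base⁻¹
          (rightMC (F := F) 𝓘(ℝ, E) (fun q => (w q).base) p X))
        - dFun (F := F) (fun q => (w q).moment) p X (μ p)
    rw [leftMC_semiDual hw, pairing_apply, leftMC_eq ((hb p).mdifferentiableAt (by simp))]
    simp only [sub_apply, ContinuousLinearMap.comp_apply]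
    rw [adL_swap G _ (μ p), map_neg]
    ring
  rw [key]
  refine (SmoothOneForm.jdu (contMDiff_coAd hb.inv ?_) hb).sub (SmoothOneForm.comp_dFun hev hm)
  exact hs.sub (hm.clm_comp had)

end Contributions

/-! ### Evaluation of the words and summation of the contributions -/

section WordLemmas

variable {Q Q' : Type*} [Group Q] [Group Q']

theorem map_prodM (f : Q →* Q') (M : ℕ → Q) (m : ℕ) :
    f (prodM M m) = prodM (fun i => f (M i)) m := by
  induction m with
  | zero => exact map_one f
  | succ m ih => simp only [prodM, map_mul, ih]

theorem map_prodH (f : Q →* Q') (n : ℕ) (M A B : ℕ → Q) (l : ℕ) :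
    f (prodH n M A B l) = prodH n (fun i => f (M i)) (fun i => f (A i)) (fun i => f (B i)) l := by
  induction l with
  | zero => exact map_prodM f M n
  | succ l ih => simp only [prodH, map_mul, map_inv, ih]

theorem map_Kinv (f : Q →* Q') (n : ℕ) (M A B : ℕ → Q) (i : ℕ) :
    f (Kinv n M A B i) = Kinv n (fun i => f (M i)) (fun i => f (A i)) (fun i => f (B i)) i := by
  unfold Kinv
  split_ifs <;> simp only [map_mul, map_prodM, map_prodH]

variable (n : ℕ) (M A B : ℕ → Q)

theorem Kinv_of_le {i : ℕ} (hi : i ≤ n) : Kinv n M A B i = prodM M i := if_pos hi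

theorem Kinv_even (l : ℕ) : Kinv n M A B (n + 2 * l) = prodH n M A B l := by
  unfold Kinv
  rcases Nat.eq_zero_or_pos l with rfl | hl
  · simp [prodH]
  · rw [if_neg (by omega), if_neg (by omega)]
    congr 1
    omega

theorem Kinv_odd (l : ℕ) : Kinv n M A B (n + 2 * l + 1) = A l * prodH n M A B l := by
  have h : (n + 2 * l + 1 - n) / 2 = l := by omega
  unfold Kinv
  rw [if_neg (by omega), if_pos (by omega), h]

end WordLemmas

section Summation

variable {E : Type*} [NormedAddCommGroup E] [NormedSpace ℝ E] [CompleteSpace E]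
  {G : Type*} [TopologicalSpace G] [ChartedSpace E G] [Group G] [LieGroup 𝓘(ℝ, E) ∞ G]
  {F : Type*} [NormedAddCommGroup F] [NormedSpace ℝ F]
  {P : Type*} [TopologicalSpace P] [ChartedSpace F P]

variable (E G) in
/-- The projection `G ⋉ 𝔤* → G`. -/
def SemiDual.baseHom : SemiDual E G →* G where
  toFun := SemiDual.base
  map_one' := SemiDual.base_one
  map_mul' := SemiDual.base_mul

theorem base_prodM (M : ℕ → P → SemiDual E G) (m : ℕ) :
    (fun q => (prodM M m q).base) = prodM (fun i q => (M i q).base) m :=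
  map_prodM ((SemiDual.baseHom E G).compLeft P) M m

theorem base_prodH (n : ℕ) (M A B : ℕ → P → SemiDual E G) (l : ℕ) :
    (fun q => (prodH n M A B l q).base)
      = prodH n (fun i q => (M i q).base) (fun i q => (A i q).base) (fun i q => (B i q).base) l :=
  map_prodH ((SemiDual.baseHom E G).compLeft P) n M A B l

variable {n g : ℕ} {M A B : ℕ → P → SemiDual E G}

variable [IsManifold 𝓘(ℝ, F) ∞ P]

theorem contMDiff_prodM (hM : ∀ i < n, ContMDiff 𝓘(ℝ, F) (sdModel E) ∞ (M i)) :
    ContMDiff 𝓘(ℝ, F) (sdModel E) ∞ (prodM M n) := by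
  induction n with
  | zero => exact contMDiff_const
  | succ n ih => exact contMDiff_pmul (hM n (by omega)) (ih fun i hi => hM i (by omega))

theorem contMDiff_prodH (hM : ∀ i < n, ContMDiff 𝓘(ℝ, F) (sdModel E) ∞ (M i))
    (hA : ∀ i < g, ContMDiff 𝓘(ℝ, F) (sdModel E) ∞ (A i))
    (hB : ∀ i < g, ContMDiff 𝓘(ℝ, F) (sdModel E) ∞ (B i)) :
    ContMDiff 𝓘(ℝ, F) (sdModel E) ∞ (prodH n M A B g) := by
  induction g with
  | zero => exact contMDiff_prodM hM
  | succ g ih =>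
    have a := hA g (by omega)
    have b := hB g (by omega)
    exact contMDiff_pmul (contMDiff_pmul (contMDiff_pmul (contMDiff_pmul b (contMDiff_pinv a))
      (contMDiff_pinv b)) a) (ih (fun i hi => hA i (by omega)) fun i hi => hB i (by omega))

/-- The terms of `Ω` with `K_1, …, K_n` telescope. -/
theorem sum_wedge_prodM (hM : ∀ i < n, ContMDiff 𝓘(ℝ, F) (sdModel E) ∞ (M i)) (p : P) (X Y : F) :
    ∑ i ∈ Finset.range n, wedge (rightMC (F := F) (sdModel E) (prodM M (i + 1))⁻¹ p)
        (rightMC (F := F) (sdModel E) (prodM M i)⁻¹ p) X Y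
      = beta (prodM M n) p X Y - ∑ i ∈ Finset.range n, beta (M i) p X Y
        - 2 * ∑ i ∈ Finset.range n, extD (crossForm (M i) (prodM M i)) p X Y := by
  induction n with
  | zero =>
    have : beta (F := F) (1 : P → SemiDual E G) p X Y = 0 := beta_const 1 X Y
    simp [prodM, this]
  | succ n ih =>
    have h := wedge_rightMC_inv_mul (p := p) (hM n (by omega))
      (contMDiff_prodM fun i hi => hM i (Nat.lt_succ_of_lt hi)) X Y
    simp only [Finset.sum_range_succ]
    rw [ih fun i hi => hM i (by omega), prodM, h]
    ring

/-- The terms of `Ω` with `K_{n+1}, …, K_{n+2g}` and those with the `A_i` and `B_i` telescope. -/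
theorem sum_wedge_prodH (hM : ∀ i < n, ContMDiff 𝓘(ℝ, F) (sdModel E) ∞ (M i))
    (hA : ∀ i < g, ContMDiff 𝓘(ℝ, F) (sdModel E) ∞ (A i))
    (hB : ∀ i < g, ContMDiff 𝓘(ℝ, F) (sdModel E) ∞ (B i)) (p : P) (X Y : F) :
    ∑ i ∈ Finset.range (2 * g),
        wedge (rightMC (F := F) (sdModel E) (Kinv n M A B (n + i + 1))⁻¹ p)
          (rightMC (F := F) (sdModel E) (Kinv n M A B (n + i))⁻¹ p) X Y
      + ∑ i ∈ Finset.range g,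
        (wedge (leftMC (F := F) (sdModel E) (A i) p) (leftMC (F := F) (sdModel E) (B i) p) X Y
          + wedge (rightMC (F := F) (sdModel E) (B i * A i * (B i)⁻¹) p)
            (rightMC (F := F) (sdModel E) (B i) p) X Y)
      = beta (prodH n M A B g) p X Y - beta (prodM M n) p X Y
        - 2 * ∑ i ∈ Finset.range g,
          (extD (crossForm (A i) (prodH n M A B i)
              - crossForm (A i) ((A i)⁻¹ * (B i)⁻¹ * A i * prodH n M A B i)) p X Y
            + extD (crossForm (B i) ((A i)⁻¹ * (B i)⁻¹ * A i * prodH n M A B i)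
              - crossForm (B i) ((B i)⁻¹ * A i * prodH n M A B i)) p X Y) := by
  induction g with
  | zero => simp [prodH]
  | succ g ih =>
    have h := handle (hA g (by omega)) (hB g (by omega))
      (contMDiff_prodH hM (fun i hi => hA i (Nat.lt_succ_of_lt hi))
        fun i hi => hB i (Nat.lt_succ_of_lt hi)) p X Y
    have ih' := ih (fun i hi => hA i (by omega)) fun i hi => hB i (by omega)
    have e : B g * (A g)⁻¹ * (B g)⁻¹ * A g * prodH n M A B g = prodH n M A B (g + 1) := rfl
    rw [e] at h
    rw [show 2 * (g + 1) = 2 * g + 1 + 1 by ring, Finset.sum_range_succ _ (2 * g + 1),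
      Finset.sum_range_succ _ (2 * g)]
    simp only [Finset.sum_range_succ _ g]
    rw [show n + (2 * g + 1) = n + 2 * g + 1 by ring,
      show n + 2 * g + 1 + 1 = n + 2 * (g + 1) by ring, Kinv_odd, Kinv_even, Kinv_even]
    linarith

/-- Without the term that involves `w`, and up to the factor `k/4π`, the two-form `Ω` is twice the
differential of the remaining terms of the potential. -/
theorem sum_contributions {C : ℕ → SemiDual E G} {gM : ℕ → P → SemiDual E G}
    {gInf d : P → SemiDual E G} {μ : P → E} {s : P → E →L[ℝ] ℝ}
    (hgM : ∀ i < n, ContMDiff 𝓘(ℝ, F) (sdModel E) ∞ (gM i))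
    (hMC : ∀ i < n, M i = gM i * (fun _ => (C i)⁻¹) * (gM i)⁻¹)
    (hA : ∀ i < g, ContMDiff 𝓘(ℝ, F) (sdModel E) ∞ (A i))
    (hB : ∀ i < g, ContMDiff 𝓘(ℝ, F) (sdModel E) ∞ (B i))
    (hgInf : ContMDiff 𝓘(ℝ, F) (sdModel E) ∞ gInf) (hd : ContMDiff 𝓘(ℝ, F) (sdModel E) ∞ d)
    (hs : ContMDiff 𝓘(ℝ, F) 𝓘(ℝ, E →L[ℝ] ℝ) ∞ s)
    (hdμ : ∀ p, baseMC (F := F) d p = dFun (F := F) μ p)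
    (hfix : ∀ p X, Ad 𝓘(ℝ, E) (d p).base⁻¹ (dFun (F := F) μ p X) = dFun (F := F) μ p X)
    (hmom : ∀ p, (d p).moment = -s p)
    (hsfix : ∀ p, coAd (d p).base⁻¹ (s p) = s p)
    (hdsfix : ∀ p X, coAd (d p).base⁻¹ (dFun (F := F) s p X) = dFun (F := F) s p X)
    (hsad : ∀ p X ζ, s p (adL G (dFun (F := F) μ p X) ζ) = 0)
    (hK : prodH n M A B g = gInf * d⁻¹ * gInf⁻¹) :
    ∃ θ : P → F →L[ℝ] ℝ, SmoothOneForm θ ∧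
      (θ = ∑ i ∈ Finset.range n, (crossForm (M i) (prodM M i) - crossForm (M i) (gM i))
        + ∑ i ∈ Finset.range g, (crossForm (A i) (prodH n M A B i)
              - crossForm (A i) ((A i)⁻¹ * (B i)⁻¹ * A i * prodH n M A B i))
        + ∑ i ∈ Finset.range g,
            (crossForm (B i) ((A i)⁻¹ * (B i)⁻¹ * A i * prodH n M A B i)
              - crossForm (B i) ((B i)⁻¹ * A i * prodH n M A B i))
        + (crossForm (prodH n M A B g) gInf - fun p =>
            (coAd (gInf p).base (gInf p).2 - (1 / 2 : ℝ) • s p).comp (dFun μ p))) ∧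
      ∀ (p : P) (X Y : F),
        ∑ i ∈ Finset.range n, wedge ((Ad (sdModel E) (C i)).comp
            (leftMC (F := F) (sdModel E) (gM i) p)) (leftMC (F := F) (sdModel E) (gM i) p) X Y
        - ∑ i ∈ Finset.range (n + 2 * g),
          wedge (rightMC (F := F) (sdModel E) (Kinv n M A B (i + 1))⁻¹ p)
            (rightMC (F := F) (sdModel E) (Kinv n M A B i)⁻¹ p) X Y
        - ∑ i ∈ Finset.range g,
          (wedge (leftMC (F := F) (sdModel E) (A i) p) (leftMC (F := F) (sdModel E) (B i) p) X Y
            + wedge (rightMC (F := F) (sdModel E) (B i * A i * (B i)⁻¹) p)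
              (rightMC (F := F) (sdModel E) (B i) p) X Y)
        + wedge (leftMC (F := F) (sdModel E) (Kinv n M A B (n + 2 * g))⁻¹ p)
            (rightMC (F := F) (sdModel E) gInf p) X Y
        + wedge ((dFun (F := F) μ p).prod (dFun (F := F) s p))
            (leftMC (F := F) (sdModel E) gInf p) X Y
        = 2 * extD θ p X Y := by
  have hM : ∀ i < n, ContMDiff 𝓘(ℝ, F) (sdModel E) ∞ (M i) := by
    intro i hi
    rw [hMC i hi]
    exact contMDiff_pmul (contMDiff_pmul (hgM i hi) contMDiff_const) (contMDiff_pinv (hgM i hi))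
  have hN : ∀ i < g, ContMDiff 𝓘(ℝ, F) (sdModel E) ∞ (prodH n M A B i) := fun i hi =>
    contMDiff_prodH hM (fun l hl => hA l (hl.trans hi)) fun l hl => hB l (hl.trans hi)
  have hBAN : ∀ i < g, ContMDiff 𝓘(ℝ, F) (sdModel E) ∞ ((B i)⁻¹ * A i * prodH n M A B i) :=
    fun i hi => contMDiff_pmul (contMDiff_pmul (contMDiff_pinv (hB i hi)) (hA i hi)) (hN i hi)
  have hABAN : ∀ i < g,
      ContMDiff 𝓘(ℝ, F) (sdModel E) ∞ ((A i)⁻¹ * (B i)⁻¹ * A i * prodH n M A B i) :=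
    fun i hi => contMDiff_pmul (contMDiff_pmul (contMDiff_pmul (contMDiff_pinv (hA i hi))
      (contMDiff_pinv (hB i hi))) (hA i hi)) (hN i hi)
  have hKs := contMDiff_prodH hM hA hB
  have hP : ∀ i < n, ContMDiff 𝓘(ℝ, F) (sdModel E) ∞ (prodM M i) := fun i hi =>
    contMDiff_prodM fun l hl => hM l (hl.trans hi)
  obtain ⟨sδ, hδ⟩ := distinguishedPuncture hgInf hd hs hdμ hfix hmom hsfix hdsfix hsad
  have s1 : ∀ i < n, SmoothOneForm (F := F)
      (crossForm (M i) (prodM M i) - crossForm (M i) (gM i)) := fun i hi =>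
    (smooth_crossForm (hM i hi) (hP i hi)).sub (smooth_crossForm (hM i hi) (hgM i hi))
  have s2 : ∀ i < g, SmoothOneForm (F := F) (crossForm (A i) (prodH n M A B i)
      - crossForm (A i) ((A i)⁻¹ * (B i)⁻¹ * A i * prodH n M A B i)) := fun i hi =>
    (smooth_crossForm (hA i hi) (hN i hi)).sub (smooth_crossForm (hA i hi) (hABAN i hi))
  have s3 : ∀ i < g, SmoothOneForm (F := F)
      (crossForm (B i) ((A i)⁻¹ * (B i)⁻¹ * A i * prodH n M A B i)
        - crossForm (B i) ((B i)⁻¹ * A i * prodH n M A B i)) := fun i hi =>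
    (smooth_crossForm (hB i hi) (hABAN i hi)).sub (smooth_crossForm (hB i hi) (hBAN i hi))
  have s4 := smooth_crossForm (F := F) hKs hgInf
  have t1 := SmoothOneForm.sum s1
  have t2 := SmoothOneForm.sum s2
  have t3 := SmoothOneForm.sum s3
  refine ⟨_, ((t1.add t2).add t3).add (s4.sub sδ), rfl, fun p X Y => ?_⟩
  rw [extD_add ((t1.add t2).add t3) (s4.sub sδ), extD_add (t1.add t2) t3, extD_add t1 t2,
    extD_sub s4 sδ, extD_sum s1, extD_sum s2, extD_sum s3, Finset.sum_range_add, Kinv_even]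
  have h1 := sum_wedge_prodM hM p X Y
  have h2 := sum_wedge_prodH hM hA hB p X Y
  have h3 := hδ p X Y
  rw [← hK] at h3
  have h4 : ∑ i ∈ Finset.range n, wedge ((Ad (sdModel E) (C i)).comp
        (leftMC (F := F) (sdModel E) (gM i) p)) (leftMC (F := F) (sdModel E) (gM i) p) X Y
      = ∑ i ∈ Finset.range n, (-beta (M i) p X Y - 2 * extD (crossForm (M i) (gM i)) p X Y) := by
    refine Finset.sum_congr rfl fun i hi => ?_
    have hi := Finset.mem_range.1 hi
    rw [puncture (hgM i hi), ← hMC i hi]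
  have h5 : ∑ i ∈ Finset.range n,
        extD (crossForm (M i) (prodM M i) - crossForm (M i) (gM i)) p X Y
      = ∑ i ∈ Finset.range n, (extD (crossForm (M i) (prodM M i)) p X Y
        - extD (crossForm (M i) (gM i)) p X Y) := by
    refine Finset.sum_congr rfl fun i hi => ?_
    have hi := Finset.mem_range.1 hi
    exact extD_sub (smooth_crossForm (hM i hi) (hP i hi)) (smooth_crossForm (hM i hi) (hgM i hi))
      p X Y
  have h6 : ∑ i ∈ Finset.range n,
        wedge (rightMC (F := F) (sdModel E) (Kinv n M A B (i + 1))⁻¹ p)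
          (rightMC (F := F) (sdModel E) (Kinv n M A B i)⁻¹ p) X Y
      = ∑ i ∈ Finset.range n, wedge (rightMC (F := F) (sdModel E) (prodM M (i + 1))⁻¹ p)
          (rightMC (F := F) (sdModel E) (prodM M i)⁻¹ p) X Y := by
    refine Finset.sum_congr rfl fun i hi => ?_
    have hi := Finset.mem_range.1 hi
    rw [Kinv_of_le n M A B (i := i + 1) (by omega), Kinv_of_le n M A B (by omega)]
  rw [Finset.sum_sub_distrib, Finset.sum_neg_distrib, ← Finset.mul_sum] at h4
  rw [Finset.sum_sub_distrib] at h5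
  simp only [← add_assoc, Finset.sum_add_distrib] at h2 ⊢
  linarith

end Summation

/-! ### Consequences of commutation relations -/

section Commutation

variable {E : Type*} [NormedAddCommGroup E] [NormedSpace ℝ E] [CompleteSpace E]
  {G : Type*} [TopologicalSpace G] [ChartedSpace E G] [Group G] [LieGroup 𝓘(ℝ, E) ∞ G]
  {F : Type*} [NormedAddCommGroup F] [NormedSpace ℝ F]
  {P : Type*} [TopologicalSpace P] [ChartedSpace F P]

theorem IsExp.inv {ξ : E} {c : G} (h : IsExp 𝓘(ℝ, E) ξ c) : IsExp 𝓘(ℝ, E) (-ξ) c⁻¹ := by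
  obtain ⟨φ, h1, rfl⟩ := h.exists_isOneParam
  refine ⟨fun t => φ (-t), fun r t => by simp only [neg_add, h1.1], ?_, h1.map_neg 1⟩
  have h2 : HasFDerivAt (fun r : ℝ => -r) (-ContinuousLinearMap.id ℝ ℝ) 0 :=
    (hasFDerivAt_id (0 : ℝ)).neg
  have h3 := h1.2.comp (hasD_iff_hasFDerivAt.2 h2) neg_zero
  have e : ((ContinuousLinearMap.id ℝ ℝ).smulRight ξ).comp (-ContinuousLinearMap.id ℝ ℝ)
      = (ContinuousLinearMap.id ℝ ℝ).smulRight (-ξ) := by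
    ext; simp
  rw [e] at h3
  exact h3

/-- `[(ξ, 0), (0, s)] = 0` says that `s` vanishes on the image of `ad ξ`. -/
theorem apply_adL_of_sdBracket {ξ : E} {s : E →L[ℝ] ℝ}
    (h : sdBracket G (ξ, 0) (0, s) = 0) (ζ : E) : s (adL G ξ ζ) = 0 := by
  have := congrFun (congrArg Prod.snd h) ζ
  simpa [sdBracket, lieBr_eq] using this

theorem IsExp.coAd_eq {ξ : E} {c : G} (hc : IsExp 𝓘(ℝ, E) ξ c) {s : E →L[ℝ] ℝ}
    (hs : ∀ ζ, s (adL G ξ ζ) = 0) : coAd c s = s := by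
  obtain ⟨φ, h1, rfl⟩ := hc.exists_isOneParam
  ext ζ
  exact h1.apply_Ad_eq s hs 1 ζ

theorem IsExp.Ad_eq {ξ ζ : E} {c : G} (hc : IsExp 𝓘(ℝ, E) ξ c) (h : adL G ξ ζ = 0) :
    Ad 𝓘(ℝ, E) c ζ = ζ := by
  obtain ⟨φ, h1, rfl⟩ := hc.exists_isOneParam
  exact h1.Ad_eq h 1

theorem mk_inv_of_coAd_eq {c : G} {s : E →L[ℝ] ℝ} (h : coAd c s = s) :
    (SemiDual.mk c s)⁻¹ = SemiDual.mk c⁻¹ (-s) :=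
  Prod.ext rfl (congrArg Neg.neg h)

/-- A linear equation satisfied by all values of a function is satisfied by its derivative. -/
theorem dFun_of_apply_eq_zero {W W' : Type*} [NormedAddCommGroup W] [NormedSpace ℝ W]
    [NormedAddCommGroup W'] [NormedSpace ℝ W'] {f : P → W} {p : P}
    (hf : MDifferentiableAt 𝓘(ℝ, F) 𝓘(ℝ, W) f p) (T : W →L[ℝ] W') (hT : ∀ q, T (f q) = 0)
    (X : F) : T (dFun (F := F) f p X) = 0 := by
  have h1 := (hasD_iff_hasFDerivAt.2 T.hasFDerivAt).comp (hasD_dFun (F := F) hf) rfl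
  simp only [hT] at h1
  exact DFunLike.congr_fun (h1.unique (hasD_const (0 : W') p)) X

end Commutation

end FlatConn

end

theorem theorem1
    {E : Type*} [NormedAddCommGroup E] [NormedSpace ℝ E] [FiniteDimensional ℝ E]
    {G : Type*} [TopologicalSpace G] [ChartedSpace E G] [Group G] [LieGroup 𝓘(ℝ, E) ∞ G]
    -- the manifold `P` that carries the variables
    {F : Type*} [NormedAddCommGroup F] [NormedSpace ℝ F] [FiniteDimensional ℝ F]
    {P : Type*} [TopologicalSpace P] [ChartedSpace F P] [IsManifold 𝓘(ℝ, F) ∞ P]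
    (k : ℝ) (n g : ℕ)
    -- the abelian subalgebra `𝔠 = 𝔱 ⊕ 𝔱'` of `𝔤 ⊕ 𝔤*`
    (cs : Submodule ℝ (E × (E →L[ℝ] ℝ)))
    (hcs_abelian : ∀ z ∈ cs, ∀ z' ∈ cs, FlatConn.sdBracket G z z' = 0)
    (hcs_graded : ∀ z ∈ cs, (z.1, (0 : E →L[ℝ] ℝ)) ∈ cs)
    -- the constants `(μᵢ, sᵢ)` and `cM i = exp μᵢ` at the ordinary punctures
    (μM : ℕ → E) (sM : ℕ → E →L[ℝ] ℝ) (cM : ℕ → G)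
    (hμM : ∀ i < n, FlatConn.sdBracket G (μM i, 0) (0, sM i) = 0)
    (hcM : ∀ i < n, FlatConn.IsExp 𝓘(ℝ, E) (μM i) (cM i))
    -- the holonomies `Mᵢ`, with `gᵢ = (vᵢ, xᵢ)`
    (vM : ℕ → P → G) (xM : ℕ → P → E →L[ℝ] ℝ) (uM : ℕ → P → G) (jM : ℕ → P → E →L[ℝ] ℝ)
    (hvM : ∀ i < n, ContMDiff 𝓘(ℝ, F) 𝓘(ℝ, E) ∞ (vM i))
    (hxM : ∀ i < n, ContMDiff 𝓘(ℝ, F) 𝓘(ℝ, E →L[ℝ] ℝ) ∞ (xM i))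
    (hM : ∀ i < n, ∀ p, FlatConn.ofUJ (uM i p) (jM i p) =
      FlatConn.SemiDual.mk (vM i p) (xM i p) * FlatConn.SemiDual.mk (cM i)⁻¹ (-sM i) *
        (FlatConn.SemiDual.mk (vM i p) (xM i p))⁻¹)
    -- the holonomies `Aᵢ`, `Bᵢ`
    (uA : ℕ → P → G) (jA : ℕ → P → E →L[ℝ] ℝ) (uB : ℕ → P → G) (jB : ℕ → P → E →L[ℝ] ℝ)
    (huA : ∀ i < g, ContMDiff 𝓘(ℝ, F) 𝓘(ℝ, E) ∞ (uA i))
    (hjA : ∀ i < g, ContMDiff 𝓘(ℝ, F) 𝓘(ℝ, E →L[ℝ] ℝ) ∞ (jA i))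
    (huB : ∀ i < g, ContMDiff 𝓘(ℝ, F) 𝓘(ℝ, E) ∞ (uB i))
    (hjB : ∀ i < g, ContMDiff 𝓘(ℝ, F) 𝓘(ℝ, E →L[ℝ] ℝ) ∞ (jB i))
    -- the variables `w` and `(μ, s) ∈ 𝔠`, and `c = exp (-μ)`
    (w : P → FlatConn.SemiDual E G) (hw : ContMDiff 𝓘(ℝ, F) (FlatConn.sdModel E) ∞ w)
    (μ : P → E) (s : P → E →L[ℝ] ℝ) (c : P → G)
    (hμ : ContMDiff 𝓘(ℝ, F) 𝓘(ℝ, E) ∞ μ) (hs : ContMDiff 𝓘(ℝ, F) 𝓘(ℝ, E →L[ℝ] ℝ) ∞ s)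
    (hμs : ∀ p, (μ p, s p) ∈ cs)
    (hc : ∀ p, FlatConn.IsExp 𝓘(ℝ, E) (-μ p) (c p))
    -- the holonomy around the distinguished puncture, with `g_∞ = (v_∞, x_∞)`
    (vInf : P → G) (xInf : P → E →L[ℝ] ℝ) (uK : P → G) (jK : P → E →L[ℝ] ℝ)
    (hvInf : ContMDiff 𝓘(ℝ, F) 𝓘(ℝ, E) ∞ vInf)
    (hxInf : ContMDiff 𝓘(ℝ, F) 𝓘(ℝ, E →L[ℝ] ℝ) ∞ xInf)
    (hK : ∀ p, FlatConn.ofUJ (uK p) (jK p) =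
      FlatConn.prodH n (fun i => FlatConn.ofUJ (uM i p) (jM i p))
        (fun i => FlatConn.ofUJ (uA i p) (jA i p)) (fun i => FlatConn.ofUJ (uB i p) (jB i p)) g)
    (hInf : ∀ p, FlatConn.ofUJ (uK p) (jK p) =
      FlatConn.SemiDual.mk (vInf p) (xInf p) * FlatConn.SemiDual.mk (c p) (-s p) *
        (FlatConn.SemiDual.mk (vInf p) (xInf p))⁻¹) :
    FlatConn.SmoothOneForm (F := F)
      (FlatConn.potential n g vM uM jM uA jA uB jB jK vInf xInf w μ s) ∧
    ∀ (p : P) (X Y : F),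
      FlatConn.Omega k n g (fun i => FlatConn.SemiDual.mk (cM i) (sM i))
        (fun i q => FlatConn.SemiDual.mk (vM i q) (xM i q))
        (fun i q => FlatConn.ofUJ (uM i q) (jM i q))
        (fun i q => FlatConn.ofUJ (uA i q) (jA i q))
        (fun i q => FlatConn.ofUJ (uB i q) (jB i q))
        (fun q => FlatConn.SemiDual.mk (vInf q) (xInf q)) w μ s p X Y
      = k / (2 * Real.pi) *
        FlatConn.extD
          (FlatConn.potential n g vM uM jM uA jA uB jB jK vInf xInf w μ s) p X Y := by
  open FlatConn in
  have : CompleteSpace E := FiniteDimensional.complete ℝ E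
  -- the consequences of `𝔠` being abelian and graded
  have hab : ∀ q q', adL G (μ q) (μ q') = 0 := fun q q' => by
    have := congrArg Prod.fst (hcs_abelian _ (hμs q) _ (hμs q'))
    simpa [sdBracket, lieBr_eq] using this
  have hsμ : ∀ p q ζ, s p (adL G (μ q) ζ) = 0 := fun p q ζ => by
    have := congrFun (congrArg Prod.snd (hcs_abelian _ (hcs_graded _ (hμs q)) _ (hμs p))) ζ
    simpa [sdBracket, lieBr_eq] using this
  have mμ : ∀ p, MDifferentiableAt 𝓘(ℝ, F) 𝓘(ℝ, E) μ p := fun p =>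
    (hμ p).mdifferentiableAt (by simp)
  have ms : ∀ p, MDifferentiableAt 𝓘(ℝ, F) 𝓘(ℝ, E →L[ℝ] ℝ) s p := fun p =>
    (hs p).mdifferentiableAt (by simp)
  have hcs : ∀ p, coAd (c p) (s p) = s p := fun p =>
    (hc p).coAd_eq fun ζ => by simp [hsμ]
  have hcis : ∀ p, coAd (c p)⁻¹ (s p) = s p := fun p => by
    rw [← hcs p, coAd_inv_coAd, hcs]
  have hcds : ∀ p X, coAd (c p) (dFun (F := F) s p X) = dFun (F := F) s p X := fun p X =>
    (hc p).coAd_eq fun ζ => dFun_of_apply_eq_zero (ms p)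
      (ContinuousLinearMap.apply ℝ ℝ (adL G (-μ p) ζ)) (fun q => by simp [hsμ]) X
  have hcdμ : ∀ p X, Ad 𝓘(ℝ, E) (c p) (dFun (F := F) μ p X) = dFun (F := F) μ p X := fun p X =>
    (hc p).Ad_eq (dFun_of_apply_eq_zero (mμ p) (adL G (-μ p)) (fun q => by simp [hab]) X)
  have hsad : ∀ p X ζ, s p (adL G (dFun (F := F) μ p X) ζ) = 0 := fun p X ζ =>
    dFun_of_apply_eq_zero (mμ p) ((s p).comp ((adL G).flip ζ)) (fun q => by simp [hsμ]) X
  have hRc : ∀ p, rightMC (F := F) 𝓘(ℝ, E) (fun q => (c q)⁻¹) p = dFun (F := F) μ p := fun p =>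
    rightMC_exp (mμ p) hab fun q => by simpa using (hc q).inv
  -- the functions with values in `G ⋉ 𝔤*`
  set gM : ℕ → P → SemiDual E G := fun i q => SemiDual.mk (vM i q) (xM i q) with hgMdef
  set M : ℕ → P → SemiDual E G := fun i q => ofUJ (uM i q) (jM i q) with hMdef
  set A : ℕ → P → SemiDual E G := fun i q => ofUJ (uA i q) (jA i q) with hAdef
  set B : ℕ → P → SemiDual E G := fun i q => ofUJ (uB i q) (jB i q) with hBdef
  set gInf : P → SemiDual E G := fun q => SemiDual.mk (vInf q) (xInf q) with hgInfdef
  set d : P → SemiDual E G := fun q => SemiDual.mk (c q)⁻¹ (s q) with hddef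
  have hgM : ∀ i < n, ContMDiff 𝓘(ℝ, F) (sdModel E) ∞ (gM i) := fun i hi =>
    contMDiff_semiDual_mk (hvM i hi) (hxM i hi)
  have hA : ∀ i < g, ContMDiff 𝓘(ℝ, F) (sdModel E) ∞ (A i) := fun i hi =>
    contMDiff_ofUJ (huA i hi) (hjA i hi)
  have hB : ∀ i < g, ContMDiff 𝓘(ℝ, F) (sdModel E) ∞ (B i) := fun i hi =>
    contMDiff_ofUJ (huB i hi) (hjB i hi)
  have hgInf : ContMDiff 𝓘(ℝ, F) (sdModel E) ∞ gInf := contMDiff_semiDual_mk hvInf hxInf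
  have hMC : ∀ i < n, M i = gM i * (fun _ => (SemiDual.mk (cM i) (sM i))⁻¹) * (gM i)⁻¹ := by
    intro i hi
    rw [mk_inv_of_coAd_eq ((hcM i hi).coAd_eq (apply_adL_of_sdBracket (hμM i hi)))]
    exact funext (hM i hi)
  have hMs : ∀ i < n, ContMDiff 𝓘(ℝ, F) (sdModel E) ∞ (M i) := by
    intro i hi
    rw [hMC i hi]
    exact contMDiff_pmul (contMDiff_pmul (hgM i hi) contMDiff_const) (contMDiff_pinv (hgM i hi))
  have hKeq : ∀ p, ofUJ (uK p) (jK p) = prodH n M A B g p := fun p =>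
    (hK p).trans (map_prodH (Pi.evalMonoidHom (fun _ : P => SemiDual E G) p) n M A B g).symm
  have hdinv : ∀ p, (d p)⁻¹ = SemiDual.mk (c p) (-s p) := fun p => by
    rw [hddef, mk_inv_of_coAd_eq (hcis p), inv_inv]
  have hKd : prodH n M A B g = gInf * d⁻¹ * gInf⁻¹ := by
    funext p
    rw [← hKeq, hInf, ← hdinv]
    rfl
  have hKs := contMDiff_prodH hMs hA hB
  -- smoothness of `c = exp (-μ)` is read off from the constraint
  have hd : ContMDiff 𝓘(ℝ, F) (sdModel E) ∞ d := by
    have e : d = gInf⁻¹ * (prodH n M A B g)⁻¹ * gInf := by rw [hKd]; group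
    rw [e]
    exact contMDiff_pmul (contMDiff_pmul (contMDiff_pinv hgInf) (contMDiff_pinv hKs)) hgInf
  obtain ⟨θ, hθ, hθeq, hsum⟩ := sum_contributions (d := d) (μ := μ) (s := s) hgM hMC hA hB hgInf
    hd hs hRc (fun p X => by simpa [hddef] using hcdμ p X)
    (fun p => by rw [hddef, SemiDual.moment_mk, hcis]) (fun p => by simpa [hddef] using hcs p)
    (fun p X => by simpa [hddef] using hcds p X) hsad hKd
  have hW := smooth_cotangentPotential (F := F) hμ hs hw
  have mom : ∀ (u : P → G) (j : P → E →L[ℝ] ℝ), (fun q => (ofUJ (u q) (j q)).moment) = j :=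
    fun u j => funext fun q => SemiDual.moment_ofUJ _ _
  have mM : ∀ i, (fun q => (M i q).moment) = jM i := fun i => mom _ _
  have mA : ∀ i, (fun q => (A i q).moment) = jA i := fun i => mom _ _
  have mB : ∀ i, (fun q => (B i q).moment) = jB i := fun i => mom _ _
  have mK : (fun q => (prodH n M A B g q).moment) = jK := by
    simp only [← hKeq]
    exact mom _ _
  have hpot : potential n g vM uM jM uA jA uB jB jK vInf xInf w μ s
      = cotangentPotential (F := F) μ s w + θ := by
    have bP : ∀ i, (fun q => (prodM M i q).base) = prodM uM i := fun i => base_prodM M i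
    have bN : ∀ i, (fun q => (prodH n M A B i q).base) = prodH n uM uA uB i := fun i =>
      base_prodH n M A B i
    have bAN : ∀ i, (fun q => (((A i)⁻¹ * (B i)⁻¹ * A i * prodH n M A B i) q).base)
        = (uA i)⁻¹ * (uB i)⁻¹ * uA i * prodH n uM uA uB i := fun i => by
      rw [← bN]; rfl
    have bBN : ∀ i, (fun q => (((B i)⁻¹ * A i * prodH n M A B i) q).base)
        = (uB i)⁻¹ * uA i * prodH n uM uA uB i := fun i => by
      rw [← bN]; rfl
    have bg : ∀ i q, (gM i q).base = vM i q := fun i q => rfl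
    have bInf : ∀ q, (gInf q).base = vInf q := fun q => rfl
    have xInf' : ∀ q, (gInf q).2 = xInf q := fun q => rfl
    rw [hθeq]
    simp only [crossForm, mM, mA, mB, mK, bP, bN, bAN, bBN, bg, bInf, xInf']
    funext p
    simp only [potential, Theta, Pi.add_apply, Pi.sub_apply, Finset.sum_apply]
    abel
  rw [hpot]
  refine ⟨hW.add hθ, fun p X Y => ?_⟩
  have hKinv : ∀ i, (fun q => (Kinv n (fun l => M l q) (fun l => A l q) (fun l => B l q) i)⁻¹)
      = (Kinv n M A B i)⁻¹ := fun i => funext fun q =>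
    congrArg _ (map_Kinv (Pi.evalMonoidHom (fun _ : P => SemiDual E G) q) n M A B i).symm
  have hBAB : ∀ i, (fun q => B i q * A i q * (B i q)⁻¹) = B i * A i * (B i)⁻¹ := fun i => rfl
  have hsum := hsum p X Y
  rw [extD_add hW hθ]
  simp only [Omega, hKinv, hBAB]
  have h4 : k / (4 * Real.pi) = k / (2 * Real.pi) / 2 := by ring
  rw [h4]
  linear_combination (k / (2 * Real.pi) / 2) * hsum
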